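/- Let $K,M\ge 1$ be the numbers of content creators and users, and let $\mathbb B^d=\{x\in\mathbb R^d:\|x\|_2\le 1,\ x_i\ge 0\ \forall i\}\subset[0,1]^d$. **Setting (full recommendation).** A market consists of a content set $\mathcal C\subseteq\mathbb B^d$, random rewards $R(j,c)\in[0,1]$ for users $j\in[M]$ and contents $c\in\mathcal C$, and costs $l_k:\mathcal C\to\mathbb R$ for $k\in[K]$. In each round $t=1,\dots,T$ the platform posts a contract $f_t:\mathcal C\times\mathbb R\to\mathbb R$ from a given family $\mathcal F$. Creator $k$ produces a best response $c_k(f_t)\in\operatorname{argmax}_{c\in\mathcal C}\ \mathbb E\big[f_t\big(c,\sum_{j}R(j,c)\big)\big]-l_k(c)$ (assumed to exist; ties broken by a fixed measurable rule). Every item is shown to every user. The platform observes all contents $c_k(f_t)$ and fresh samples of all rewards $R(j,c_k(f_t))$; the samples are independent across rounds, and the rewards within one round may depend on each other arbitrarily. The platform's utility is $u(f)=\mathbb E\big[\sum_{k}\big(R_k-f(c_k(f),R_k)\big)\big]$ with $R_k=\sum_j R(j,c_k(f))$. The expected regret of a (possibly randomized) algorithm, which chooses $f_t$ from the observations of the previous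 rounds without knowing the market, is $\mathbb E\big[\sum_{t=1}^T\big(\sup_{f\in\mathcal F}u(f)-u(f_t)\big)\big]$. The horizon $T$ is known to the algorithm. **(1) Return-based contracts**, $f(c,r)=\alpha r$ with $\alpha\in[0,1]$: the worst-case expected regret is $\Theta(T^{2/3})$. That is, there are constants $a,b>0$ depending only on $K,M$ such that for all $d,T\ge 1$ some algorithm has expected regret at most $bT^{2/3}$ on every market, and for every algorithm there is a market with $\mathcal C=\mathbb B^d$, for which an optimal $\alpha$ exists, where its expected regret is at least $aT^{2/3}$. **(2) Linear feature-based contracts**, $f(c,r)=\theta^\top c$ with $\theta\in\mathbb B^d$, $\mathcal C=\mathbb B^d$ and $\mathbb E[R(j,c)]=u_j^\top c$ for unknown vectors $u_j$ such that the expected total reward $c\mapsto\sum_j u_j^\top c$ itself belongs to the contract family, i.e. $\sum_{j=1}^M u_j\in\mathbb B^d$: for every $d\ge 1$ there is a constant $b$ depending only on $d,K,M$ such that for every $T\ge 1$ some algorithm has expected regret at most $b\,T^{2d/(2d+1)}$ on every such market. -/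

import Mathlib

open MeasureTheory

/-- The space `ℝ^d` with the Euclidean norm. -/
abbrev Vec (d : ℕ) : Type := EuclideanSpace ℝ (Fin d)

/-- `𝔹^d ⊆ [0,1]^d`: the vectors of Euclidean norm at most one with nonnegative coordinates. -/
def unitBall (d : ℕ) : Set (Vec d) := {x | ‖x‖ ≤ 1 ∧ ∀ i, 0 ≤ x i}

/-- A creator economy with `K` creators, `M` users and full recommendation, in which the platform
posts contracts from a family `pay` indexed by `X`: under the contract `x`, a content `c` with
total reward `r` is paid `pay x c r`. The creators best-respond to the posted contract. -/
structure CreatorMarket (d K M : ℕ) {X : Type} [MeasurableSpace X]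
    (pay : X → Vec d → ℝ → ℝ) where
  /-- The set of possible contents. -/
  C : Set (Vec d)
  C_subset : C ⊆ unitBall d
  /-- The joint law of the rewards `(R(j, c))_j` which the `M` users give to the content `c`. -/
  rewardLaw : C → Measure (Fin M → ℝ)
  /-- The source of randomness of one round. -/
  Noise : Type
  [noiseSpace : MeasurableSpace Noise]
  noise : Measure Noise
  [noise_prob : IsProbabilityMeasure noise]
  /-- `reward c ω j k` is the reward of user `j` for the item `c k` of creator `k`, when the
  contents of the round are `c` and its noise is `ω`. Any dependence between the rewards of one
  round is allowed. -/
  reward : (Fin K → C) → Noise → Fin M → Fin K → ℝ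
  measurable_reward : Measurable fun p : (Fin K → C) × Noise => reward p.1 p.2
  reward_mem : ∀ c ω j k, reward c ω j k ∈ Set.Icc (0 : ℝ) 1
  map_reward : ∀ c k, noise.map (fun ω j => reward c ω j k) = rewardLaw (c k)
  /-- `cost k c` is the cost for creator `k` of creating the content `c`. -/
  cost : Fin K → C → ℝ
  /-- `response k x` is the content that creator `k` creates under the contract `x`. -/
  response : Fin K → X → C
  measurable_response : ∀ k, Measurable (response k)
  /-- The created content maximizes the expected payment minus the cost. -/
  response_optimal : ∀ k x c,
    (∫ r, pay x (c : Vec d) (∑ j, r j) ∂(rewardLaw c)) - cost k c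
      ≤ (∫ r, pay x (response k x : Vec d) (∑ j, r j) ∂(rewardLaw (response k x)))
          - cost k (response k x)

/-- What the platform observes in one round: the contract it posted, the contents created, and
the reward of every user for every item. -/
abbrev RoundRecord (X : Type) (d K M : ℕ) : Type :=
  X × (Fin K → Vec d) × (Fin M → Fin K → ℝ)

/-- A (possibly randomized) online algorithm: it draws a seed once, independently of the market,
and in every round chooses the contract from the seed and the records of the previous rounds. -/
structure Algorithm (X : Type) [MeasurableSpace X] (d K M : ℕ) where
  Seed : Type
  [seedSpace : MeasurableSpace Seed]
  seedLaw : Measure Seed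
  [seed_prob : IsProbabilityMeasure seedLaw]
  act : (t : ℕ) → Seed → (Fin t → RoundRecord X d K M) → X
  measurable_act : ∀ t, Measurable fun p : Seed × (Fin t → RoundRecord X d K M) => act t p.1 p.2

attribute [instance] CreatorMarket.noiseSpace CreatorMarket.noise_prob
  Algorithm.seedSpace Algorithm.seed_prob

noncomputable section

namespace CreatorMarket

variable {d K M : ℕ} {X : Type} [MeasurableSpace X] {pay : X → Vec d → ℝ → ℝ}

/-- The expected reward `𝔼[R(j, c)]`. -/
def meanReward (E : CreatorMarket d K M pay) (j : Fin M) (c : E.C) : ℝ :=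
  ∫ r, r j ∂(E.rewardLaw c)

/-- The expected utility of the platform under the contract `x`: total reward minus payment,
summed over the creators. -/
def utility (E : CreatorMarket d K M pay) (x : X) : ℝ :=
  ∑ k, ∫ r, ((∑ j, r j) - pay x (E.response k x : Vec d) (∑ j, r j))
    ∂(E.rewardLaw (E.response k x))

/-- The optimal utility over the contract family. -/
def optimum (E : CreatorMarket d K M pay) : ℝ := ⨆ x, E.utility x

/-- The record of a round in which the contract `x` is posted and the noise is `ω`. -/
def observe (E : CreatorMarket d K M pay) (x : X) (ω : E.Noise) : RoundRecord X d K M :=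
  (x, fun k => (E.response k x : Vec d), E.reward (fun k => E.response k x) ω)

/-- The records of the first `t` rounds, when the seed is `s` and the noise is `ω`. -/
def history (E : CreatorMarket d K M pay) (A : Algorithm X d K M) (s : A.Seed)
    (ω : ℕ → E.Noise) : (t : ℕ) → Fin t → RoundRecord X d K M
  | 0 => Fin.elim0
  | t + 1 => Fin.snoc (α := fun _ => RoundRecord X d K M) (history E A s ω t)
      (E.observe (A.act t s (history E A s ω t)) (ω t))

/-- The contract posted in round `t` (rounds are numbered from `0`). -/
def contract (E : CreatorMarket d K M pay) (A : Algorithm X d K M) (s : A.Seed)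
    (ω : ℕ → E.Noise) (t : ℕ) : X :=
  A.act t s (E.history A s ω t)

/-- The expected regret over `T` rounds, with independent identically distributed noise. -/
def regret (E : CreatorMarket d K M pay) (A : Algorithm X d K M) (T : ℕ) : ℝ :=
  ∫ p : A.Seed × (ℕ → E.Noise),
    (∑ t ∈ Finset.range T, (E.optimum - E.utility (E.contract A p.1 p.2 t)))
    ∂(A.seedLaw.prod (Measure.infinitePi fun _ : ℕ => E.noise))

end CreatorMarket

/-- The return-based contracts `f(c, r) = α r`, `α ∈ [0, 1]`. -/
def returnPay (d : ℕ) (α : Set.Icc (0 : ℝ) 1) (_c : Vec d) (r : ℝ) : ℝ := (α : ℝ) * r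

/-- The linear feature-based contracts `f(c, r) = θᵀ c`, `θ ∈ 𝔹^d`. -/
def linearPay (d : ℕ) (θ : unitBall d) (c : Vec d) (_r : ℝ) : ℝ := inner ℝ (θ : Vec d) c

end

/-! ### Fresh noise, and concentration for adaptively sampled sums. -/

section Fresh

variable {S Y : Type}

/-! Return-based contracts, lower bound. Every monotone curve `m` with values in `[0,1]` is the
mean-reward curve of some market: with cost `M (x m(x) - ∫₀ˣ m)`, the content `α e₀` is a best
answer to the contract `α`, because `(α - x) m(x) ≤ ∫ₓ^α m`. The platform then earns `K M (1 - α)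
m(α)`. The choice `m(α) = 1/(4(1-α))` on `[0, 1/2]` makes all contracts there equally good. Lifting
`m` on a window of length `ε` to its value at the right end keeps it monotone, makes the left end of
the window better than everything outside by order `ε`, and moves the Bernoulli means by at most
`ε`. All users and creators share one coin, so a round carries one bit. Among `8n` windows some
window is visited at most `T/(8n)` times in expectation in the unlifted market. With `ε = 1/(16n)`
the divergence of the two transcripts is `O(T/n³)`. For `n` of order `T^(1/3)` the algorithm
therefore misses the lifted window in at least half of the rounds on average, at a price of order
`T^(-1/3)` per miss. See `integral_history_change_measure`, `integral_count_le_of_close` and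
`exists_market_le_regret`.

Return-based contracts, upper bound. Best responses to larger `α` have larger expected reward, so
rounding `α` up to a grid of mesh `1/N` loses at most `K M / N` (`utility_le_of_le`). A bandit with
`N + 1` arms, `N` of order `T^(1/3)`, remains, and its regret must be free of logarithms. The index
policy recomputes an empirical mean only after `16^L` pulls. For target precision `4^(-h)`, the
width at level `L` is at least `2^|h-L|` times the deviation scale `4^(-L)`, and a fourth-moment
bound turns the expected failures over all levels into a geometric series
(`regret_le_of_armIndex_le`, `integral_bandit_regret_le`).

Linear contracts. With `v` the sum of the `u_j`, the utility of `θ` is `⟨v - θ, C(θ)⟩`, where the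
total content `C(θ)` is observed without noise. Playing each grid contract once reveals all `C(θ)`.
By `exists_measurable_spanner`, the unknown numbers `⟨v, C(θ)⟩` are then, up to a small error,
combinations of `d` of them with coefficients in `[-1,1]`; each of these is estimated from `r²`
rounds, and the best estimate is played from then on. The utility may jump in `θ`, but a grid
contract near `(1-δ)θ + δv` is nearly as good as `θ`, by monotonicity of best responses
(`exists_gridVector_utility`). The choice of `r` of order `T^(1/(2d+1))` balances `r^(2d)`
exploration rounds against the loss `T/r`. -/

/-- `f` depends on the noise sequence only through the rounds before `t`. -/
def DependsOnPast {α : Type} (t : ℕ) (f : S × (ℕ → Y) → α) : Prop :=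
  ∀ s ω ω', (∀ r < t, ω r = ω' r) → f (s, ω) = f (s, ω')

theorem DependsOnPast.update {α : Type} {t : ℕ} {f : S × (ℕ → Y) → α} (h : DependsOnPast t f)
    (s : S) (ω : ℕ → Y) (z : Y) : f (s, Function.update ω t z) = f (s, ω) :=
  h s _ _ fun _ hr => Function.update_of_ne hr.ne _ _

variable [MeasurableSpace S] [MeasurableSpace Y]

/-- This is the form in which independence is used: a quantity blind to coordinate `t` cannot tell
the resampled sequence from the original one. On cylinders, coordinate `t` takes its factor from the
second component. -/
theorem map_update_infinitePi (ν : Measure Y) [IsProbabilityMeasure ν] (t : ℕ) :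
    ((Measure.infinitePi fun _ : ℕ => ν).prod ν).map
      (fun p : (ℕ → Y) × Y => Function.update p.1 t p.2) = Measure.infinitePi fun _ : ℕ => ν := by
  have hm : Measurable fun p : (ℕ → Y) × Y => Function.update p.1 t p.2 := by
    refine measurable_pi_iff.2 fun i => ?_
    rcases eq_or_ne i t with rfl | hi
    · simpa using measurable_snd
    · simp only [Function.update_of_ne hi]; fun_prop
  refine Measure.eq_infinitePi _ fun s A hA => ?_
  rw [Measure.map_apply hm (.pi s.countable_toSet fun i _ => hA i)]
  by_cases ht : t ∈ s
  · have : (fun p : (ℕ → Y) × Y => Function.update p.1 t p.2) ⁻¹' (Set.pi s A)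
        = (Set.pi (s.erase t) A) ×ˢ A t := by
      ext p
      simp only [Set.mem_preimage, Set.mem_pi, Finset.mem_coe, Set.mem_prod, Finset.mem_erase]
      constructor
      · intro h
        exact ⟨fun i hi => by simpa [Function.update_of_ne hi.1] using h i hi.2,
          by simpa using h t ht⟩
      · intro h i hi
        rcases eq_or_ne i t with rfl | hit
        · simpa using h.2
        · simpa [Function.update_of_ne hit] using h.1 i ⟨hit, hi⟩
    rw [this, Measure.prod_prod, Measure.infinitePi_pi _ fun i _ => hA i,
      Finset.prod_erase_mul _ _ ht]
  · have : (fun p : (ℕ → Y) × Y => Function.update p.1 t p.2) ⁻¹' (Set.pi s A)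
        = (Set.pi s A) ×ˢ Set.univ := by
      ext p
      simp only [Set.mem_preimage, Set.mem_pi, Finset.mem_coe, Set.mem_prod, Set.mem_univ,
        and_true]
      refine forall₂_congr fun i hi => ?_
      rw [Function.update_of_ne (by rintro rfl; exact ht hi)]
    rw [this, Measure.prod_prod, Measure.infinitePi_pi _ fun i _ => hA i, measure_univ, mul_one]

theorem integrable_of_abs_le {Ω : Type} [MeasurableSpace Ω] {P : Measure Ω}
    [IsProbabilityMeasure P] {f : Ω → ℝ} (hf : Measurable f) {C : ℝ} (hC : ∀ x, |f x| ≤ C) :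
    Integrable f P :=
  Integrable.of_bound hf.aestronglyMeasurable C (Filter.Eventually.of_forall hC)

/-- The noise of round `t` may be integrated out in a quantity that otherwise depends on the
past. -/
theorem integral_fresh (σ : Measure S) [IsProbabilityMeasure σ] (ν : Measure Y)
    [IsProbabilityMeasure ν] (t : ℕ) (F : (S × (ℕ → Y)) × Y → ℝ) (hF : Measurable F)
    {C : ℝ} (hC : ∀ p, |F p| ≤ C) (hpast : ∀ y, DependsOnPast t fun p => F (p, y)) :
    ∫ p, F (p, p.2 t) ∂(σ.prod (Measure.infinitePi fun _ : ℕ => ν))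
      = ∫ p, (∫ y, F (p, y) ∂ν) ∂(σ.prod (Measure.infinitePi fun _ : ℕ => ν)) := by
  have hm : Measurable fun p : (ℕ → Y) × Y => Function.update p.1 t p.2 := by
    refine measurable_pi_iff.2 fun i => ?_
    rcases eq_or_ne i t with rfl | hi
    · simpa using measurable_snd
    · simp only [Function.update_of_ne hi]; fun_prop
  rw [integral_prod, integral_prod]
  · congr 1
    ext s
    have hFs : Measurable fun ω : ℕ → Y => F ((s, ω), ω t) := by fun_prop
    -- Pass to the resampled sequence: the last argument of `F` becomes the new sample, and by
    -- `hpast` the first argument does not notice the replacement.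
    conv_lhs => rw [← map_update_infinitePi ν t]
    rw [integral_map hm.aemeasurable hFs.aestronglyMeasurable, integral_prod]
    · refine integral_congr_ae (Filter.Eventually.of_forall fun ω => ?_)
      refine integral_congr_ae (Filter.Eventually.of_forall fun y => ?_)
      simp only [Function.update_self]
      exact (hpast y).update s ω y
    · exact integrable_of_abs_le (hFs.comp hm) fun p => hC _
  · refine integrable_of_abs_le (C := C) ?_ fun p => ?_
    · exact (hF.stronglyMeasurable.integral_prod_right' (ν := ν)).measurable
    · have h := norm_integral_le_of_norm_le_const (μ := ν) (f := fun y => F (p, y)) (C := C)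
        (Filter.Eventually.of_forall fun y => hC (p, y))
      simpa using h
  · exact integrable_of_abs_le (by fun_prop) fun p => hC _

/-- The process `exp (l ∑ q - c ∑ g)` is a supermartingale by Hoeffding's lemma applied to the fresh
noise of each round; the sure bound `∑ g ≤ n` then removes the compensator. Here `g` plays the role
of the predictable indicator of the rounds that are counted. -/
theorem integral_exp_sum_le (σ : Measure S) [IsProbabilityMeasure σ] (ν : Measure Y)
    [IsProbabilityMeasure ν] (q : ℕ → (S × (ℕ → Y)) × Y → ℝ) (g : ℕ → S × (ℕ → Y) → ℝ)
    {D : ℝ} (hD : 0 ≤ D) (hq : ∀ t, Measurable (q t)) (hg : ∀ t, Measurable (g t))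
    (hqp : ∀ t y, DependsOnPast t fun p => q t (p, y)) (hgp : ∀ t, DependsOnPast t (g t))
    (hg01 : ∀ t p, g t p = 0 ∨ g t p = 1) (hb : ∀ t p y, |q t (p, y)| ≤ D * g t p)
    (hz : ∀ t p, ∫ y, q t (p, y) ∂ν = 0) (T : ℕ) {n : ℝ}
    (hn : ∀ p, ∑ t ∈ Finset.range T, g t p ≤ n) (l : ℝ) :
    ∫ p, Real.exp (l * ∑ t ∈ Finset.range T, q t (p, p.2 t))
      ∂(σ.prod (Measure.infinitePi fun _ : ℕ => ν)) ≤ Real.exp (l ^ 2 * D ^ 2 / 2 * n) := by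
  set c := l ^ 2 * D ^ 2 / 2 with hc
  have hc0 : 0 ≤ c := by positivity
  have hb1 : ∀ t p y, |q t (p, y)| ≤ D := fun t p y => (hb t p y).trans <| by
    rcases hg01 t p with h | h <;> simp [h, hD]
  have hg0 : ∀ t p, 0 ≤ g t p := fun t p => by rcases hg01 t p with h | h <;> simp [h]
  have hVb : ∀ t p, l * ∑ r ∈ Finset.range t, q r (p, p.2 r) ≤ |l| * (t * D) := by
    intro t p
    refine (le_abs_self _).trans ?_
    rw [abs_mul]
    refine mul_le_mul_of_nonneg_left ?_ (abs_nonneg _)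
    refine (Finset.abs_sum_le_sum_abs _ _).trans ?_
    refine (Finset.sum_le_card_nsmul _ _ D fun r _ => hb1 _ _ _).trans ?_
    simp
  have hstep : ∀ t : ℕ, ∫ p, Real.exp (l * ∑ r ∈ Finset.range t, q r (p, p.2 r)
        - c * ∑ r ∈ Finset.range t, g r p)
      ∂(σ.prod (Measure.infinitePi fun _ : ℕ => ν)) ≤ 1 := by
    intro t
    induction t with
    | zero => simp
    | succ t ih =>
      -- The compensator of round `t` is placed in the first factor: `g t` is determined by the
      -- past, so only `exp (l * q t)` has to be integrated over the fresh noise.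
      let F : (S × (ℕ → Y)) × Y → ℝ := fun z =>
        Real.exp (l * ∑ r ∈ Finset.range t, q r (z.1, z.1.2 r)
          - c * ∑ r ∈ Finset.range (t + 1), g r z.1) * Real.exp (l * q t z)
      have hFm : Measurable F := by
        have := hq; have := hg
        fun_prop
      have hFb : ∀ z, |F z| ≤ Real.exp (|l| * (t * D)) * Real.exp (|l| * D) := by
        intro z
        rw [abs_of_nonneg (by positivity)]
        refine mul_le_mul (Real.exp_le_exp.2 ?_) (Real.exp_le_exp.2 ?_) (Real.exp_pos _).le
          (Real.exp_pos _).le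
        · have h0 : 0 ≤ c * ∑ r ∈ Finset.range (t + 1), g r z.1 :=
            mul_nonneg hc0 (Finset.sum_nonneg fun r _ => hg0 r _)
          linarith [hVb t z.1]
        · refine (le_abs_self _).trans ?_
          rw [abs_mul]
          exact mul_le_mul_of_nonneg_left (hb1 t z.1 z.2) (abs_nonneg _)
      have hFp : ∀ y, DependsOnPast t fun p => F (p, y) := by
        intro y s ω ω' h
        have h1 : ∀ r ∈ Finset.range t, q r ((s, ω), ω r) = q r ((s, ω'), ω' r) := by
          intro r hr
          rw [Finset.mem_range] at hr
          rw [h r hr]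
          exact (hqp r (ω' r)) s ω ω' fun i hi => h i (hi.trans hr)
        have h2 : ∀ r ∈ Finset.range (t + 1), g r (s, ω) = g r (s, ω') := by
          intro r hr
          rw [Finset.mem_range] at hr
          exact (hgp r) s ω ω' fun i hi => h i (by omega)
        have h3 : q t ((s, ω), y) = q t ((s, ω'), y) := hqp t y s ω ω' h
        simp only [F]
        rw [Finset.sum_congr rfl h1, Finset.sum_congr rfl h2, h3]
      have key := integral_fresh σ ν t F hFm hFb hFp
      have e1 : ∀ p : S × (ℕ → Y), Real.exp (l * ∑ r ∈ Finset.range (t + 1), q r (p, p.2 r)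
          - c * ∑ r ∈ Finset.range (t + 1), g r p) = F (p, p.2 t) := by
        intro p
        simp only [F]
        rw [← Real.exp_add, Finset.sum_range_succ (fun r => q r (p, p.2 r))]
        congr 1; ring
      simp_rw [e1]
      rw [key]
      refine le_trans (integral_mono_of_nonneg (Filter.Eventually.of_forall fun p => ?_) ?_
        (Filter.Eventually.of_forall fun p => ?_)) ih
      · exact integral_nonneg fun y => by positivity
      · refine integrable_of_abs_le (C := Real.exp (|l| * (t * D))) ?_ fun p => ?_
        · have := hq; have := hg
          fun_prop
        · rw [abs_of_nonneg (by positivity)]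
          refine Real.exp_le_exp.2 ?_
          have h0 : 0 ≤ c * ∑ r ∈ Finset.range t, g r p :=
            mul_nonneg hc0 (Finset.sum_nonneg fun r _ => hg0 r _)
          linarith [hVb t p]
      · simp only [F]
        rw [integral_const_mul]
        have hmgf : ∫ y, Real.exp (l * q t (p, y)) ∂ν ≤ Real.exp (c * g t p) := by
          have hs := ProbabilityTheory.hasSubgaussianMGF_of_mem_Icc_of_integral_eq_zero (μ := ν)
            (X := fun y => q t (p, y)) (a := -(D * g t p)) (b := D * g t p)
            ((hq t).comp (by fun_prop : Measurable fun y => (p, y))).aemeasurable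
            (Filter.Eventually.of_forall fun y => abs_le.1 (hb t p y)) (hz t p)
          refine (hs.mgf_le l).trans (Real.exp_le_exp.2 (le_of_eq ?_))
          -- Hoeffding's exponent is quadratic in `g`, the compensator is linear; they agree because
          -- `g` is an indicator.
          have hgg : g t p ^ 2 = g t p := by rcases hg01 t p with h | h <;> simp [h]
          simp only [NNReal.coe_pow, NNReal.coe_div, coe_nnnorm, Real.norm_eq_abs, NNReal.coe_ofNat]
          rw [div_pow, sq_abs, hc]
          linear_combination (l ^ 2 * D ^ 2 / 2) * hgg
        refine (mul_le_mul_of_nonneg_left hmgf (Real.exp_pos _).le).trans (le_of_eq ?_)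
        rw [← Real.exp_add, Finset.sum_range_succ (fun r => g r p)]
        congr 1; ring
  have hcn : ∀ p, Real.exp (l * ∑ t ∈ Finset.range T, q t (p, p.2 t)) ≤
      Real.exp (c * n) * Real.exp (l * ∑ r ∈ Finset.range T, q r (p, p.2 r)
        - c * ∑ r ∈ Finset.range T, g r p) := by
    intro p
    rw [← Real.exp_add]
    refine Real.exp_le_exp.2 ?_
    have := mul_le_mul_of_nonneg_left (hn p) hc0
    linarith
  refine (integral_mono_of_nonneg (Filter.Eventually.of_forall fun p => (Real.exp_pos _).le) ?_
    (Filter.Eventually.of_forall hcn)).trans ?_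
  · refine Integrable.const_mul ?_ _
    refine integrable_of_abs_le (C := Real.exp (|l| * (T * D))) ?_ fun p => ?_
    · have := hq; have := hg
      fun_prop
    · rw [abs_of_nonneg (by positivity)]
      refine Real.exp_le_exp.2 ?_
      have h0 : 0 ≤ c * ∑ r ∈ Finset.range T, g r p :=
        mul_nonneg hc0 (Finset.sum_nonneg fun r _ => hg0 r _)
      linarith [hVb T p]
  · rw [integral_const_mul]
    exact mul_le_of_le_one_right (Real.exp_pos _).le (hstep T)

/-- The rate `1 / (D √n)` makes the exponent of `integral_exp_sum_le` equal to `1/2`, and `e^(1/2) <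
2`. The two signs together give the factor `4`. -/
theorem integral_le_of_le_exp (σ : Measure S) [IsProbabilityMeasure σ] (ν : Measure Y)
    [IsProbabilityMeasure ν] (q : ℕ → (S × (ℕ → Y)) × Y → ℝ) (g : ℕ → S × (ℕ → Y) → ℝ)
    {D : ℝ} (hD : 0 < D) (hq : ∀ t, Measurable (q t)) (hg : ∀ t, Measurable (g t))
    (hqp : ∀ t y, DependsOnPast t fun p => q t (p, y)) (hgp : ∀ t, DependsOnPast t (g t))
    (hg01 : ∀ t p, g t p = 0 ∨ g t p = 1) (hb : ∀ t p y, |q t (p, y)| ≤ D * g t p)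
    (hz : ∀ t p, ∫ y, q t (p, y) ∂ν = 0) (T : ℕ) {n : ℝ} (hn0 : 0 < n)
    (hn : ∀ p, ∑ t ∈ Finset.range T, g t p ≤ n) (φ : ℝ → ℝ) (hφ : ∀ x, 0 ≤ φ x) (B : ℝ)
    (hB : 0 ≤ B)
    (hφe : ∀ x, φ x ≤ B * (Real.exp (1 / (D * √n) * x) + Real.exp (-(1 / (D * √n)) * x))) :
    ∫ p, φ (∑ t ∈ Finset.range T, q t (p, p.2 t))
      ∂(σ.prod (Measure.infinitePi fun _ : ℕ => ν)) ≤ 4 * B := by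
  have hE : ∀ l : ℝ, Integrable (fun p : S × (ℕ → Y) =>
      Real.exp (l * ∑ t ∈ Finset.range T, q t (p, p.2 t)))
      (σ.prod (Measure.infinitePi fun _ : ℕ => ν)) := by
    intro l
    refine integrable_of_abs_le (C := Real.exp (|l| * (T * D))) ?_ fun p => ?_
    · have := hq
      fun_prop
    · rw [abs_of_nonneg (by positivity)]
      refine Real.exp_le_exp.2 ((le_abs_self _).trans ?_)
      rw [abs_mul]
      refine mul_le_mul_of_nonneg_left ?_ (abs_nonneg _)
      refine (Finset.abs_sum_le_sum_abs _ _).trans ?_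
      refine (Finset.sum_le_card_nsmul _ _ D fun r _ => (hb _ _ _).trans ?_).trans ?_
      · rcases hg01 r p with h | h <;> simp [h, hD.le]
      · simp
  have hbd : ∀ l : ℝ, l ^ 2 = (1 / (D * √n)) ^ 2 → ∫ p : S × (ℕ → Y),
      Real.exp (l * ∑ t ∈ Finset.range T, q t (p, p.2 t))
      ∂(σ.prod (Measure.infinitePi fun _ : ℕ => ν)) ≤ 2 := by
    intro l hl
    refine (integral_exp_sum_le σ ν q g hD.le hq hg hqp hgp hg01 hb hz T hn l).trans ?_
    have : l ^ 2 * D ^ 2 / 2 * n = 1 / 2 := by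
      rw [hl, div_pow, mul_pow, Real.sq_sqrt hn0.le]
      field_simp
    rw [this]
    have h1 : Real.exp (1 / 2) ^ 2 < 2 ^ 2 := by
      rw [← Real.exp_nat_mul]
      norm_num
      linarith [Real.exp_one_lt_d9]
    exact (lt_of_pow_lt_pow_left₀ 2 (by norm_num) h1).le
  refine (integral_mono_of_nonneg (Filter.Eventually.of_forall fun p => hφ _)
    (((hE _).add (hE _)).const_mul B) (Filter.Eventually.of_forall fun p => hφe _)).trans ?_
  simp only [Pi.add_apply]
  rw [integral_const_mul, integral_add (hE _) (hE _)]
  have := hbd (1 / (D * √n)) rfl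
  have := hbd (-(1 / (D * √n))) (by ring)
  nlinarith

theorem abs_le_exp_add_exp (x : ℝ) : |x| ≤ Real.exp x + Real.exp (-x) := by
  have h1 := Real.add_one_le_exp x
  have h2 := Real.add_one_le_exp (-x)
  have h3 := Real.exp_pos x
  have h4 := Real.exp_pos (-x)
  rcases abs_cases x with ⟨h, _⟩ | ⟨h, _⟩ <;> rw [h] <;> linarith

theorem pow_four_le_exp_add_exp (x : ℝ) : x ^ 4 ≤ 24 * (Real.exp x + Real.exp (-x)) := by
  have h3 := Real.exp_pos x
  have h4 := Real.exp_pos (-x)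
  rcases le_total 0 x with h | h
  · have := Real.pow_div_factorial_le_exp x h 4
    norm_num [Nat.factorial] at this
    linarith
  · have := Real.pow_div_factorial_le_exp (-x) (by linarith) 4
    norm_num [Nat.factorial] at this
    linarith

theorem integral_abs_sum_le (σ : Measure S) [IsProbabilityMeasure σ] (ν : Measure Y)
    [IsProbabilityMeasure ν] (q : ℕ → (S × (ℕ → Y)) × Y → ℝ) (g : ℕ → S × (ℕ → Y) → ℝ)
    {D : ℝ} (hD : 0 < D) (hq : ∀ t, Measurable (q t)) (hg : ∀ t, Measurable (g t))
    (hqp : ∀ t y, DependsOnPast t fun p => q t (p, y)) (hgp : ∀ t, DependsOnPast t (g t))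
    (hg01 : ∀ t p, g t p = 0 ∨ g t p = 1) (hb : ∀ t p y, |q t (p, y)| ≤ D * g t p)
    (hz : ∀ t p, ∫ y, q t (p, y) ∂ν = 0) (T : ℕ) {n : ℝ} (hn0 : 0 < n)
    (hn : ∀ p, ∑ t ∈ Finset.range T, g t p ≤ n) :
    ∫ p, |∑ t ∈ Finset.range T, q t (p, p.2 t)|
      ∂(σ.prod (Measure.infinitePi fun _ : ℕ => ν)) ≤ 4 * (D * √n) := by
  have hs : 0 < D * √n := mul_pos hD (Real.sqrt_pos.2 hn0)
  refine integral_le_of_le_exp σ ν q g hD hq hg hqp hgp hg01 hb hz T hn0 hn (fun x => |x|)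
    (fun x => abs_nonneg x) _ hs.le fun x => ?_
  have := abs_le_exp_add_exp (1 / (D * √n) * x)
  rw [abs_mul, abs_of_pos (by positivity), ← neg_mul] at this
  rw [← div_le_iff₀' hs]
  calc |x| / (D * √n) = 1 / (D * √n) * |x| := by ring
    _ ≤ _ := this

theorem integral_pow_four_sum_le (σ : Measure S) [IsProbabilityMeasure σ] (ν : Measure Y)
    [IsProbabilityMeasure ν] (q : ℕ → (S × (ℕ → Y)) × Y → ℝ) (g : ℕ → S × (ℕ → Y) → ℝ)
    {D : ℝ} (hD : 0 < D) (hq : ∀ t, Measurable (q t)) (hg : ∀ t, Measurable (g t))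
    (hqp : ∀ t y, DependsOnPast t fun p => q t (p, y)) (hgp : ∀ t, DependsOnPast t (g t))
    (hg01 : ∀ t p, g t p = 0 ∨ g t p = 1) (hb : ∀ t p y, |q t (p, y)| ≤ D * g t p)
    (hz : ∀ t p, ∫ y, q t (p, y) ∂ν = 0) (T : ℕ) {n : ℝ} (hn0 : 0 < n)
    (hn : ∀ p, ∑ t ∈ Finset.range T, g t p ≤ n) :
    ∫ p, (∑ t ∈ Finset.range T, q t (p, p.2 t)) ^ 4
      ∂(σ.prod (Measure.infinitePi fun _ : ℕ => ν)) ≤ 96 * (D ^ 4 * n ^ 2) := by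
  have hs : 0 < D * √n := mul_pos hD (Real.sqrt_pos.2 hn0)
  have h4 : (D * √n) ^ 4 = D ^ 4 * n ^ 2 := by
    rw [mul_pow, show √n ^ 4 = (√n ^ 2) ^ 2 by ring, Real.sq_sqrt hn0.le]
  have h := integral_le_of_le_exp σ ν q g hD hq hg hqp hgp hg01 hb hz T hn0 hn (fun x => x ^ 4)
    (fun x => by positivity) (24 * (D ^ 4 * n ^ 2)) (by positivity) fun x => ?_
  · linarith
  · have := pow_four_le_exp_add_exp (1 / (D * √n) * x)
    rw [mul_pow, div_pow, h4, ← neg_mul] at this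
    have h5 : 0 < D ^ 4 * n ^ 2 := by positivity
    calc x ^ 4 = (D ^ 4 * n ^ 2) * (1 ^ 4 / (D ^ 4 * n ^ 2) * x ^ 4) := by field_simp
      _ ≤ _ := mul_le_mul_of_nonneg_left this h5.le
      _ = _ := by ring

end Fresh

/-! ### Runs of an algorithm: predictability and measurability. -/

namespace CreatorMarket

variable {d K M : ℕ} {X : Type} [MeasurableSpace X] {pay : X → Vec d → ℝ → ℝ}

theorem history_apply (E : CreatorMarket d K M pay) (A : Algorithm X d K M) (s : A.Seed)
    (ω : ℕ → E.Noise) (t : ℕ) (r : Fin t) :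
    E.history A s ω t r = E.observe (E.contract A s ω r) (ω r) := by
  induction t with
  | zero => exact r.elim0
  | succ t ih =>
    rw [history]
    refine Fin.lastCases ?_ (fun i => ?_) r
    · simp [contract]
    · simpa using ih i

theorem dependsOnPast_history (E : CreatorMarket d K M pay) (A : Algorithm X d K M) (t : ℕ) :
    DependsOnPast t fun p : A.Seed × (ℕ → E.Noise) => E.history A p.1 p.2 t := by
  induction t with
  | zero => intro s ω ω' _; rfl
  | succ t ih =>
    intro s ω ω' h
    have := ih s ω ω' fun r hr => h r (by omega)
    simp only [history] at this ⊢
    rw [this, h t (by omega)]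

theorem dependsOnPast_contract (E : CreatorMarket d K M pay) (A : Algorithm X d K M) (t : ℕ) :
    DependsOnPast t fun p : A.Seed × (ℕ → E.Noise) => E.contract A p.1 p.2 t := by
  intro s ω ω' h
  have := E.dependsOnPast_history A t s ω ω' h
  simp only [contract] at this ⊢
  rw [this]

theorem measurable_observe (E : CreatorMarket d K M pay) :
    Measurable fun p : X × E.Noise => E.observe p.1 p.2 := by
  have h1 := E.measurable_response
  have h2 := E.measurable_reward
  have h3 : Measurable fun p : X × E.Noise => (fun k => E.response k p.1, p.2) := by fun_prop
  unfold observe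
  refine measurable_fst.prodMk ((measurable_pi_iff.2 fun k => ?_).prodMk (h2.comp h3))
  exact measurable_subtype_coe.comp ((h1 k).comp measurable_fst)

theorem measurable_history (E : CreatorMarket d K M pay) (A : Algorithm X d K M) (t : ℕ) :
    Measurable fun p : A.Seed × (ℕ → E.Noise) => E.history A p.1 p.2 t := by
  induction t with
  | zero => exact measurable_pi_iff.2 fun i => i.elim0
  | succ t ih =>
    refine measurable_pi_iff.2 fun i => ?_
    simp only [history]
    refine Fin.lastCases ?_ (fun i => ?_) i
    · simp only [Fin.snoc_last]
      refine E.measurable_observe.comp (Measurable.prodMk ?_ (by fun_prop))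
      exact (A.measurable_act t).comp (measurable_fst.prodMk ih)
    · simp only [Fin.snoc_castSucc]
      exact (measurable_pi_apply i).comp ih

theorem measurable_contract (E : CreatorMarket d K M pay) (A : Algorithm X d K M) (t : ℕ) :
    Measurable fun p : A.Seed × (ℕ → E.Noise) => E.contract A p.1 p.2 t :=
  (A.measurable_act t).comp (measurable_fst.prodMk (E.measurable_history A t))

end CreatorMarket

/-! ### Markets that realise a prescribed monotone reward curve. -/

noncomputable section

theorem integral_ite_le {a : ℝ} (ha : a ∈ Set.Icc (0 : ℝ) 1) (u v : ℝ) :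
    ∫ ω : unitInterval, (if (ω : ℝ) ≤ a then u else v) = a * u + (1 - a) * v := by
  have hs : MeasurableSet {ω : unitInterval | (ω : ℝ) ≤ a} :=
    measurableSet_le measurable_subtype_coe measurable_const
  have hset : {ω : unitInterval | (ω : ℝ) ≤ a} = Set.Iic (⟨a, ha⟩ : unitInterval) := by
    ext ω; simp [← Subtype.coe_le_coe]
  have h1 : volume.real {ω : unitInterval | (ω : ℝ) ≤ a} = a := by
    rw [hset, Measure.real, unitInterval.volume_Iic, ENNReal.toReal_ofReal ha.1]
  have hf : (fun ω : unitInterval => if (ω : ℝ) ≤ a then u else v)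
      = fun ω => v + Set.indicator {ω : unitInterval | (ω : ℝ) ≤ a} (fun _ => u - v) ω := by
    funext ω
    by_cases h : (ω : ℝ) ≤ a <;> simp [h]
  rw [hf, integral_add (integrable_const _) ((integrable_const _).indicator hs),
    integral_indicator_const _ hs, h1]
  simp
  ring

section ThresholdMarket

variable {d K M : ℕ} (hd : 1 ≤ d) (hK : 1 ≤ K) (m : ℝ → ℝ)

/-- The reward of every user for every item when the mean rewards are `x` and the noise is `ω`. -/
def bit (x : ℝ) (ω : unitInterval) : ℝ := if (ω : ℝ) ≤ x then 1 else 0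

theorem bit_mem (x : ℝ) (ω : unitInterval) : bit x ω ∈ Set.Icc (0 : ℝ) 1 := by
  unfold bit; split_ifs <;> simp

theorem integral_bit {x : ℝ} (hx : x ∈ Set.Icc (0 : ℝ) 1) : ∫ ω, bit x ω = x := by
  unfold bit
  rw [integral_ite_le hx]
  ring

theorem measurable_bit : Measurable fun p : ℝ × unitInterval => bit p.1 p.2 := by
  refine Measurable.ite (measurableSet_le ?_ ?_) measurable_const measurable_const <;> fun_prop

theorem single_mem_unitBall (i : Fin d) (α : Set.Icc (0 : ℝ) 1) :
    EuclideanSpace.single i (α : ℝ) ∈ unitBall d := by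
  refine ⟨?_, fun j => ?_⟩
  · rw [PiLp.norm_single, Real.norm_eq_abs, abs_of_nonneg α.2.1]
    exact α.2.2
  · rw [PiLp.single_apply]
    split_ifs
    · exact α.2.1
    · exact le_rfl

theorem coord_mem_of_mem_unitBall {c : Vec d} (hc : c ∈ unitBall d) (i : Fin d) :
    c i ∈ Set.Icc (0 : ℝ) 1 :=
  ⟨hc.2 i, (le_abs_self _).trans ((PiLp.norm_apply_le c i).trans hc.1)⟩

/-- This amounts to `(α - x) m x ≤ ∫ₓ^α m`, which monotonicity gives on either side of `α`. Equality
holds at `x = α`, so the subtracted term is a cost for which `x = α` is a best response to `α`. -/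
theorem mul_sub_cost_le {m : ℝ → ℝ} (hm : Monotone m) (α x : ℝ) :
    α * m x - (x * m x - ∫ s in (0 : ℝ)..x, m s) ≤ ∫ s in (0 : ℝ)..α, m s := by
  have hi : ∀ a b, IntervalIntegrable m volume a b := fun a b => hm.intervalIntegrable
  rw [← intervalIntegral.integral_add_adjacent_intervals (hi 0 x) (hi x α)]
  suffices h : (α - x) * m x ≤ ∫ s in x..α, m s by linarith
  rw [show (α - x) * m x = ∫ _ in x..α, m x by simp]
  rcases le_total x α with h | h
  · exact intervalIntegral.integral_mono_on h (by simp) (hi _ _) fun s hs => hm hs.1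
  · rw [intervalIntegral.integral_symm, intervalIntegral.integral_symm α x]
    exact neg_le_neg (intervalIntegral.integral_mono_on h (hi _ _) (by simp) fun s hs => hm hs.2)

/-- The market in which all creators answer the contract `α` by the content `α e₀`, and a content
`c` has mean reward `m (c 0)` for every user. -/
abbrev thresholdMarket (d K M : ℕ) (hd : 1 ≤ d) (m : ℝ → ℝ) (hm : Monotone m)
    (hm01 : ∀ x, m x ∈ Set.Icc (0 : ℝ) 1) : CreatorMarket d K M (returnPay d) where
  C := unitBall d
  C_subset := subset_rfl
  rewardLaw c := (volume : Measure unitInterval).map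
    fun ω (_ : Fin M) => bit (m ((c : Vec d) ⟨0, hd⟩)) ω
  Noise := unitInterval
  noise := volume
  -- One uniform variable serves all users and creators, so a round with a common content reveals a
  -- single Bernoulli bit.
  reward c ω _ k := bit (m ((c k : Vec d) ⟨0, hd⟩)) ω
  measurable_reward := by
    have := hm.measurable
    refine measurable_pi_iff.2 fun _ => measurable_pi_iff.2 fun k => ?_
    have h : Measurable fun p : (Fin K → unitBall d) × unitInterval =>
        (m ((p.1 k : Vec d) ⟨0, hd⟩), p.2) := by fun_prop
    exact measurable_bit.comp h
  reward_mem _ _ _ _ := bit_mem _ _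
  map_reward _ _ := rfl
  cost _ c := M * ((c : Vec d) ⟨0, hd⟩ * m ((c : Vec d) ⟨0, hd⟩)
    - ∫ s in (0 : ℝ)..(c : Vec d) ⟨0, hd⟩, m s)
  response _ α := ⟨EuclideanSpace.single ⟨0, hd⟩ (α : ℝ), single_mem_unitBall _ α⟩
  measurable_response _ := by
    refine Measurable.subtype_mk ?_
    refine (WithLp.measurable_toLp 2 (Fin d → ℝ)).comp ?_
    refine measurable_pi_iff.2 fun i => ?_
    simp only [Pi.single_apply]
    split_ifs
    · exact measurable_subtype_coe
    · exact measurable_const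
  response_optimal := by
    intro _ α c
    have hpay : ∀ x : ℝ, ∫ r, returnPay d α (c : Vec d) (∑ j, r j)
        ∂((volume : Measure unitInterval).map fun ω (_ : Fin M) => bit (m x) ω)
        = M * (α * m x) := by
      intro x
      have hb : Measurable fun ω (_ : Fin M) => bit (m x) ω :=
        measurable_pi_iff.2 fun _ => measurable_bit.comp (measurable_const.prodMk measurable_id)
      rw [integral_map hb.aemeasurable (by unfold returnPay; fun_prop)]
      simp only [returnPay, Finset.sum_const, Finset.card_univ, Fintype.card_fin, nsmul_eq_mul]
      rw [integral_const_mul, integral_const_mul, integral_bit (hm01 x)]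
      ring
    have h1 := hpay ((c : Vec d) ⟨0, hd⟩)
    have h2 := hpay α
    simp only [returnPay] at h1 h2 ⊢
    rw [PiLp.single_apply, if_pos rfl, h1, h2]
    have h3 := mul_sub_cost_le hm α ((c : Vec d) ⟨0, hd⟩)
    have h4 := mul_le_mul_of_nonneg_left h3 (Nat.cast_nonneg (α := ℝ) M)
    linarith

theorem utility_thresholdMarket (hd : 1 ≤ d) {m : ℝ → ℝ} (hm : Monotone m)
    (hm01 : ∀ x, m x ∈ Set.Icc (0 : ℝ) 1) (α : Set.Icc (0 : ℝ) 1) :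
    (thresholdMarket d K M hd m hm hm01).utility α = K * M * ((1 - α) * m α) := by
  have hb : Measurable fun ω (_ : Fin M) => bit (m α) ω :=
    measurable_pi_iff.2 fun _ => measurable_bit.comp (measurable_const.prodMk measurable_id)
  have h : ∫ r, ((∑ j, r j) - α * (∑ j, r j))
        ∂((volume : Measure unitInterval).map fun ω (_ : Fin M) => bit (m α) ω)
        = M * ((1 - α) * m α) := by
    rw [integral_map hb.aemeasurable (by fun_prop)]
    simp only [Finset.sum_const, Finset.card_univ, Fintype.card_fin, nsmul_eq_mul]
    have : ∀ x : ℝ, (M : ℝ) * x - α * (M * x) = (M * (1 - α)) * x := fun x => by ring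
    simp_rw [this]
    rw [integral_const_mul, integral_bit (hm01 _)]
    ring
  simp only [CreatorMarket.utility, returnPay]
  rw [PiLp.single_apply, if_pos rfl, h]
  simp
  ring

/-- The record of a round with contract `α` in which all rewards equal `b`. -/
def bitRecord (d K M : ℕ) (hd : 1 ≤ d) (α : Set.Icc (0 : ℝ) 1) (b : ℝ) :
    RoundRecord (Set.Icc (0 : ℝ) 1) d K M :=
  (α, fun _ => EuclideanSpace.single ⟨0, hd⟩ (α : ℝ), fun _ _ => b)

theorem observe_thresholdMarket (hd : 1 ≤ d) {m : ℝ → ℝ} (hm : Monotone m)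
    (hm01 : ∀ x, m x ∈ Set.Icc (0 : ℝ) 1) (α : Set.Icc (0 : ℝ) 1) (ω : unitInterval) :
    (thresholdMarket d K M hd m hm hm01).observe α ω = bitRecord d K M hd α (bit (m α) ω) := by
  simp [CreatorMarket.observe, bitRecord]

end ThresholdMarket
end

/-! ### Change of measure between two such markets. -/

noncomputable section

section ChangeOfMeasure

variable {d K M : ℕ}

theorem measurable_snoc {R : Type} [MeasurableSpace R] (t : ℕ) :
    Measurable fun p : (Fin t → R) × R =>
      (Fin.snoc (α := fun _ => R) p.1 p.2 : Fin (t + 1) → R) := by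
  refine measurable_pi_iff.2 fun i => ?_
  refine Fin.lastCases ?_ (fun i => ?_) i
  · simpa using measurable_snd
  · simp only [Fin.snoc_castSucc]
    exact (measurable_pi_apply i).comp measurable_fst

theorem integral_observe_thresholdMarket (hd : 1 ≤ d) {m : ℝ → ℝ} (hm : Monotone m)
    (hm01 : ∀ x, m x ∈ Set.Icc (0 : ℝ) 1) (α : Set.Icc (0 : ℝ) 1)
    (G : RoundRecord (Set.Icc (0 : ℝ) 1) d K M → ℝ) :
    ∫ ω, G ((thresholdMarket d K M hd m hm hm01).observe α ω) ∂(volume : Measure unitInterval)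
      = m α * G (bitRecord d K M hd α 1) + (1 - m α) * G (bitRecord d K M hd α 0) := by
  simp_rw [observe_thresholdMarket]
  rw [← integral_ite_le (hm01 α)]
  refine integral_congr_ae (Filter.Eventually.of_forall fun ω => ?_)
  simp only [bit]
  split_ifs <;> rfl

/-- The likelihood ratio of one record between mean rewards `m'` and `m`. -/
def recordRatio (hK : 1 ≤ K) (hM : 1 ≤ M) (m m' : ℝ → ℝ)
    (x : RoundRecord (Set.Icc (0 : ℝ) 1) d K M) : ℝ :=
  if x.2.2 ⟨0, hM⟩ ⟨0, hK⟩ = 1 then m' x.1 / m x.1 else (1 - m' x.1) / (1 - m x.1)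

variable (hd : 1 ≤ d) (hK : 1 ≤ K) (hM : 1 ≤ M) {m m' : ℝ → ℝ} (hm : Monotone m)
  (hm01 : ∀ x, m x ∈ Set.Icc (0 : ℝ) 1) (hm' : Monotone m')
  (hm01' : ∀ x, m' x ∈ Set.Icc (0 : ℝ) 1)

theorem measurable_recordRatio (hK : 1 ≤ K) (hM : 1 ≤ M) {m m' : ℝ → ℝ} (hm : Monotone m)
    (hm' : Monotone m') :
    Measurable (recordRatio (d := d) hK hM m m') := by
  have h1 := hm.measurable
  have h2 := hm'.measurable
  unfold recordRatio
  refine Measurable.ite (measurableSet_eq_fun ?_ measurable_const) ?_ ?_ <;> fun_prop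

theorem recordRatio_mem
    (hb : ∀ x : Set.Icc (0 : ℝ) 1, m x ∈ Set.Icc (1 / 4 : ℝ) (1 / 2))
    (hb' : ∀ x : Set.Icc (0 : ℝ) 1, m' x ∈ Set.Icc (1 / 4 : ℝ) (1 / 2))
    (x : RoundRecord (Set.Icc (0 : ℝ) 1) d K M) :
    recordRatio hK hM m m' x ∈ Set.Icc (1 / 2 : ℝ) 2 := by
  have h1 := hb x.1
  have h2 := hb' x.1
  simp only [Set.mem_Icc] at h1 h2
  unfold recordRatio
  split_ifs
  · constructor
    · rw [le_div_iff₀ (by linarith)]; linarith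
    · rw [div_le_iff₀ (by linarith)]; linarith
  · constructor
    · rw [le_div_iff₀ (by linarith)]; linarith
    · rw [div_le_iff₀ (by linarith)]; linarith

/-- Induction that peels off the last round. The test function must stay arbitrary, since the step
replaces `F` by its conditional expectation `Φ` given the first `t` records. Weighting by the
likelihood ratio turns the probabilities `m`, `1 - m` of the last bit into `m'`, `1 - m'`, so both
markets lead to the same `Φ`. -/
theorem integral_history_change_measure
    (hb : ∀ x : Set.Icc (0 : ℝ) 1, m x ∈ Set.Icc (1 / 4 : ℝ) (1 / 2))
    (hb' : ∀ x : Set.Icc (0 : ℝ) 1, m' x ∈ Set.Icc (1 / 4 : ℝ) (1 / 2))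
    (A : Algorithm (Set.Icc (0 : ℝ) 1) d K M) (t : ℕ) :
    ∀ F : A.Seed × (Fin t → RoundRecord (Set.Icc (0 : ℝ) 1) d K M) → ℝ, Measurable F →
      ∀ C : ℝ, (∀ p, |F p| ≤ C) →
      ∫ p : A.Seed × (ℕ → unitInterval),
          F (p.1, (thresholdMarket d K M hd m' hm' hm01').history A p.1 p.2 t)
          ∂(A.seedLaw.prod (Measure.infinitePi fun _ : ℕ => (volume : Measure unitInterval)))
        = ∫ p : A.Seed × (ℕ → unitInterval),
          F (p.1, (thresholdMarket d K M hd m hm hm01).history A p.1 p.2 t)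
            * ∏ r, recordRatio hK hM m m'
              ((thresholdMarket d K M hd m hm hm01).history A p.1 p.2 t r)
          ∂(A.seedLaw.prod (Measure.infinitePi fun _ : ℕ => (volume : Measure unitInterval))) := by
  set E := thresholdMarket d K M hd m hm hm01 with hE
  set E' := thresholdMarket d K M hd m' hm' hm01' with hE'
  have hρm := measurable_recordRatio (d := d) hK hM hm hm'
  have hρb := recordRatio_mem (d := d) hK hM hb hb'
  induction t with
  | zero =>
    intro F _ C _
    simp [CreatorMarket.history]
  | succ t ih =>
    intro F hF C hC
    have hC0 : 0 ≤ C := (abs_nonneg _).trans (hC (A.seedLaw.nonempty_of_neZero.some, fun _ =>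
      bitRecord d K M hd ⟨0, by simp⟩ 0))
    let Φ : A.Seed × (Fin t → RoundRecord (Set.Icc (0 : ℝ) 1) d K M) → ℝ := fun z =>
      m' (A.act t z.1 z.2) * F (z.1, Fin.snoc (α := fun _ => RoundRecord (Set.Icc (0 : ℝ) 1) d K M)
          z.2 (bitRecord d K M hd (A.act t z.1 z.2) 1))
      + (1 - m' (A.act t z.1 z.2)) * F (z.1, Fin.snoc
          (α := fun _ => RoundRecord (Set.Icc (0 : ℝ) 1) d K M)
          z.2 (bitRecord d K M hd (A.act t z.1 z.2) 0))
    have hact := A.measurable_act t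
    have hbr : ∀ b : ℝ, Measurable fun α => bitRecord d K M hd α b := by
      intro b
      have h1 : Measurable fun α : Set.Icc (0 : ℝ) 1 =>
          (EuclideanSpace.single (⟨0, hd⟩ : Fin d) (α : ℝ) : Vec d) := by
        refine (WithLp.measurable_toLp 2 (Fin d → ℝ)).comp ?_
        refine measurable_pi_iff.2 fun i => ?_
        simp only [Pi.single_apply]
        split_ifs
        · exact measurable_subtype_coe
        · exact measurable_const
      exact measurable_id.prodMk ((measurable_pi_iff.2 fun _ => h1).prodMk measurable_const)
    have hΦm : Measurable Φ := by
      have h1 := hm'.measurable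
      have h2 : ∀ b : ℝ, Measurable fun z : A.Seed × (Fin t → RoundRecord (Set.Icc (0 : ℝ) 1) d K M)
          => F (z.1, Fin.snoc (α := fun _ => RoundRecord (Set.Icc (0 : ℝ) 1) d K M)
          z.2 (bitRecord d K M hd (A.act t z.1 z.2) b)) := fun b =>
        hF.comp (measurable_fst.prodMk ((measurable_snoc t).comp
          (measurable_snd.prodMk ((hbr b).comp hact))))
      have h3 : Measurable fun z : A.Seed × (Fin t → RoundRecord (Set.Icc (0 : ℝ) 1) d K M)
          => m' (A.act t z.1 z.2) := h1.comp (measurable_subtype_coe.comp hact)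
      exact (h3.mul (h2 1)).add ((measurable_const.sub h3).mul (h2 0))
    have hΦb : ∀ z, |Φ z| ≤ C := by
      intro z
      have h1 := hb' (A.act t z.1 z.2)
      simp only [Set.mem_Icc] at h1
      refine (abs_add_le _ _).trans ?_
      rw [abs_mul, abs_mul, abs_of_nonneg (by linarith : 0 ≤ m' (A.act t z.1 z.2)),
        abs_of_nonneg (by linarith : 0 ≤ 1 - m' (A.act t z.1 z.2))]
      have h2 := mul_le_mul_of_nonneg_left (hC (z.1, Fin.snoc
        (α := fun _ => RoundRecord (Set.Icc (0 : ℝ) 1) d K M)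
        z.2 (bitRecord d K M hd (A.act t z.1 z.2) 1)))
        (by linarith : 0 ≤ m' (A.act t z.1 z.2))
      have h3 := mul_le_mul_of_nonneg_left (hC (z.1, Fin.snoc
        (α := fun _ => RoundRecord (Set.Icc (0 : ℝ) 1) d K M)
        z.2 (bitRecord d K M hd (A.act t z.1 z.2) 0)))
        (by linarith : 0 ≤ 1 - m' (A.act t z.1 z.2))
      linarith
    have hprodb : ∀ (n : ℕ) (h : Fin n → RoundRecord (Set.Icc (0 : ℝ) 1) d K M),
        |∏ r, recordRatio hK hM m m' (h r)| ≤ 2 ^ n := by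
      intro n h
      rw [Finset.abs_prod]
      refine (Finset.prod_le_prod (fun _ _ => abs_nonneg _) fun r _ => ?_).trans_eq
        (by simp : ∏ _ : Fin n, (2 : ℝ) = 2 ^ n)
      have := hρb (h r)
      rw [abs_of_nonneg (by linarith [this.1])]
      exact this.2
    have hsnoc : ∀ (e : CreatorMarket d K M (returnPay d)), Measurable
        fun z : (A.Seed × (ℕ → e.Noise)) × e.Noise =>
        (Fin.snoc (α := fun _ => RoundRecord (Set.Icc (0 : ℝ) 1) d K M)
          (e.history A z.1.1 z.1.2 t) (e.observe (e.contract A z.1.1 z.1.2 t) z.2) :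
            Fin (t + 1) → RoundRecord (Set.Icc (0 : ℝ) 1) d K M) := by
      intro e
      refine (measurable_snoc t).comp (((e.measurable_history A t).comp measurable_fst).prodMk ?_)
      exact e.measurable_observe.comp
        (((e.measurable_contract A t).comp measurable_fst).prodMk measurable_snd)
    have hpast : ∀ (e : CreatorMarket d K M (returnPay d)) (y : e.Noise), DependsOnPast t
        fun z : (A.Seed × (ℕ → e.Noise)) =>
        (Fin.snoc (α := fun _ => RoundRecord (Set.Icc (0 : ℝ) 1) d K M)
          (e.history A z.1 z.2 t) (e.observe (e.contract A z.1 z.2 t) y) :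
            Fin (t + 1) → RoundRecord (Set.Icc (0 : ℝ) 1) d K M) := by
      intro e y s ω ω' h
      have h1 := e.dependsOnPast_history A t s ω ω' h
      have h2 := e.dependsOnPast_contract A t s ω ω' h
      simp only at h1 h2 ⊢
      rw [h1, h2]
    have key' := integral_fresh A.seedLaw (volume : Measure unitInterval) t
      (fun z => F (z.1.1, Fin.snoc (α := fun _ => RoundRecord (Set.Icc (0 : ℝ) 1) d K M)
          (E'.history A z.1.1 z.1.2 t) (E'.observe (E'.contract A z.1.1 z.1.2 t) z.2)))
      (hF.comp ((measurable_fst.comp measurable_fst).prodMk (hsnoc E'))) (fun z => hC _)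
      (fun y s ω ω' h => by
        have := hpast E' y s ω ω' h
        simp only at this ⊢
        rw [this])
    have key := integral_fresh A.seedLaw (volume : Measure unitInterval) t
      (fun z => F (z.1.1, Fin.snoc (α := fun _ => RoundRecord (Set.Icc (0 : ℝ) 1) d K M)
          (E.history A z.1.1 z.1.2 t) (E.observe (E.contract A z.1.1 z.1.2 t) z.2))
        * ∏ r, recordRatio hK hM m m' ((Fin.snoc
          (α := fun _ => RoundRecord (Set.Icc (0 : ℝ) 1) d K M)
          (E.history A z.1.1 z.1.2 t) (E.observe (E.contract A z.1.1 z.1.2 t) z.2) :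
            Fin (t + 1) → RoundRecord (Set.Icc (0 : ℝ) 1) d K M) r))
      ((hF.comp ((measurable_fst.comp measurable_fst).prodMk (hsnoc E))).mul
        (Finset.measurable_prod _ fun r _ => hρm.comp ((measurable_pi_apply r).comp (hsnoc E))))
      (C := C * 2 ^ (t + 1))
      (fun z => by
        rw [abs_mul]
        exact mul_le_mul (hC _) (hprodb _ _) (abs_nonneg _) hC0)
      (fun y s ω ω' h => by
        have := hpast E y s ω ω' h
        simp only at this ⊢
        rw [this])
    refine key'.trans (Eq.trans ?_ key.symm)
    have e1 : ∀ p : A.Seed × (ℕ → unitInterval), ∫ y, F (p.1, Fin.snoc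
          (α := fun _ => RoundRecord (Set.Icc (0 : ℝ) 1) d K M)
          (E'.history A p.1 p.2 t) (E'.observe (E'.contract A p.1 p.2 t) y))
          ∂(volume : Measure unitInterval)
        = Φ (p.1, E'.history A p.1 p.2 t) := fun p =>
      integral_observe_thresholdMarket hd hm' hm01' _ fun x => F (p.1, Fin.snoc
          (α := fun _ => RoundRecord (Set.Icc (0 : ℝ) 1) d K M) (E'.history A p.1 p.2 t) x)
    have e2 : ∀ p : A.Seed × (ℕ → unitInterval), ∫ y, F (p.1, Fin.snoc
          (α := fun _ => RoundRecord (Set.Icc (0 : ℝ) 1) d K M)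
          (E.history A p.1 p.2 t) (E.observe (E.contract A p.1 p.2 t) y))
        * ∏ r, recordRatio hK hM m m' ((Fin.snoc
          (α := fun _ => RoundRecord (Set.Icc (0 : ℝ) 1) d K M)
          (E.history A p.1 p.2 t) (E.observe (E.contract A p.1 p.2 t) y) :
            Fin (t + 1) → RoundRecord (Set.Icc (0 : ℝ) 1) d K M) r)
          ∂(volume : Measure unitInterval)
        = Φ (p.1, E.history A p.1 p.2 t)
          * ∏ r, recordRatio hK hM m m' (E.history A p.1 p.2 t r) := by
      intro p
      refine (integral_observe_thresholdMarket hd hm hm01 _ fun x => F (p.1, Fin.snoc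
          (α := fun _ => RoundRecord (Set.Icc (0 : ℝ) 1) d K M) (E.history A p.1 p.2 t) x)
          * ∏ r, recordRatio hK hM m m' ((Fin.snoc
          (α := fun _ => RoundRecord (Set.Icc (0 : ℝ) 1) d K M)
          (E.history A p.1 p.2 t) x :
            Fin (t + 1) → RoundRecord (Set.Icc (0 : ℝ) 1) d K M) r)).trans ?_
      have h1 := hb (E.contract A p.1 p.2 t)
      simp only [Set.mem_Icc] at h1
      simp only [Fin.prod_univ_castSucc, Fin.snoc_castSucc, Fin.snoc_last]
      simp only [Φ]
      have r1 : recordRatio hK hM m m' (bitRecord d K M hd (E.contract A p.1 p.2 t) 1)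
          = m' (E.contract A p.1 p.2 t) / m (E.contract A p.1 p.2 t) := by
        simp [recordRatio, bitRecord]
      have r0 : recordRatio hK hM m m' (bitRecord d K M hd (E.contract A p.1 p.2 t) 0)
          = (1 - m' (E.contract A p.1 p.2 t)) / (1 - m (E.contract A p.1 p.2 t)) := by
        simp [recordRatio, bitRecord]
      rw [r1, r0]
      rw [show A.act t p.1 (E.history A p.1 p.2 t) = E.contract A p.1 p.2 t from rfl]
      have h2 : m (E.contract A p.1 p.2 t) ≠ 0 := by linarith
      have h3 : 1 - m (E.contract A p.1 p.2 t) ≠ 0 := by linarith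
      field_simp
    simp_rw [e1, e2]
    exact ih Φ hΦm C hΦb

end ChangeOfMeasure
end

/-! ### Information inequalities. -/

noncomputable section

/-- With `x = √L`, the bound `log x ≤ x - 1` gives `L - 1 - log L ≥ (x - 1)²`, and `|L - 1| = |x -
1| (x + 1) ≤ 8 (x - 1)² + (x + 1)² / 32`. For a likelihood ratio `L` the expectation yields total
variation at most a multiple of the divergence plus a small constant, in place of Pinsker's
inequality. -/
theorem abs_sub_one_le {L : ℝ} (hL : 0 < L) :
    |L - 1| ≤ 8 * (L - 1 - Real.log L) + (L + 1) / 16 := by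
  set x := √L with hx
  have hx0 : 0 < x := Real.sqrt_pos.2 hL
  have hL2 : L = x ^ 2 := (Real.sq_sqrt hL.le).symm
  have hlog : Real.log L = 2 * Real.log x := by rw [hL2, Real.log_pow]; norm_num
  have h1 := Real.log_le_sub_one_of_pos hx0
  rw [hlog, hL2, abs_le]
  constructor <;> nlinarith [sq_nonneg (8 * (x - 1) - (x + 1) / 2), sq_nonneg (x - 1),
    sq_nonneg (8 * (x - 1) + (x + 1) / 2)]

/-- The relative entropy of two Bernoulli laws is at most their chi-square distance `(q - p)² / (q
(1 - q))`, and `q (1 - q) ≥ 1/6` on the given interval. -/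
theorem neg_le_bernoulli_log {p q : ℝ} (hp : p ∈ Set.Icc (1 / 4 : ℝ) (1 / 2))
    (hq : q ∈ Set.Icc (1 / 4 : ℝ) (1 / 2)) :
    -(6 * (q - p) ^ 2) ≤ p * Real.log (q / p) + (1 - p) * Real.log ((1 - q) / (1 - p)) := by
  obtain ⟨hp1, hp2⟩ := hp
  obtain ⟨hq1, hq2⟩ := hq
  have hp0 : 0 < p := by linarith
  have hq0 : 0 < q := by linarith
  have hp0' : 0 < 1 - p := by linarith
  have hq0' : 0 < 1 - q := by linarith
  have h1 : -(p / q - 1) ≤ Real.log (q / p) := by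
    have := Real.log_le_sub_one_of_pos (div_pos hp0 hq0)
    rw [← inv_div q p, Real.log_inv] at this
    rw [inv_div] at this
    linarith
  have h2 : -((1 - p) / (1 - q) - 1) ≤ Real.log ((1 - q) / (1 - p)) := by
    have := Real.log_le_sub_one_of_pos (div_pos hp0' hq0')
    rw [← inv_div (1 - q) (1 - p), Real.log_inv] at this
    rw [inv_div] at this
    linarith
  have h3 := mul_le_mul_of_nonneg_left h1 hp0.le
  have h4 := mul_le_mul_of_nonneg_left h2 hp0'.le
  refine le_trans ?_ (add_le_add h3 h4)
  have h5 : p * -(p / q - 1) + (1 - p) * -((1 - p) / (1 - q) - 1)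
      = -((q - p) ^ 2 / (q * (1 - q))) := by
    field_simp
    ring
  rw [h5, neg_le_neg_iff, div_le_iff₀ (mul_pos hq0 hq0')]
  have h6 : 1 ≤ 6 * (q * (1 - q)) := by nlinarith
  nlinarith [sq_nonneg (q - p)]

section Information

variable {d K M : ℕ}

/-- The count under `m'` is `𝔼[N L] ≤ 𝔼 N + T 𝔼|L - 1|` under `m`. The divergence accumulates only
in rounds where `f` is positive, hence is at most `6 w² n`, and `abs_sub_one_le` converts it into
`48 w² n + 1/8`. -/
theorem integral_count_le_of_close (hd : 1 ≤ d) (hK : 1 ≤ K) (hM : 1 ≤ M) {m m' : ℝ → ℝ}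
    (hm : Monotone m) (hm01 : ∀ x, m x ∈ Set.Icc (0 : ℝ) 1) (hm' : Monotone m')
    (hm01' : ∀ x, m' x ∈ Set.Icc (0 : ℝ) 1)
    (hb : ∀ x : Set.Icc (0 : ℝ) 1, m x ∈ Set.Icc (1 / 4 : ℝ) (1 / 2))
    (hb' : ∀ x : Set.Icc (0 : ℝ) 1, m' x ∈ Set.Icc (1 / 4 : ℝ) (1 / 2))
    (f : Set.Icc (0 : ℝ) 1 → ℝ) (hf : Measurable f) (hf01 : ∀ x, f x ∈ Set.Icc (0 : ℝ) 1) {w : ℝ}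
    (hw : ∀ x : Set.Icc (0 : ℝ) 1, (m' x - m x) ^ 2 ≤ w ^ 2 * f x)
    (A : Algorithm (Set.Icc (0 : ℝ) 1) d K M) (T : ℕ) {n : ℝ}
    (hn : ∫ p : A.Seed × (ℕ → unitInterval), ∑ t ∈ Finset.range T,
        f ((thresholdMarket d K M hd m hm hm01).contract A p.1 p.2 t)
        ∂(A.seedLaw.prod (Measure.infinitePi fun _ : ℕ => (volume : Measure unitInterval))) ≤ n) :
    ∫ p : A.Seed × (ℕ → unitInterval), ∑ t ∈ Finset.range T,
        f ((thresholdMarket d K M hd m' hm' hm01').contract A p.1 p.2 t)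
        ∂(A.seedLaw.prod (Measure.infinitePi fun _ : ℕ => (volume : Measure unitInterval)))
      ≤ n + T * (48 * w ^ 2 * n + 1 / 8) := by
  set E := thresholdMarket d K M hd m hm hm01 with hE
  set E' := thresholdMarket d K M hd m' hm' hm01' with hE'
  set P : Measure (A.Seed × (ℕ → unitInterval)) :=
    A.seedLaw.prod (Measure.infinitePi fun _ : ℕ => (volume : Measure unitInterval)) with hP
  have hρm := measurable_recordRatio (d := d) hK hM hm hm'
  have hρb := recordRatio_mem (d := d) hK hM hb hb'
  have hcm : ∀ t, Measurable fun p : A.Seed × (ℕ → unitInterval) => E.contract A p.1 p.2 t :=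
    fun t => E.measurable_contract A t
  have hobs : ∀ t, Measurable fun p : A.Seed × (ℕ → unitInterval) =>
      recordRatio hK hM m m' (E.observe (E.contract A p.1 p.2 t) (p.2 t)) := fun t =>
    hρm.comp (E.measurable_observe.comp ((hcm t).prodMk
      ((measurable_pi_apply t).comp measurable_snd)))
  -- the count, the likelihood ratio and its logarithm, as functions of the run
  let N : A.Seed × (ℕ → unitInterval) → ℝ := fun p =>
    ∑ t ∈ Finset.range T, f (E.contract A p.1 p.2 t)
  let L : A.Seed × (ℕ → unitInterval) → ℝ := fun p =>
    ∏ t ∈ Finset.range T, recordRatio hK hM m m' (E.observe (E.contract A p.1 p.2 t) (p.2 t))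
  let G : A.Seed × (ℕ → unitInterval) → ℝ := fun p => ∑ t ∈ Finset.range T,
    Real.log (recordRatio hK hM m m' (E.observe (E.contract A p.1 p.2 t) (p.2 t)))
  have hNm : Measurable N := Finset.measurable_sum _ fun t _ => hf.comp (hcm t)
  have hLm : Measurable L := Finset.measurable_prod _ fun t _ => hobs t
  have hGm : Measurable G := Finset.measurable_sum _ fun t _ =>
    Real.measurable_log.comp (hobs t)
  have hN0 : ∀ p, 0 ≤ N p := fun p => Finset.sum_nonneg fun t _ => (hf01 _).1
  have hNT : ∀ p, N p ≤ T := fun p =>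
    (Finset.sum_le_card_nsmul _ _ 1 fun t _ => (hf01 _).2).trans (by simp)
  have hL0 : ∀ p, 0 < L p := fun p => Finset.prod_pos fun t _ =>
    lt_of_lt_of_le (by norm_num) (hρb _).1
  have hLb : ∀ p, L p ≤ 2 ^ T := fun p =>
    (Finset.prod_le_prod (fun t _ => (lt_of_lt_of_le (by norm_num) (hρb _).1).le)
      fun t _ => (hρb _).2).trans_eq (by simp)
  have hlogb : ∀ x : RoundRecord (Set.Icc (0 : ℝ) 1) d K M,
      |Real.log (recordRatio hK hM m m' x)| ≤ 1 := by
    intro x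
    have h := hρb x
    have h0 : 0 < recordRatio hK hM m m' x := lt_of_lt_of_le (by norm_num) h.1
    rw [abs_le]
    constructor
    · have := Real.log_le_sub_one_of_pos (inv_pos.2 h0)
      rw [Real.log_inv] at this
      have h2 : (recordRatio hK hM m m' x)⁻¹ ≤ 2 := by
        rw [inv_le_comm₀ h0 (by norm_num)]
        linarith [h.1]
      linarith
    · linarith [Real.log_le_sub_one_of_pos h0, h.2]
  have hGb : ∀ p, |G p| ≤ T := fun p =>
    (Finset.abs_sum_le_sum_abs _ _).trans
      ((Finset.sum_le_card_nsmul _ _ 1 fun t _ => hlogb _).trans (by simp))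
  have hNi : Integrable N P := integrable_of_abs_le hNm (C := T) fun p => by
    rw [abs_of_nonneg (hN0 p)]; exact hNT p
  have hLi : Integrable L P := integrable_of_abs_le hLm (C := 2 ^ T) fun p => by
    rw [abs_of_pos (hL0 p)]; exact hLb p
  have hGi : Integrable G P := integrable_of_abs_le hGm hGb
  have hNLi : Integrable (fun p => N p * L p) P :=
    integrable_of_abs_le (hNm.mul hLm) (C := T * 2 ^ T) fun p => by
      rw [abs_of_nonneg (mul_nonneg (hN0 p) (hL0 p).le)]
      exact mul_le_mul (hNT p) (hLb p) (hL0 p).le (Nat.cast_nonneg T)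
  have hprod : ∀ p : A.Seed × (ℕ → unitInterval),
      ∏ r, recordRatio hK hM m m' (E.history A p.1 p.2 T r) = L p := by
    intro p
    simp only [L]
    rw [Finset.prod_range]
    refine Finset.prod_congr rfl fun r _ => ?_
    rw [E.history_apply A p.1 p.2 T r]
  have hL1 : ∫ p, L p ∂P = 1 := by
    have h : ∫ _, (1 : ℝ) ∂P = ∫ p : A.Seed × (ℕ → unitInterval),
        1 * ∏ r, recordRatio hK hM m m' (E.history A p.1 p.2 T r) ∂P :=
      integral_history_change_measure hd hK hM hm hm01 hm' hm01' hb hb' A T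
        (fun _ => 1) measurable_const 1 (by simp)
    simp only [one_mul, hprod] at h
    rw [← h]
    simp
  have hNL : ∫ p : A.Seed × (ℕ → unitInterval), ∑ t ∈ Finset.range T,
      f (E'.contract A p.1 p.2 t) ∂P = ∫ p, N p * L p ∂P := by
    have h : ∫ p : A.Seed × (ℕ → unitInterval), ∑ r : Fin T, f (E'.history A p.1 p.2 T r).1 ∂P
        = ∫ p : A.Seed × (ℕ → unitInterval), (∑ r : Fin T, f (E.history A p.1 p.2 T r).1)
          * ∏ r, recordRatio hK hM m m' (E.history A p.1 p.2 T r) ∂P :=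
      integral_history_change_measure hd hK hM hm hm01 hm' hm01' hb hb' A T
        (fun z => ∑ r, f (z.2 r).1) (Finset.measurable_sum _ fun r _ => hf.comp (by fun_prop)) T
        (fun z => by
          rw [abs_of_nonneg (Finset.sum_nonneg fun r _ => (hf01 _).1)]
          exact (Finset.sum_le_card_nsmul _ _ 1 fun t _ => (hf01 _).2).trans (by simp))
    have hcount : ∀ (e : CreatorMarket d K M (returnPay d)) (s : A.Seed) (ω : ℕ → e.Noise),
        ∑ r : Fin T, f (e.history A s ω T r).1
          = ∑ t ∈ Finset.range T, f (e.contract A s ω t) := by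
      intro e s ω
      rw [Finset.sum_range]
      refine Finset.sum_congr rfl fun r _ => ?_
      rw [e.history_apply A s ω T r]
      rfl
    have h1 := hcount E
    have h2 := hcount E'
    simp only [h1, h2, hprod] at h
    exact h
  -- Chain rule: minus the expected log-likelihood ratio is the sum of the conditional one-round
  -- divergences, each at most `6 w² f` of the posted contract.
  have hG : -(6 * w ^ 2 * n) ≤ ∫ p, G p ∂P := by
    have hterm : ∀ t, -(6 * w ^ 2) * ∫ p, f (E.contract A p.1 p.2 t) ∂P ≤
        ∫ p : A.Seed × (ℕ → unitInterval),
          Real.log (recordRatio hK hM m m' (E.observe (E.contract A p.1 p.2 t) (p.2 t))) ∂P := by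
      intro t
      have hfr := integral_fresh A.seedLaw (volume : Measure unitInterval) t
        (fun z => Real.log (recordRatio hK hM m m'
          (E.observe (E.contract A z.1.1 z.1.2 t) z.2)))
        (Real.measurable_log.comp (hρm.comp (E.measurable_observe.comp
          (((hcm t).comp measurable_fst).prodMk measurable_snd))))
        (fun z => hlogb _)
        (fun y s ω ω' h => by
          have := E.dependsOnPast_contract A t s ω ω' h
          simp only at this ⊢
          rw [this])
      rw [hP, hfr, ← integral_const_mul]
      refine integral_mono ?_ ?_ fun p => ?_
      · refine Integrable.const_mul (integrable_of_abs_le (hf.comp (hcm t)) (C := 1) fun p => ?_) _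
        simp only [Function.comp_apply]
        rw [abs_of_nonneg (hf01 _).1]
        exact (hf01 _).2
      · refine integrable_of_abs_le (C := 1) ?_ fun p => ?_
        · exact ((Real.measurable_log.comp (hρm.comp (E.measurable_observe.comp
            (((hcm t).comp measurable_fst).prodMk
              measurable_snd)))).stronglyMeasurable.integral_prod_right'
                (ν := (volume : Measure unitInterval))).measurable
        · have h := norm_integral_le_of_norm_le_const (μ := (volume : Measure unitInterval))
            (f := fun y => Real.log (recordRatio hK hM m m'
              (E.observe (E.contract A p.1 p.2 t) y))) (C := 1)
            (Filter.Eventually.of_forall fun y => hlogb _)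
          simpa using h
      · have h1 := integral_observe_thresholdMarket (K := K) (M := M) hd hm hm01
          (E.contract A p.1 p.2 t) fun x => Real.log (recordRatio hK hM m m' x)
        have h2 := neg_le_bernoulli_log (hb (E.contract A p.1 p.2 t))
          (hb' (E.contract A p.1 p.2 t))
        have h3 := hw (E.contract A p.1 p.2 t)
        refine le_trans ?_ (h2.trans_eq (Eq.trans ?_ h1.symm))
        · simp only
          linarith
        · simp [recordRatio, bitRecord]
    have hfi : ∀ t ∈ Finset.range T, Integrable
        (fun p : A.Seed × (ℕ → unitInterval) => f (E.contract A p.1 p.2 t)) P := fun t _ =>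
      integrable_of_abs_le (hf.comp (hcm t)) (C := 1) fun p => by
        rw [abs_of_nonneg (hf01 _).1]
        exact (hf01 _).2
    have hsum : ∫ p, G p ∂P = ∑ t ∈ Finset.range T, ∫ p : A.Seed × (ℕ → unitInterval),
          Real.log (recordRatio hK hM m m' (E.observe (E.contract A p.1 p.2 t) (p.2 t))) ∂P :=
      integral_finsetSum _ fun t _ => integrable_of_abs_le
        (Real.measurable_log.comp (hobs t)) fun p => hlogb _
    rw [integral_finsetSum _ hfi] at hn
    rw [hsum]
    calc -(6 * w ^ 2 * n) = -(6 * w ^ 2) * n := by ring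
      _ ≤ -(6 * w ^ 2) * ∑ t ∈ Finset.range T, ∫ p, f (E.contract A p.1 p.2 t) ∂P := by
        nlinarith [sq_nonneg w]
      _ ≤ _ := by
        rw [Finset.mul_sum]
        exact Finset.sum_le_sum fun t _ => hterm t
  have hpt : ∀ p, N p * L p ≤ N p + T * (8 * (L p - 1 - G p) + (L p + 1) / 16) := by
    intro p
    have hlog : Real.log (L p) = G p :=
      Real.log_prod fun t _ => (lt_of_lt_of_le (by norm_num) (hρb _).1).ne'
    have h1 := abs_sub_one_le (hL0 p)
    rw [hlog] at h1
    have h2 : N p * (L p - 1) ≤ N p * |L p - 1| :=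
      mul_le_mul_of_nonneg_left (le_abs_self _) (hN0 p)
    have h3 : N p * |L p - 1| ≤ T * |L p - 1| :=
      mul_le_mul_of_nonneg_right (hNT p) (abs_nonneg _)
    have h4 := mul_le_mul_of_nonneg_left h1 (Nat.cast_nonneg (α := ℝ) T)
    linarith
  rw [hNL]
  have hi1 : Integrable (fun p => L p - 1) P := hLi.sub (integrable_const _)
  have hi2 : Integrable (fun p => L p - 1 - G p) P := hi1.sub hGi
  have hi3 : Integrable (fun p => L p + 1) P := hLi.add (integrable_const _)
  have hi4 : Integrable (fun p => 8 * (L p - 1 - G p) + (L p + 1) / 16) P :=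
    (hi2.const_mul 8).add (hi3.div_const 16)
  refine (integral_mono hNLi (hNi.add (hi4.const_mul T)) hpt).trans ?_
  simp only [Pi.add_apply]
  rw [integral_add hNi (hi4.const_mul T), integral_const_mul,
    integral_add (hi2.const_mul 8) (hi3.div_const 16), integral_const_mul, integral_div,
    integral_sub hi1 hGi, integral_sub hLi (integrable_const _),
    integral_add hLi (integrable_const _), hL1]
  simp only [integral_const, probReal_univ, smul_eq_mul, mul_one]
  have hn' : ∫ p, N p ∂P ≤ n := hn
  have hT0 : (0 : ℝ) ≤ T := Nat.cast_nonneg T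
  nlinarith

end Information

end

/-! ### The hard instances and the lower bound. -/

noncomputable section

/-- Mean rewards for which all contracts `α ≤ 1/2` are equally good. -/
def baseMean (s : ℝ) : ℝ := 1 / (4 * (1 - min s (1 / 2)))

/-- `baseMean`, raised on the window `[a, b)` such that the contract `a` becomes optimal. -/
def bumpMean (a b s : ℝ) : ℝ := if a ≤ s ∧ s < b then baseMean b else baseMean s

theorem monotone_baseMean : Monotone baseMean := by
  intro s t h
  unfold baseMean
  have h1 : min t (1 / 2 : ℝ) ≤ 1 / 2 := min_le_right _ _
  have h2 : min s (1 / 2 : ℝ) ≤ min t (1 / 2) := min_le_min_right _ h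
  exact one_div_le_one_div_of_le (by linarith) (by linarith)

theorem baseMean_mem (s : ℝ) : baseMean s ∈ Set.Icc (0 : ℝ) 1 := by
  unfold baseMean
  have h1 : min s (1 / 2 : ℝ) ≤ 1 / 2 := min_le_right _ _
  refine ⟨by apply div_nonneg <;> linarith, ?_⟩
  rw [div_le_one (by linarith)]
  linarith

theorem baseMean_mem' {s : ℝ} (hs : 0 ≤ s) : baseMean s ∈ Set.Icc (1 / 4 : ℝ) (1 / 2) := by
  unfold baseMean
  have h1 : min s (1 / 2 : ℝ) ≤ 1 / 2 := min_le_right _ _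
  have h2 : 0 ≤ min s (1 / 2 : ℝ) := le_min hs (by norm_num)
  constructor
  · exact one_div_le_one_div_of_le (by linarith) (by linarith)
  · exact one_div_le_one_div_of_le (by linarith) (by linarith)

/-- The lifted value is the base value at the right end `b`, so nothing at or beyond the window's
end lies below it. Monotonicity is what `thresholdMarket` demands. -/
theorem monotone_bumpMean (a b : ℝ) : Monotone (bumpMean a b) := by
  intro s t h
  unfold bumpMean
  have := monotone_baseMean h
  split_ifs with h1 h2 h2
  · exact le_rfl
  · exact monotone_baseMean (by by_contra! h3; exact h2 ⟨h1.1.trans h, h3⟩)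
  · exact monotone_baseMean (h.trans h2.2.le)
  · exact this

theorem bumpMean_mem (a b s : ℝ) : bumpMean a b s ∈ Set.Icc (0 : ℝ) 1 := by
  unfold bumpMean; split_ifs <;> exact baseMean_mem _

theorem bumpMean_mem' {a b s : ℝ} (hb : 0 ≤ b) (hs : 0 ≤ s) :
    bumpMean a b s ∈ Set.Icc (1 / 4 : ℝ) (1 / 2) := by
  unfold bumpMean; split_ifs
  exacts [baseMean_mem' hb, baseMean_mem' hs]

theorem baseMean_of_le {s : ℝ} (hs : s ≤ 1 / 2) : baseMean s = 1 / (4 * (1 - s)) := by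
  rw [baseMean, min_eq_left hs]

theorem one_sub_mul_baseMean_le (s : ℝ) : (1 - s) * baseMean s ≤ 1 / 4 := by
  unfold baseMean
  have h1 : min s (1 / 2 : ℝ) ≤ 1 / 2 := min_le_right _ _
  have h2 : min s (1 / 2 : ℝ) ≤ s := min_le_left _ _
  rw [mul_one_div, div_le_iff₀ (by linarith)]
  linarith

/-- On `s, b ≤ 1/2` one has `4 (1 - b) (1 - s) ≥ 1`, so the base curve has slope at most one there.
The indicator records that rounds outside the window carry no information. -/
theorem bumpMean_sub_sq_le {a b s : ℝ} (ha : 0 ≤ a) (hb : b ≤ 1 / 2) :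
    (bumpMean a b s - baseMean s) ^ 2 ≤ (b - a) ^ 2 * if a ≤ s ∧ s < b then 1 else 0 := by
  unfold bumpMean
  split_ifs with h
  · rw [mul_one]
    have hs : s ≤ 1 / 2 := h.2.le.trans hb
    have h0 : 0 ≤ baseMean b - baseMean s := sub_nonneg.2 (monotone_baseMean h.2.le)
    refine pow_le_pow_left₀ h0 ?_ 2
    rw [baseMean_of_le hb, baseMean_of_le hs]
    have e : 1 / (4 * (1 - b)) - 1 / (4 * (1 - s)) = (b - s) / (4 * ((1 - b) * (1 - s))) := by
      have : 1 - b ≠ 0 := by linarith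
      have : 1 - s ≠ 0 := by linarith
      field_simp
      ring
    rw [e, div_le_iff₀ (by nlinarith)]
    have h1 : 1 ≤ 4 * ((1 - b) * (1 - s)) := by nlinarith
    have h2 : 0 ≤ b - a := by linarith [h.1, h.2]
    nlinarith [h.1]
  · simp

/-- Inside the window the mean is constant and `1 - s` decreases, so `a` is best there. Outside, the
value is at most `1/4`, whereas at `a` it is `(1 - a) / (4 (1 - b)) ≥ 1/4 + (b - a) / 4`. -/
theorem one_sub_mul_bumpMean_le {a b : ℝ} (ha0 : 0 ≤ a) (hab : a < b) (hb : b ≤ 1 / 2)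
    (s : ℝ) :
    (1 - s) * bumpMean a b s
      ≤ (1 - a) * bumpMean a b a - (b - a) / 4 * (1 - if a ≤ s ∧ s < b then 1 else 0) := by
  have ha : bumpMean a b a = baseMean b := by
    unfold bumpMean; rw [if_pos ⟨le_rfl, hab⟩]
  rw [ha]
  have hb0 : 0 ≤ baseMean b := (baseMean_mem b).1
  unfold bumpMean
  split_ifs with h
  · have := mul_le_mul_of_nonneg_right (sub_le_sub_left h.1 1) hb0
    linarith
  · have h1 := one_sub_mul_baseMean_le s
    have h2 : 1 / 4 + (b - a) / 4 ≤ (1 - a) * baseMean b := by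
      rw [baseMean_of_le hb, mul_one_div, le_div_iff₀ (by linarith)]
      nlinarith [mul_nonneg (ha0.trans hab.le) (sub_nonneg.2 hab.le)]
    linarith

/-- The windows are disjoint, so their visit counts sum to at most `T`; pigeonhole on the
expectations. -/
theorem exists_integral_window_le {Ω : Type} [MeasurableSpace Ω] (P : Measure Ω)
    [IsProbabilityMeasure P] (c : ℕ → Ω → ℝ) (hc : ∀ t, Measurable (c t)) (T N : ℕ)
    (hN : 1 ≤ N) :
    ∃ i : ℕ, i < N ∧ ∫ p, ∑ t ∈ Finset.range T,
      (if (i : ℝ) / (2 * N) ≤ c t p ∧ c t p < (i + 1) / (2 * N) then (1 : ℝ) else 0) ∂P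
        ≤ T / N := by
  have hN0 : (0 : ℝ) < 2 * N := by positivity
  have hmeas : ∀ (i : ℕ), Measurable fun p => ∑ t ∈ Finset.range T,
      (if (i : ℝ) / (2 * N) ≤ c t p ∧ c t p < (i + 1) / (2 * N) then (1 : ℝ) else 0) := by
    intro i
    refine Finset.measurable_sum _ fun t _ => Measurable.ite ?_ measurable_const measurable_const
    exact (measurableSet_le measurable_const (hc t)).inter
      (measurableSet_lt (hc t) measurable_const)
  have hint : ∀ i ∈ Finset.range N, Integrable (fun p => ∑ t ∈ Finset.range T,
      (if (i : ℝ) / (2 * N) ≤ c t p ∧ c t p < (i + 1) / (2 * N) then (1 : ℝ) else 0)) P := by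
    intro i _
    refine integrable_of_abs_le (hmeas i) (C := T) fun p => ?_
    rw [abs_of_nonneg (Finset.sum_nonneg fun t _ => by split_ifs <;> norm_num)]
    refine (Finset.sum_le_card_nsmul _ _ 1 fun t _ => ?_).trans (by simp)
    split_ifs <;> norm_num
  have hle : ∑ i ∈ Finset.range N, ∫ p, ∑ t ∈ Finset.range T,
      (if (i : ℝ) / (2 * N) ≤ c t p ∧ c t p < (i + 1) / (2 * N) then (1 : ℝ) else 0) ∂P
      ≤ ∑ _i ∈ Finset.range N, (T : ℝ) / N := by
    rw [← integral_finsetSum _ hint]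
    have hb : ∀ p, ∑ i ∈ Finset.range N, ∑ t ∈ Finset.range T,
        (if (i : ℝ) / (2 * N) ≤ c t p ∧ c t p < (i + 1) / (2 * N) then (1 : ℝ) else 0) ≤ T := by
      intro p
      rw [Finset.sum_comm]
      refine (Finset.sum_le_card_nsmul _ _ 1 fun t _ => ?_).trans (by simp)
      rw [← Finset.sum_filter, Finset.sum_const, nsmul_eq_mul, mul_one]
      refine Nat.cast_le_one.2 (Finset.card_le_one.2 fun i hi j hj => ?_)
      simp only [Finset.mem_filter, div_le_iff₀ hN0, lt_div_iff₀ hN0] at hi hj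
      have h1 : (i : ℝ) < j + 1 := hi.2.1.trans_lt hj.2.2
      have h2 : (j : ℝ) < i + 1 := hj.2.1.trans_lt hi.2.2
      norm_cast at h1 h2
      omega
    have h0 : ∀ p, 0 ≤ ∑ i ∈ Finset.range N, ∑ t ∈ Finset.range T,
        (if (i : ℝ) / (2 * N) ≤ c t p ∧ c t p < (i + 1) / (2 * N) then (1 : ℝ) else 0) := fun p =>
      Finset.sum_nonneg fun i _ => Finset.sum_nonneg fun t _ => by split_ifs <;> norm_num
    refine (integral_mono_of_nonneg (Filter.Eventually.of_forall h0) (integrable_const (T : ℝ))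
      (Filter.Eventually.of_forall hb)).trans ?_
    simp
    rw [mul_div_cancel₀]
    positivity
  obtain ⟨i, hi, h⟩ := Finset.exists_le_of_sum_le (Finset.nonempty_range_iff.2 (by omega)) hle
  exact ⟨i, Finset.mem_range.1 hi, h⟩

theorem exists_cube_root (T : ℕ) (hT : 1 ≤ T) :
    ∃ n : ℕ, 1 ≤ n ∧ T ≤ n ^ 3 ∧ (n : ℝ) ≤ 2 * (T : ℝ) ^ ((1 : ℝ) / 3) := by
  have hT' : (1 : ℝ) ≤ T := by exact_mod_cast hT
  set x := (T : ℝ) ^ ((1 : ℝ) / 3) with hx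
  have hx1 : 1 ≤ x := Real.one_le_rpow hT' (by norm_num)
  have hx3 : x ^ 3 = T := by
    rw [hx, ← Real.rpow_natCast, ← Real.rpow_mul (by linarith)]
    norm_num
  refine ⟨⌈x⌉₊, Nat.one_le_ceil_iff.2 (by linarith), ?_, ?_⟩
  · have : (T : ℝ) ≤ (⌈x⌉₊ : ℝ) ^ 3 := by
      rw [← hx3]
      exact pow_le_pow_left₀ (by linarith) (Nat.le_ceil x) 3
    exact_mod_cast this
  · have := Nat.ceil_lt_add_one (by linarith : 0 ≤ x)
    linarith

set_option maxHeartbeats 1000000 in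
theorem exists_market_le_regret {K M d : ℕ} (hK : 1 ≤ K) (hM : 1 ≤ M) (hd : 1 ≤ d) {T : ℕ}
    (hT : 1 ≤ T) (A : Algorithm (Set.Icc (0 : ℝ) 1) d K M) :
    ∃ E : CreatorMarket d K M (returnPay d),
      E.C = unitBall d ∧ (∃ x, ∀ y, E.utility y ≤ E.utility x) ∧
      (1 / 256) * (T : ℝ) ^ ((2 : ℝ) / 3) ≤ E.regret A T := by
  obtain ⟨n, hn1, hTn, hnT⟩ := exists_cube_root T hT
  have hT' : (1 : ℝ) ≤ T := by exact_mod_cast hT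
  have hn1' : (1 : ℝ) ≤ n := by exact_mod_cast hn1
  have hTn' : (T : ℝ) ≤ (n : ℝ) ^ 3 := by exact_mod_cast hTn
  -- The `N` windows of length `1 / (2N)` fill `[0, 1/2)`. The factor `8` is slack that keeps the
  -- visits in the lifted market below `T/2`.
  set N := 8 * n with hN
  have hNr : (N : ℝ) = 8 * n := by rw [hN]; push_cast; ring
  set P : Measure (A.Seed × (ℕ → unitInterval)) :=
    A.seedLaw.prod (Measure.infinitePi fun _ : ℕ => (volume : Measure unitInterval)) with hP
  obtain ⟨i, hi, hcount⟩ := exists_integral_window_le P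
    (fun t p => ((thresholdMarket d K M hd baseMean monotone_baseMean baseMean_mem).contract
      A p.1 p.2 t : ℝ))
    (fun t => measurable_subtype_coe.comp ((thresholdMarket d K M hd baseMean monotone_baseMean
      baseMean_mem).measurable_contract A t)) T N (by omega)
  set a : ℝ := (i : ℝ) / (2 * N) with ha
  set b : ℝ := ((i : ℝ) + 1) / (2 * N) with hb
  have hN0 : (0 : ℝ) < 2 * N := by rw [hNr]; linarith
  have hi' : (i : ℝ) + 1 ≤ N := by exact_mod_cast hi
  have hab' : b - a = 1 / (2 * N) := by rw [ha, hb]; ring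
  have hab : a < b := by
    have : 0 < 1 / (2 * (N : ℝ)) := by positivity
    linarith
  have ha0 : 0 ≤ a := by positivity
  have hb0 : 0 ≤ b := by linarith
  have hb2 : b ≤ 1 / 2 := by
    rw [hb, div_le_iff₀ hN0]; linarith
  have ha1 : a ≤ 1 := by linarith
  let x0 : Set.Icc (0 : ℝ) 1 := ⟨a, ha0, ha1⟩
  let f : Set.Icc (0 : ℝ) 1 → ℝ := fun x => if a ≤ (x : ℝ) ∧ (x : ℝ) < b then 1 else 0
  have hf : Measurable f := by
    refine Measurable.ite ?_ measurable_const measurable_const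
    exact (measurableSet_le measurable_const measurable_subtype_coe).inter
      (measurableSet_lt measurable_subtype_coe measurable_const)
  have hf01 : ∀ x, f x ∈ Set.Icc (0 : ℝ) 1 := fun x => by
    simp only [f]; split_ifs <;> simp
  have hmain := integral_count_le_of_close hd hK hM monotone_baseMean baseMean_mem
    (monotone_bumpMean a b) (bumpMean_mem a b) (fun x => baseMean_mem' x.2.1)
    (fun x => bumpMean_mem' hb0 x.2.1) f hf hf01 (w := b - a)
    (fun x => bumpMean_sub_sq_le ha0 hb2) A T hcount
  set E := thresholdMarket d K M hd (bumpMean a b) (monotone_bumpMean a b) (bumpMean_mem a b)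
    with hE
  have hKM : (1 : ℝ) ≤ K * M := by exact_mod_cast Nat.mul_le_mul hK hM
  have hu : ∀ y, E.utility y = K * M * ((1 - (y : ℝ)) * bumpMean a b y) :=
    utility_thresholdMarket hd _ _
  have hgap : ∀ y, E.utility y + K * M * ((b - a) / 4 * (1 - f y)) ≤ E.utility x0 := by
    intro y
    have h := one_sub_mul_bumpMean_le ha0 hab hb2 y
    rw [hu, hu, ← mul_add]
    refine mul_le_mul_of_nonneg_left ?_ (by linarith)
    simp only [f, x0]
    linarith
  have hmax : ∀ y, E.utility y ≤ E.utility x0 := by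
    intro y
    have h1 : 0 ≤ K * M * ((b - a) / 4 * (1 - f y)) := by
      have := (hf01 y).2
      refine mul_nonneg (by linarith) (mul_nonneg (by linarith) (by linarith))
    linarith [hgap y]
  refine ⟨E, rfl, ⟨x0, hmax⟩, ?_⟩
  have hopt : E.optimum = E.utility x0 := le_antisymm (ciSup_le hmax)
    (le_ciSup (f := E.utility) ⟨E.utility x0, by rintro _ ⟨y, rfl⟩; exact hmax y⟩ x0)
  have hcm : ∀ t, Measurable fun p : A.Seed × (ℕ → unitInterval) => E.contract A p.1 p.2 t :=
    fun t => E.measurable_contract A t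
  have hum : Measurable E.utility := by
    have h1 : E.utility
        = fun y : Set.Icc (0 : ℝ) 1 => K * M * ((1 - (y : ℝ)) * bumpMean a b y) := funext hu
    rw [h1]
    have := (monotone_bumpMean a b).measurable
    fun_prop
  set cnt : A.Seed × (ℕ → unitInterval) → ℝ := fun p =>
    ∑ t ∈ Finset.range T, f (E.contract A p.1 p.2 t) with hcnt
  have hci : Integrable cnt P := by
    refine integrable_of_abs_le (Finset.measurable_sum _ fun t _ => hf.comp (hcm t)) (C := T)
      fun p => ?_
    rw [abs_of_nonneg (Finset.sum_nonneg fun t _ => (hf01 _).1)]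
    exact (Finset.sum_le_card_nsmul _ _ 1 fun t _ => (hf01 _).2).trans (by simp)
  have hreg : ∫ p, K * M * ((b - a) / 4) * (T - cnt p) ∂P ≤ E.regret A T := by
    change _ ≤ ∫ p : A.Seed × (ℕ → unitInterval),
      (∑ t ∈ Finset.range T, (E.optimum - E.utility (E.contract A p.1 p.2 t))) ∂P
    refine integral_mono (((integrable_const _).sub hci).const_mul _) ?_ fun p => ?_
    · refine integrable_of_abs_le (C := T * (K * M)) (Finset.measurable_sum _ fun t _ =>
        measurable_const.sub (hum.comp (hcm t))) fun p => ?_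
      rw [hopt, abs_of_nonneg (Finset.sum_nonneg fun t _ => sub_nonneg.2 (hmax _))]
      refine (Finset.sum_le_card_nsmul _ _ ((K : ℝ) * M) fun t _ => ?_).trans (by simp)
      have h1 : E.utility x0 ≤ K * M := by
        rw [hu]
        refine mul_le_of_le_one_right (by linarith) ?_
        have := bumpMean_mem a b x0
        exact mul_le_one₀ (by simp [x0, ha0]) this.1 this.2
      have h2 : 0 ≤ E.utility (E.contract A p.1 p.2 t) := by
        rw [hu]
        exact mul_nonneg (by linarith) (mul_nonneg (sub_nonneg.2 (E.contract A p.1 p.2 t).2.2)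
          (bumpMean_mem a b _).1)
      linarith
    · simp only [hcnt]
      have : K * M * ((b - a) / 4) * ((T : ℝ) - ∑ t ∈ Finset.range T, f (E.contract A p.1 p.2 t))
          = ∑ t ∈ Finset.range T, K * M * ((b - a) / 4 * (1 - f (E.contract A p.1 p.2 t))) := by
        rw [← Finset.mul_sum, ← Finset.mul_sum, Finset.sum_sub_distrib]
        simp
        ring
      rw [this]
      refine Finset.sum_le_sum fun t _ => ?_
      rw [hopt]
      linarith [hgap (E.contract A p.1 p.2 t)]
  refine le_trans ?_ hreg
  rw [integral_const_mul, integral_sub (integrable_const _) hci]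
  simp only [integral_const, probReal_univ, smul_eq_mul, one_mul]
  have hE2 : ∫ p, cnt p ∂P ≤ T / N + T * (48 * (b - a) ^ 2 * (T / N) + 1 / 8) := hmain
  -- Three contributions of at most `T/8` each: the visits in the base market, the divergence term,
  -- which is `3/128 · T/n³` per round, and the additive constant of `integral_count_le_of_close`.
  have hcount2 : ∫ p, cnt p ∂P ≤ T / 2 := by
    refine hE2.trans ?_
    rw [hab', hNr]
    have h1 : (T : ℝ) / (8 * n) ≤ T / 8 := by
      apply div_le_div_of_nonneg_left <;> linarith
    have h2 : 48 * (1 / (2 * (8 * (n : ℝ)))) ^ 2 * (T / (8 * n)) ≤ 1 / 8 := by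
      have e : 48 * (1 / (2 * (8 * (n : ℝ)))) ^ 2 * (T / (8 * n))
          = 3 / 128 * (T / (n : ℝ) ^ 3) := by
        field_simp
        norm_num
      rw [e]
      have : T / (n : ℝ) ^ 3 ≤ 1 := by rw [div_le_one (by positivity)]; exact hTn'
      linarith
    nlinarith
  have hfin : (1 / 256) * (T : ℝ) ^ ((2 : ℝ) / 3) ≤ (b - a) / 4 * (T / 2) := by
    rw [hab', hNr]
    have e1 : (1 / (2 * (8 * (n : ℝ)))) / 4 * (T / 2) = T / n / 128 := by
      field_simp
      norm_num
    rw [e1]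
    have e2 : (T : ℝ) ^ ((2 : ℝ) / 3) * (T : ℝ) ^ ((1 : ℝ) / 3) = T := by
      rw [← Real.rpow_add (by linarith)]
      norm_num
    have h3 : (T : ℝ) ^ ((2 : ℝ) / 3) / 2 ≤ T / n := by
      rw [le_div_iff₀ (by linarith)]
      have := mul_le_mul_of_nonneg_left hnT
        (Real.rpow_nonneg (by linarith : (0 : ℝ) ≤ T) ((2 : ℝ) / 3))
      nlinarith
    linarith
  refine hfin.trans ?_
  have h4 : (b - a) / 4 * (T / 2) ≤ (b - a) / 4 * (T - ∫ p, cnt p ∂P) :=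
    mul_le_mul_of_nonneg_left (by linarith) (by linarith)
  have h5 : 0 ≤ (b - a) / 4 * (T - ∫ p, cnt p ∂P) := le_trans (by
    have : 0 ≤ (b - a) := by linarith
    positivity) h4
  rw [mul_assoc]
  nlinarith

end

/-! ### A logarithm-free index policy: pathwise analysis. -/

noncomputable section

section Bandit

variable {ι : Type} [DecidableEq ι]

/-- The number of pulls of the arm `i` before round `t`. -/
def pulls (a : ℕ → ι) (i : ι) (t : ℕ) : ℕ := ∑ r ∈ Finset.range t, if a r = i then 1 else 0

/-- The sum of `x` over those rounds before `t` that belong to the first `n` pulls of `i`. -/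
def batchSum (a : ℕ → ι) (x : ℕ → ℝ) (i : ι) (n t : ℕ) : ℝ :=
  ∑ r ∈ Finset.range t, if a r = i ∧ pulls a i r < n then x r else 0

/-- The confidence width after `16 ^ L` pulls. -/
def width (h L : ℕ) : ℝ := 8 ^ (h - L) / 4 ^ h

/-- The number of complete batches: the index of an arm is updated when its number of pulls
reaches a power of `16`. -/
def level (a : ℕ → ι) (i : ι) (t : ℕ) : ℕ := Nat.log 16 (pulls a i t)

/-- The optimistic index of the arm `i` in round `t`. -/
def armIndex (h : ℕ) (a : ℕ → ι) (x : ℕ → ℝ) (i : ι) (t : ℕ) : ℝ :=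
  if pulls a i t = 0 then 1
  else batchSum a x i (16 ^ level a i t) t / 16 ^ level a i t + width h (level a i t)

theorem width_pos (h L : ℕ) : 0 < width h L := by unfold width; positivity

theorem pulls_succ (a : ℕ → ι) (i : ι) (t : ℕ) :
    pulls a i (t + 1) = pulls a i t + if a t = i then 1 else 0 :=
  Finset.sum_range_succ _ _

theorem pulls_mono (a : ℕ → ι) (i : ι) : Monotone (pulls a i) :=
  monotone_nat_of_le_succ fun t => by rw [pulls_succ]; omega

theorem pulls_le (a : ℕ → ι) (i : ι) (t : ℕ) : pulls a i t ≤ t := by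
  refine (Finset.sum_le_card_nsmul _ _ 1 fun r _ => ?_).trans (by simp)
  split_ifs <;> simp

theorem pulls_lt_pulls {a : ℕ → ι} {i : ι} {s t : ℕ} (hs : a s = i) (hst : s < t) :
    pulls a i s < pulls a i t := by
  have h1 := pulls_succ a i s
  rw [if_pos hs] at h1
  have h2 := pulls_mono a i (show s + 1 ≤ t from hst)
  omega

theorem sum_batch_indicator (a : ℕ → ι) (i : ι) (n t : ℕ) :
    ∑ r ∈ Finset.range t, (if a r = i ∧ pulls a i r < n then (1 : ℝ) else 0)
      = (min n (pulls a i t) : ℕ) := by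
  induction t with
  | zero => simp [pulls]
  | succ t ih =>
    rw [Finset.sum_range_succ, ih, pulls_succ]
    by_cases h1 : a t = i
    · by_cases h2 : pulls a i t < n
      · rw [if_pos ⟨h1, h2⟩, if_pos h1, min_eq_right h2.le, min_eq_right h2]
        push_cast; rfl
      · rw [if_neg fun h => h2 h.2, min_eq_left (not_lt.1 h2), min_eq_left (by omega), add_zero]
    · rw [if_neg fun h => h1 h.1, if_neg h1, add_zero, add_zero]

/-- A completed batch never changes. Indices of all rounds can therefore be read off at the horizon,
and only one deviation per arm and level, not one per round, has to be controlled. -/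
theorem batchSum_eq_of_le (a : ℕ → ι) (x : ℕ → ℝ) (i : ι) {n t T : ℕ} (htT : t ≤ T)
    (hn : n ≤ pulls a i t) : batchSum a x i n T = batchSum a x i n t := by
  refine (Finset.sum_subset (Finset.range_subset_range.2 htT) fun r _ hr => ?_).symm
  rw [if_neg]
  rintro ⟨_, h2⟩
  have := pulls_mono a i (show t ≤ r by simpa using hr)
  omega

theorem batchSum_sub_const (a : ℕ → ι) (x : ℕ → ℝ) (i : ι) (c : ℝ) (n t : ℕ) :
    batchSum a (fun r => x r - c) i n t
      = batchSum a x i n t - c * (min n (pulls a i t) : ℕ) := by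
  rw [← sum_batch_indicator, batchSum, batchSum, Finset.mul_sum, ← Finset.sum_sub_distrib]
  refine Finset.sum_congr rfl fun r _ => ?_
  split_ifs <;> simp

theorem pow_level_le {a : ℕ → ι} {i : ι} {t : ℕ} (h : pulls a i t ≠ 0) :
    16 ^ level a i t ≤ pulls a i t :=
  Nat.pow_log_le_self 16 h

theorem armIndex_eq (h : ℕ) (a : ℕ → ι) (x : ℕ → ℝ) (i : ι) (c : ℝ) {t T : ℕ} (htT : t ≤ T)
    (h0 : pulls a i t ≠ 0) :
    armIndex h a x i t = c + batchSum a (fun r => x r - c) i (16 ^ level a i t) T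
      / 16 ^ level a i t + width h (level a i t) := by
  have h1 := pow_level_le h0
  rw [armIndex, if_neg h0, batchSum_eq_of_le a _ i htT h1, batchSum_sub_const, min_eq_left h1]
  push_cast
  field_simp
  ring

theorem pulls_congr {a a' : ℕ → ι} {t : ℕ} (h : ∀ r < t, a r = a' r) (i : ι) :
    pulls a i t = pulls a' i t :=
  Finset.sum_congr rfl fun r hr => by rw [h r (Finset.mem_range.1 hr)]

theorem armIndex_congr {a a' : ℕ → ι} {x x' : ℕ → ℝ} {t : ℕ} (ha : ∀ r < t, a r = a' r)
    (hx : ∀ r < t, x r = x' r) (h : ℕ) (i : ι) : armIndex h a x i t = armIndex h a' x' i t := by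
  have h1 := pulls_congr ha i
  have h2 : level a i t = level a' i t := by rw [level, h1, level]
  have h3 : ∀ n, batchSum a x i n t = batchSum a' x' i n t := fun n =>
    Finset.sum_congr rfl fun r hr => by
      have hr' := Finset.mem_range.1 hr
      rw [ha r hr', hx r hr', pulls_congr fun s hs => ha s (hs.trans hr')]
  rw [armIndex, armIndex, h1, h2, h3]

variable [Fintype ι]

/-- At level `L` the pull count is below `16^(L+1)` and it grows strictly with each pull, so each
pair of arm and level is charged at most `16^(L+1)` times. -/
theorem sum_level_le (a : ℕ → ι) (ψ : ι → ℕ → ℝ) (hψ : ∀ i L, 0 ≤ ψ i L) (T : ℕ) :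
    ∑ t ∈ Finset.range T, (if pulls a (a t) t = 0 then 0 else ψ (a t) (level a (a t) t))
      ≤ ∑ i, ∑ L ∈ Finset.range T, 16 ^ (L + 1) * ψ i L := by
  have h1 : ∀ t ∈ Finset.range T,
      (if pulls a (a t) t = 0 then 0 else ψ (a t) (level a (a t) t))
      ≤ ∑ i, ∑ L ∈ Finset.range T,
        if a t = i ∧ level a i t = L ∧ pulls a i t ≠ 0 then ψ i L else 0 := by
    intro t ht
    split_ifs with h0
    · exact Finset.sum_nonneg fun i _ => Finset.sum_nonneg fun L _ => by
        split_ifs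
        · exact hψ i L
        · exact le_rfl
    · have hL : level a (a t) t ∈ Finset.range T := by
        rw [Finset.mem_range] at ht ⊢
        exact ((Nat.log_le_self _ _).trans (pulls_le _ _ _)).trans_lt ht
      refine le_trans ?_ (Finset.single_le_sum (f := fun i => ∑ L ∈ Finset.range T,
        if a t = i ∧ level a i t = L ∧ pulls a i t ≠ 0 then ψ i L else 0)
        (fun i _ => Finset.sum_nonneg fun L _ => by
          split_ifs
          · exact hψ i L
          · exact le_rfl) (Finset.mem_univ (a t)))
      refine le_trans ?_ (Finset.single_le_sum (f := fun L =>
        if a t = a t ∧ level a (a t) t = L ∧ pulls a (a t) t ≠ 0 then ψ (a t) L else 0)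
        (fun L _ => by
          split_ifs
          · exact hψ _ L
          · exact le_rfl) hL)
      simp [h0]
  refine (Finset.sum_le_sum h1).trans ?_
  rw [Finset.sum_comm]
  refine Finset.sum_le_sum fun i _ => ?_
  rw [Finset.sum_comm]
  refine Finset.sum_le_sum fun L _ => ?_
  rw [← Finset.sum_filter, Finset.sum_const, nsmul_eq_mul]
  refine mul_le_mul_of_nonneg_right ?_ (hψ i L)
  have : (Finset.filter (fun t => a t = i ∧ level a i t = L ∧ pulls a i t ≠ 0)
      (Finset.range T)).card ≤ (Finset.range (16 ^ (L + 1))).card := by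
    refine Finset.card_le_card_of_injOn (pulls a i) (fun t ht => ?_) fun s hs t ht hst => ?_
    · simp only [Finset.coe_filter, Finset.mem_range, Set.mem_ofPred_eq] at ht
      simp only [Finset.coe_range, Set.mem_Iio]
      rw [← ht.2.2.1]
      exact Nat.lt_pow_succ_log_self (by norm_num) _
    · simp only [Finset.coe_filter, Finset.mem_range, Set.mem_ofPred_eq] at hs ht
      rcases lt_trichotomy s t with h | h | h
      · exact absurd hst (pulls_lt_pulls hs.2.1 h).ne
      · exact h
      · exact absurd hst (pulls_lt_pulls ht.2.1 h).ne'
  rw [Finset.card_range] at this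
  exact_mod_cast this

theorem card_first_pulls_le (a : ℕ → ι) (T : ℕ) :
    ∑ t ∈ Finset.range T, (if pulls a (a t) t = 0 then (1 : ℝ) else 0) ≤ Fintype.card ι := by
  rw [← Finset.sum_filter, Finset.sum_const, nsmul_eq_mul, mul_one]
  refine Nat.cast_le.2 (Finset.card_le_card_of_injOn a (fun _ _ => Finset.mem_univ _)
    fun s hs t ht hst => ?_)
  simp only [Finset.coe_filter, Finset.mem_range, Set.mem_ofPred_eq] at hs ht
  rcases lt_trichotomy s t with h | h | h
  · have := pulls_lt_pulls hst h
    omega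
  · exact h
  · have := pulls_lt_pulls hst.symm h
    omega

/-- The average deviation of the first `16 ^ L` pulls of `i` from `c`. -/
def deviation (a : ℕ → ι) (x : ℕ → ℝ) (i : ι) (c : ℝ) (T L : ℕ) : ℝ :=
  batchSum a (fun r => x r - c) i (16 ^ L) T / 16 ^ L

/-- Apart from first pulls, the shortfall `W` of the arm `i₀` over all levels gives `μ i₀ - W ≤
index of i₀ ≤ index of the played arm = mean + deviation + width`. The regret of the round is thus
at most `W`, plus the excess of the deviation over the width, plus twice the width. The part `1 /
4^h` of each width is charged to the round, the rest to the level. -/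
theorem regret_le_of_armIndex_le (h : ℕ) (a : ℕ → ι) (x : ℕ → ℝ) (μ : ι → ℝ)
    (hμ : ∀ i, μ i ∈ Set.Icc (0 : ℝ) 1)
    (hmax : ∀ t i, armIndex h a x i t ≤ armIndex h a x (a t) t) (i₀ : ι) (T : ℕ) :
    ∑ t ∈ Finset.range T, (μ i₀ - μ (a t))
      ≤ Fintype.card ι
        + T * ∑ L ∈ Finset.range T, max (-deviation a x i₀ (μ i₀) T L - width h L) 0
        + ∑ i, ∑ L ∈ Finset.range T, 16 ^ (L + 1) *
          (max (deviation a x i (μ i) T L - width h L) 0 + 2 * (width h L - 1 / 4 ^ h))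
        + 2 * (T / 4 ^ h) := by
  set W := ∑ L ∈ Finset.range T, max (-deviation a x i₀ (μ i₀) T L - width h L) 0 with hW
  set ψ : ι → ℕ → ℝ := fun i L =>
    max (deviation a x i (μ i) T L - width h L) 0 + 2 * (width h L - 1 / 4 ^ h) with hψ
  -- The truncated subtraction in `h - L` stops the width from shrinking below the target precision.
  have hwη : ∀ L, 1 / 4 ^ h ≤ width h L := fun L => by
    unfold width
    exact div_le_div_of_nonneg_right (one_le_pow₀ (by norm_num)) (by positivity)
  have hW0 : 0 ≤ W := Finset.sum_nonneg fun L _ => le_max_right _ _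
  have hψ0 : ∀ i L, 0 ≤ ψ i L := fun i L =>
    add_nonneg (le_max_right _ _) (mul_nonneg (by norm_num) (sub_nonneg.2 (hwη L)))
  have hη0 : (0 : ℝ) ≤ 1 / 4 ^ h := by positivity
  have hstep : ∀ t ∈ Finset.range T, μ i₀ - μ (a t) ≤
      (if pulls a (a t) t = 0 then (1 : ℝ) else 0) + W
        + (if pulls a (a t) t = 0 then 0 else ψ (a t) (level a (a t) t)) + 2 * (1 / 4 ^ h) := by
    intro t ht
    rw [Finset.mem_range] at ht
    split_ifs with h0
    · have h1 := (hμ i₀).2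
      have h2 := (hμ (a t)).1
      linarith
    · have h1 : μ i₀ - W ≤ armIndex h a x i₀ t := by
        -- The default index `1` of an unpulled arm is optimistic because means are at most one.
        by_cases h2 : pulls a i₀ t = 0
        · rw [armIndex, if_pos h2]
          linarith [(hμ i₀).2]
        · rw [armIndex_eq h a x i₀ (μ i₀) ht.le h2]
          have hL : level a i₀ t ∈ Finset.range T := by
            rw [Finset.mem_range]
            exact ((Nat.log_le_self _ _).trans (pulls_le _ _ _)).trans_lt ht
          have h3 := Finset.single_le_sum (f := fun L =>
            max (-deviation a x i₀ (μ i₀) T L - width h L) 0) (fun L _ => le_max_right _ _) hL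
          have h4 := le_max_left (-deviation a x i₀ (μ i₀) T (level a i₀ t)
            - width h (level a i₀ t)) 0
          simp only [← hW] at h3
          rw [deviation] at h3 h4
          linarith
      have h2 := h1.trans (hmax t i₀)
      rw [armIndex_eq h a x (a t) (μ (a t)) ht.le h0] at h2
      have h4 := le_max_left (deviation a x (a t) (μ (a t)) T (level a (a t) t)
            - width h (level a (a t) t)) 0
      simp only [hψ]
      rw [deviation] at h4 ⊢
      linarith
  refine (Finset.sum_le_sum hstep).trans ?_
  simp only [Finset.sum_add_distrib, Finset.sum_const, Finset.card_range, nsmul_eq_mul]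
  have h1 := card_first_pulls_le a T
  have h2 := sum_level_le a ψ hψ0 T
  have h3 : (T : ℝ) * (2 * (1 / 4 ^ h)) = 2 * (T / 4 ^ h) := by ring
  rw [h3]
  linarith

end Bandit

section Geometric

theorem sum_half_pow_le (n : ℕ) : ∑ j ∈ Finset.range n, (1 / 2 : ℝ) ^ j ≤ 2 := by
  rw [geom_sum_eq (by norm_num), div_le_iff_of_neg (by norm_num)]
  have : (0 : ℝ) < (1 / 2) ^ n := by positivity
  linarith

/-- In truncated subtraction `(h - L) + (L - h)` is `|h - L|`; each side of `h` contributes at most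
`2`. -/
theorem sum_half_pow_dist_le (h n : ℕ) :
    ∑ L ∈ Finset.range n, (1 / 2 : ℝ) ^ ((h - L) + (L - h)) ≤ 4 := by
  have h1 : ∑ L ∈ Finset.range n, (1 / 2 : ℝ) ^ ((h - L) + (L - h))
      ≤ ∑ L ∈ Finset.range (h + n), (1 / 2 : ℝ) ^ ((h - L) + (L - h)) :=
    Finset.sum_le_sum_of_subset_of_nonneg (Finset.range_subset_range.2 (by omega))
      fun _ _ _ => by positivity
  rw [Finset.sum_range_add] at h1
  have h2 : ∑ L ∈ Finset.range h, (1 / 2 : ℝ) ^ ((h - L) + (L - h)) ≤ 2 := by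
    rw [← Finset.sum_range_reflect]
    refine (Finset.sum_le_sum fun j hj => ?_).trans (sum_half_pow_le h)
    rw [Finset.mem_range] at hj
    exact pow_le_pow_of_le_one (by norm_num) (by norm_num) (by omega)
  have h3 : ∑ j ∈ Finset.range n, (1 / 2 : ℝ) ^ ((h - (h + j)) + (h + j - h)) ≤ 2 := by
    refine (Finset.sum_le_sum fun j _ => ?_).trans (sum_half_pow_le n)
    exact pow_le_pow_of_le_one (by norm_num) (by norm_num) (by omega)
  linarith

/-- The left side is (scale)⁴ / width³ with scale `4^(-L)`. For `L = h - k` the width is `2^k`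
scales, leaving `4^(-L) / 8^k = 4^(-h) / 2^k`; for `L = h + k` the value is `4^(-h) / 256^k`. -/
theorem inv_width_cube_le (h L : ℕ) :
    1 / (256 ^ L * width h L ^ 3) ≤ 1 / 4 ^ h * (1 / 2) ^ ((h - L) + (L - h)) := by
  unfold width
  rw [div_pow, ← one_div_pow]
  rcases le_total L h with hLh | hLh
  · obtain ⟨k, rfl⟩ := Nat.exists_eq_add_of_le hLh
    rw [show L + k - L = k by omega, show L - (L + k) = 0 by omega, add_zero]
    have e : (1 : ℝ) / (256 ^ L * ((8 ^ k) ^ 3 / (4 ^ (L + k)) ^ 3))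
        = (1 / 4) ^ (L + k) * (1 / 2) ^ k := by
      rw [show (256 : ℝ) = 4 ^ 4 by norm_num, show (8 : ℝ) = 2 ^ 3 by norm_num,
        show (4 : ℝ) = 2 ^ 2 by norm_num]
      rw [one_div_pow, one_div_pow]
      field_simp
      simp only [← pow_mul, ← pow_add]
      congr 1
      ring
    exact e.le
  · obtain ⟨k, rfl⟩ := Nat.exists_eq_add_of_le hLh
    rw [show h + k - h = k by omega, show h - (h + k) = 0 by omega, zero_add, pow_zero, one_pow]
    have e : (1 : ℝ) / (256 ^ (h + k) * (1 / (4 ^ h) ^ 3)) = (1 / 4) ^ h * (1 / 256) ^ k := by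
      rw [show (256 : ℝ) = 4 ^ 4 by norm_num]
      rw [one_div_pow, one_div_pow]
      field_simp
      simp only [← pow_mul, ← pow_add]
      congr 1
      ring
    rw [e]
    exact mul_le_mul_of_nonneg_left (pow_le_pow_left₀ (by norm_num) (by norm_num) k)
      (by positivity)

theorem pow_inv_width_cube_le (h L : ℕ) :
    16 ^ L * (1 / (256 ^ L * width h L ^ 3)) ≤ 4 ^ h * (1 / 2) ^ ((h - L) + (L - h)) := by
  unfold width
  rw [div_pow]
  rcases le_total L h with hLh | hLh
  · obtain ⟨k, rfl⟩ := Nat.exists_eq_add_of_le hLh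
    rw [show L + k - L = k by omega, show L - (L + k) = 0 by omega, add_zero]
    have e : (16 : ℝ) ^ L * (1 / (256 ^ L * ((8 ^ k) ^ 3 / (4 ^ (L + k)) ^ 3)))
        = 4 ^ (L + k) * (1 / 32) ^ k := by
      rw [show (256 : ℝ) = 2 ^ 8 by norm_num, show (8 : ℝ) = 2 ^ 3 by norm_num,
        show (4 : ℝ) = 2 ^ 2 by norm_num, show (16 : ℝ) = 2 ^ 4 by norm_num,
        show (32 : ℝ) = 2 ^ 5 by norm_num]
      rw [one_div_pow]
      field_simp
      simp only [← pow_mul, ← pow_add]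
      congr 1
      ring
    rw [e]
    exact mul_le_mul_of_nonneg_left (pow_le_pow_left₀ (by norm_num) (by norm_num) k)
      (by positivity)
  · obtain ⟨k, rfl⟩ := Nat.exists_eq_add_of_le hLh
    rw [show h + k - h = k by omega, show h - (h + k) = 0 by omega, zero_add, pow_zero, one_pow]
    have e : (16 : ℝ) ^ (h + k) * (1 / (256 ^ (h + k) * (1 / (4 ^ h) ^ 3)))
        = 4 ^ h * (1 / 16) ^ k := by
      rw [show (256 : ℝ) = 2 ^ 8 by norm_num,
        show (4 : ℝ) = 2 ^ 2 by norm_num, show (16 : ℝ) = 2 ^ 4 by norm_num]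
      rw [one_div_pow]
      field_simp
      simp only [← pow_mul, ← pow_add]
      congr 1
      ring
    rw [e]
    exact mul_le_mul_of_nonneg_left (pow_le_pow_left₀ (by norm_num) (by norm_num) k)
      (by positivity)

/-- The base `8` of the width is below `16`, so the cost of exploring at width `8^(h-L) / 4^h` for
`16^L` pulls is dominated by levels near `h`; from level `h` on the difference vanishes. -/
theorem pow_mul_width_sub_le (h L : ℕ) :
    16 ^ L * (width h L - 1 / 4 ^ h) ≤ 4 ^ h * (1 / 2) ^ ((h - L) + (L - h)) := by
  unfold width
  rcases le_total L h with hLh | hLh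
  · obtain ⟨k, rfl⟩ := Nat.exists_eq_add_of_le hLh
    rw [show L + k - L = k by omega, show L - (L + k) = 0 by omega, add_zero]
    have e : (16 : ℝ) ^ L * (8 ^ k / 4 ^ (L + k)) = 4 ^ (L + k) * (1 / 2) ^ k := by
      rw [show (8 : ℝ) = 2 ^ 3 by norm_num,
        show (4 : ℝ) = 2 ^ 2 by norm_num, show (16 : ℝ) = 2 ^ 4 by norm_num]
      rw [one_div_pow]
      field_simp
      simp only [← pow_mul, ← pow_add]
      congr 1
      ring
    rw [mul_sub, e]
    have : (0 : ℝ) ≤ 16 ^ L * (1 / 4 ^ (L + k)) := by positivity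
    linarith
  · rw [show h - L = 0 by omega, pow_zero, sub_self, mul_zero]
    positivity

end Geometric
end

/-! ### Expected regret of the index policy. -/

noncomputable section

section BanditExpectation

variable {S Y ι : Type} [MeasurableSpace S] [MeasurableSpace Y] [MeasurableSpace ι]
  [DiscreteMeasurableSpace ι] [DecidableEq ι]

/-- The cube is needed: at level `h - k` the width is `2^k` times a scale `4^k · 4^(-h)`, so a
square in the denominator would leave no decay in `k`. -/
theorem max_sub_le_pow_four_div {x w : ℝ} (hw : 0 < w) : max (x - w) 0 ≤ x ^ 4 / w ^ 3 := by
  refine max_le ?_ (by positivity)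
  rcases le_total x w with h | h
  · have : 0 ≤ x ^ 4 / w ^ 3 := by positivity
    linarith
  · rw [le_div_iff₀ (by positivity)]
    have h1 : w ^ 3 ≤ x ^ 3 := pow_le_pow_left₀ hw.le h 3
    have h2 : (x - w) * w ^ 3 ≤ x * x ^ 3 :=
      mul_le_mul (by linarith) h1 (by positivity) (by linarith)
    linarith [show x * x ^ 3 = x ^ 4 by ring]

theorem measurable_pulls {Ω : Type} [MeasurableSpace Ω] {a : ℕ → Ω → ι} {t : ℕ}
    (ha : ∀ r < t, Measurable (a r)) (i : ι) : Measurable fun p => pulls (fun r => a r p) i t := by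
  refine Finset.measurable_sum _ fun r hr => ?_
  exact Measurable.ite (ha r (Finset.mem_range.1 hr) (measurableSet_singleton i))
    measurable_const measurable_const

theorem measurable_armIndex {Ω : Type} [MeasurableSpace Ω] {a : ℕ → Ω → ι} {x : ℕ → Ω → ℝ} {t : ℕ}
    (ha : ∀ r < t, Measurable (a r)) (hx : ∀ r < t, Measurable (x r)) (h : ℕ) (i : ι) :
    Measurable fun p => armIndex h (fun r => a r p) (fun r => x r p) i t := by
  have hp := measurable_pulls ha i
  have hl : Measurable fun p => level (fun r => a r p) i t :=
    (measurable_from_top (f := Nat.log 16)).comp hp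
  refine Measurable.ite (hp (measurableSet_singleton 0)) measurable_const ?_
  refine Measurable.add (Measurable.div ?_ ?_) ?_
  · refine Finset.measurable_sum _ fun r hr => Measurable.ite ?_ (hx r (Finset.mem_range.1 hr))
      measurable_const
    have hr' := Finset.mem_range.1 hr
    refine (ha r hr' (measurableSet_singleton i)).inter (measurableSet_lt
      (measurable_pulls (fun s hs => ha s (hs.trans hr')) i) ?_)
    exact (measurable_from_top (f := fun n : ℕ => 16 ^ n)).comp hl
  · exact (measurable_from_top (f := fun n : ℕ => (16 : ℝ) ^ n)).comp hl
  · exact (measurable_from_top (f := fun n : ℕ => width h n)).comp hl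

variable [Fintype ι]

/-- Each batch deviation is a martingale with at most `16^L` increments, so its fourth moment is at
most `96 / 256^L`, and the pathwise bound sums to geometric series over the levels. Since the levels
are not handled by a union bound at a common confidence, no logarithm appears. -/
theorem integral_bandit_regret_le (σ : Measure S) [IsProbabilityMeasure σ] (ν : Measure Y)
    [IsProbabilityMeasure ν] (a : ℕ → S × (ℕ → Y) → ι) (ham : ∀ t, Measurable (a t))
    (hap : ∀ t, DependsOnPast t (a t)) (X : ι → Y → ℝ) (hXm : ∀ i, Measurable (X i))
    (hX : ∀ i y, X i y ∈ Set.Icc (0 : ℝ) 1) (h : ℕ)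
    (hmax : ∀ p t i, armIndex h (fun r => a r p) (fun r => X (a r p) (p.2 r)) i t
      ≤ armIndex h (fun r => a r p) (fun r => X (a r p) (p.2 r)) (a t p) t) (i₀ : ι) (T : ℕ) :
    ∫ p, ∑ t ∈ Finset.range T, ((∫ y, X i₀ y ∂ν) - ∫ y, X (a t p) y ∂ν)
        ∂(σ.prod (Measure.infinitePi fun _ : ℕ => ν))
      ≤ 400 * (T / 4 ^ h) + 7000 * (Fintype.card ι * 4 ^ h) := by
  set P := σ.prod (Measure.infinitePi fun _ : ℕ => ν) with hP
  set μ : ι → ℝ := fun i => ∫ y, X i y ∂ν with hμdef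
  have hXi : ∀ i, Integrable (X i) ν := fun i => integrable_of_abs_le (hXm i) (C := 1) fun y => by
    rw [abs_of_nonneg (hX i y).1]; exact (hX i y).2
  have hμ : ∀ i, μ i ∈ Set.Icc (0 : ℝ) 1 := fun i =>
    ⟨integral_nonneg fun y => (hX i y).1, by
      have := integral_mono (hXi i) (integrable_const 1) fun y => (hX i y).2
      simpa using this⟩
  let dev : ι → ℕ → S × (ℕ → Y) → ℝ := fun i L p =>
    deviation (fun r => a r p) (fun r => X (a r p) (p.2 r)) i (μ i) T L
  -- The centring uses the reward of the fixed arm `i`, not of the played arm; the two agree on the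
  -- predictable event that `i` is played within its first `16^L` pulls.
  let q : ι → ℕ → ℕ → (S × (ℕ → Y)) × Y → ℝ := fun i L t z =>
    if a t z.1 = i ∧ pulls (fun r => a r z.1) i t < 16 ^ L then X i z.2 - μ i else 0
  let g : ι → ℕ → ℕ → S × (ℕ → Y) → ℝ := fun i L t p =>
    if a t p = i ∧ pulls (fun r => a r p) i t < 16 ^ L then 1 else 0
  have hset : ∀ i L t, MeasurableSet
      {p : S × (ℕ → Y) | a t p = i ∧ pulls (fun r => a r p) i t < 16 ^ L} := fun i L t =>
    (ham t (measurableSet_singleton i)).inter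
      (measurableSet_lt (measurable_pulls (fun r _ => ham r) i) measurable_const)
  have hpe : ∀ (i : ι) (t : ℕ) (s : S) (ω ω' : ℕ → Y), (∀ r < t, ω r = ω' r) →
      a t (s, ω) = a t (s, ω') ∧
        pulls (fun r => a r (s, ω)) i t = pulls (fun r => a r (s, ω')) i t := by
    intro i t s ω ω' hω
    refine ⟨hap t s ω ω' hω, pulls_congr (fun r hr => ?_) i⟩
    exact hap r s ω ω' fun r' hr' => hω r' (hr'.trans hr)
  have hdevq : ∀ i L p, dev i L p = (∑ t ∈ Finset.range T, q i L t (p, p.2 t)) / 16 ^ L := by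
    intro i L p
    simp only [dev, deviation, batchSum, q]
    congr 1
    refine Finset.sum_congr rfl fun t _ => ?_
    split_ifs with h1
    · rw [h1.1]
    · rfl
  have hqm : ∀ i L t, Measurable (q i L t) := fun i L t =>
    Measurable.ite ((hset i L t).preimage measurable_fst)
      (((hXm i).comp measurable_snd).sub measurable_const) measurable_const
  have hgm : ∀ i L t, Measurable (g i L t) := fun i L t =>
    Measurable.ite (hset i L t) measurable_const measurable_const
  have hXμ : ∀ i y, |X i y - μ i| ≤ 1 := fun i y => by
    have h1 := hX i y
    have h2 := hμ i
    rw [abs_le]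
    constructor <;> linarith [h1.1, h1.2, h2.1, h2.2]
  have hmoment : ∀ i L, ∫ p, (∑ t ∈ Finset.range T, q i L t (p, p.2 t)) ^ 4 ∂P
      ≤ 96 * 256 ^ L := by
    intro i L
    have := integral_pow_four_sum_le σ ν (q i L) (g i L) one_pos (hqm i L) (hgm i L)
      (fun t y s ω ω' hω => by
        have h1 := hpe i t s ω ω' hω
        simp only [q, h1.1, h1.2])
      (fun t s ω ω' hω => by
        have h1 := hpe i t s ω ω' hω
        simp only [g, h1.1, h1.2])
      (fun t p => by simp only [g]; split_ifs <;> simp)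
      (fun t p y => by
        simp only [q, g]
        split_ifs
        · simpa using hXμ i y
        · simp)
      (fun t p => by
        simp only [q]
        split_ifs
        · rw [integral_sub (hXi i) (integrable_const _)]
          simp [hμdef]
        · simp) T (n := 16 ^ L) (by positivity)
      (fun p => by
        simp only [g]
        rw [sum_batch_indicator (fun r => a r p) i (16 ^ L) T]
        exact_mod_cast min_le_left _ _)
    refine this.trans (le_of_eq ?_)
    rw [← pow_mul, mul_comm L 2, pow_mul]
    norm_num
  have hdevm : ∀ i L, Measurable (dev i L) := fun i L => by
    have : dev i L = fun p => (∑ t ∈ Finset.range T, q i L t (p, p.2 t)) / 16 ^ L :=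
      funext (hdevq i L)
    rw [this]
    refine (Finset.measurable_sum _ fun t _ => (hqm i L t).comp ?_).div_const _
    fun_prop
  have hVb : ∀ i L p, |∑ t ∈ Finset.range T, q i L t (p, p.2 t)| ≤ T := fun i L p => by
    refine (Finset.abs_sum_le_sum_abs _ _).trans
      ((Finset.sum_le_card_nsmul _ _ 1 fun t _ => ?_).trans (by simp))
    simp only [q]
    split_ifs
    · exact hXμ i _
    · simp
  have hdevb : ∀ i L p, |dev i L p| ≤ T := fun i L p => by
    rw [hdevq, abs_div, abs_of_pos (by positivity : (0 : ℝ) < 16 ^ L)]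
    exact (div_le_self (abs_nonneg _) (one_le_pow₀ (by norm_num))).trans (hVb i L p)
  -- both signs are needed: the optimal arm must not look too bad, the others not too good
  have hpos : ∀ (e : ℝ), e = 1 ∨ e = -1 → ∀ i L,
      Integrable (fun p => max (e * dev i L p - width h L) 0) P ∧
      ∫ p, max (e * dev i L p - width h L) 0 ∂P ≤ 96 * (1 / (256 ^ L * width h L ^ 3)) := by
    intro e he i L
    have hw := width_pos h L
    have he1 : |e| = 1 := by rcases he with rfl | rfl <;> simp
    have he4 : e ^ 4 = 1 := by rcases he with rfl | rfl <;> norm_num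
    have hV4 : Integrable (fun p : S × (ℕ → Y) =>
        (∑ t ∈ Finset.range T, q i L t (p, p.2 t)) ^ 4) P := by
      refine integrable_of_abs_le (C := T ^ 4) ?_ fun p => ?_
      · refine (Finset.measurable_sum _ fun t _ => (hqm i L t).comp ?_).pow_const _
        fun_prop
      · rw [abs_pow]
        exact pow_le_pow_left₀ (abs_nonneg _) (hVb i L p) 4
    refine ⟨integrable_of_abs_le (C := T)
      (((hdevm i L).const_mul e).sub_const _ |>.max measurable_const) fun p => ?_, ?_⟩
    · rw [abs_of_nonneg (le_max_right _ _)]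
      refine max_le ?_ (Nat.cast_nonneg T)
      have h1 := (le_abs_self (e * dev i L p))
      rw [abs_mul, he1, one_mul] at h1
      linarith [hdevb i L p]
    · refine (integral_mono_of_nonneg (Filter.Eventually.of_forall fun p => le_max_right _ _)
        (hV4.const_mul (1 / ((16 ^ L) ^ 4 * width h L ^ 3)))
        (Filter.Eventually.of_forall fun p => ?_)).trans ?_
      · refine (max_sub_le_pow_four_div hw).trans (le_of_eq ?_)
        rw [hdevq, mul_pow, he4, div_pow]
        field_simp
      · rw [integral_const_mul]
        refine (mul_le_mul_of_nonneg_left (hmoment i L) (by positivity)).trans (le_of_eq ?_)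
        rw [show ((16 : ℝ) ^ L) ^ 4 = 256 ^ L * 256 ^ L by
          rw [← pow_mul, ← mul_pow, mul_comm L 4, pow_mul]; norm_num]
        field_simp
  have hI1 : ∀ L, Integrable (fun p => max (-dev i₀ L p - width h L) 0) P ∧
      ∫ p, max (-dev i₀ L p - width h L) 0 ∂P ≤ 96 * (1 / (256 ^ L * width h L ^ 3)) := fun L => by
    simpa using hpos (-1) (Or.inr rfl) i₀ L
  have hI2 : ∀ i L, Integrable (fun p => max (dev i L p - width h L) 0) P ∧
      ∫ p, max (dev i L p - width h L) 0 ∂P ≤ 96 * (1 / (256 ^ L * width h L ^ 3)) := fun i L => by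
    simpa using hpos 1 (Or.inl rfl) i L
  have hI3 : ∀ i L, Integrable (fun p => 16 ^ (L + 1) *
      (max (dev i L p - width h L) 0 + 2 * (width h L - 1 / 4 ^ h))) P := fun i L =>
    ((hI2 i L).1.add (integrable_const _)).const_mul _
  have hJ1 : Integrable (fun p => ∑ L ∈ Finset.range T, max (-dev i₀ L p - width h L) 0) P :=
    integrable_finsetSum _ fun L _ => (hI1 L).1
  have hJ2 : Integrable (fun p => ∑ i, ∑ L ∈ Finset.range T, 16 ^ (L + 1) *
      (max (dev i L p - width h L) 0 + 2 * (width h L - 1 / 4 ^ h))) P :=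
    integrable_finsetSum _ fun i _ => integrable_finsetSum _ fun L _ => hI3 i L
  have hreg : ∀ p, ∑ t ∈ Finset.range T, (μ i₀ - μ (a t p)) ≤ Fintype.card ι
        + T * ∑ L ∈ Finset.range T, max (-dev i₀ L p - width h L) 0
        + ∑ i, ∑ L ∈ Finset.range T, 16 ^ (L + 1) *
          (max (dev i L p - width h L) 0 + 2 * (width h L - 1 / 4 ^ h))
        + 2 * (T / 4 ^ h) := fun p =>
    regret_le_of_armIndex_le h (fun r => a r p) _ μ hμ (hmax p) i₀ T
  have hJ3 : Integrable (fun p => (Fintype.card ι : ℝ)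
      + T * ∑ L ∈ Finset.range T, max (-dev i₀ L p - width h L) 0) P :=
    (integrable_const _).add (hJ1.const_mul _)
  have hJ4 : Integrable (fun p => (Fintype.card ι : ℝ)
      + T * ∑ L ∈ Finset.range T, max (-dev i₀ L p - width h L) 0
      + ∑ i, ∑ L ∈ Finset.range T, 16 ^ (L + 1) *
          (max (dev i L p - width h L) 0 + 2 * (width h L - 1 / 4 ^ h))) P := hJ3.add hJ2
  refine (integral_mono ?_ (hJ4.add (integrable_const _)) hreg).trans ?_
  · refine integrable_of_abs_le (C := T) (Finset.measurable_sum _ fun t _ =>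
      measurable_const.sub ((measurable_of_countable μ).comp (ham t))) fun p => ?_
    refine (Finset.abs_sum_le_sum_abs _ _).trans
      ((Finset.sum_le_card_nsmul _ _ 1 fun t _ => ?_).trans (by simp))
    have h1 := hμ i₀
    have h2 := hμ (a t p)
    change |μ i₀ - μ (a t p)| ≤ 1
    rw [abs_le]
    constructor <;> linarith [h1.1, h1.2, h2.1, h2.2]
  simp only [Pi.add_apply]
  rw [integral_add hJ4 (integrable_const _), integral_add hJ3 hJ2,
    integral_add (integrable_const _) (hJ1.const_mul _), integral_const_mul,
    integral_finsetSum _ fun L _ => (hI1 L).1,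
    integral_finsetSum _ fun i _ => integrable_finsetSum _ fun L _ => hI3 i L]
  simp only [integral_const, probReal_univ, smul_eq_mul, one_mul]
  have hgeo := sum_half_pow_dist_le h T
  have hA : ∑ L ∈ Finset.range T, ∫ p, max (-dev i₀ L p - width h L) 0 ∂P
      ≤ 384 * (1 / 4 ^ h) := by
    calc _ ≤ ∑ L ∈ Finset.range T, 96 * (1 / 4 ^ h * (1 / 2 : ℝ) ^ ((h - L) + (L - h))) :=
          Finset.sum_le_sum fun L _ => (hI1 L).2.trans
            (mul_le_mul_of_nonneg_left (inv_width_cube_le h L) (by norm_num))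
      _ = 96 * (1 / 4 ^ h) * ∑ L ∈ Finset.range T, (1 / 2) ^ ((h - L) + (L - h)) := by
          rw [Finset.mul_sum]
          exact Finset.sum_congr rfl fun L _ => by ring
      _ ≤ 96 * (1 / 4 ^ h) * 4 := mul_le_mul_of_nonneg_left hgeo (by positivity)
      _ = _ := by ring
  -- Each level costs `16 · (96 + 2) = 1568` units, from the excess deviation and from twice the
  -- reduced width; the geometric sum contributes `4`.
  have hB : ∀ i, ∫ p, ∑ L ∈ Finset.range T, 16 ^ (L + 1) *
      (max (dev i L p - width h L) 0 + 2 * (width h L - 1 / 4 ^ h)) ∂P ≤ 6272 * 4 ^ h := by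
    intro i
    rw [integral_finsetSum _ fun L _ => hI3 i L]
    calc _ ≤ ∑ L ∈ Finset.range T, 1568 * (4 ^ h * (1 / 2 : ℝ) ^ ((h - L) + (L - h))) := by
          refine Finset.sum_le_sum fun L _ => ?_
          rw [integral_const_mul, integral_add (hI2 i L).1 (integrable_const _)]
          simp only [integral_const, probReal_univ, smul_eq_mul, one_mul]
          have h1 := (hI2 i L).2
          have h2 := pow_inv_width_cube_le h L
          have h3 := pow_mul_width_sub_le h L
          have h4 := mul_le_mul_of_nonneg_left h1 (by positivity : (0 : ℝ) ≤ 16 ^ (L + 1))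
          rw [pow_succ] at h4 ⊢
          linarith
      _ = 1568 * 4 ^ h * ∑ L ∈ Finset.range T, (1 / 2 : ℝ) ^ ((h - L) + (L - h)) := by
          rw [Finset.mul_sum]
          exact Finset.sum_congr rfl fun L _ => by ring
      _ ≤ 1568 * 4 ^ h * 4 := mul_le_mul_of_nonneg_left hgeo (by positivity)
      _ = _ := by ring
  have hB' := Finset.sum_le_card_nsmul Finset.univ _ _ fun i _ => hB i
  rw [nsmul_eq_mul, Finset.card_univ] at hB'
  have hA' := mul_le_mul_of_nonneg_left hA (Nat.cast_nonneg (α := ℝ) T)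
  have h1 : (Fintype.card ι : ℝ) ≤ Fintype.card ι * 4 ^ h :=
    le_mul_of_one_le_right (Nat.cast_nonneg _) (one_le_pow₀ (by norm_num))
  have h2 : (0 : ℝ) ≤ T / 4 ^ h := by positivity
  have h3 : (T : ℝ) * (384 * (1 / 4 ^ h)) = 384 * (T / 4 ^ h) := by ring
  have h4 : (0 : ℝ) ≤ Fintype.card ι := Nat.cast_nonneg _
  linarith

end BanditExpectation

/-- Adding one index at a time, the running maximiser is kept or replaced on a measurable event; the
new index wins ties. -/
theorem exists_measurable_argmax {Ω ι : Type} [MeasurableSpace Ω] [MeasurableSpace ι] [Fintype ι]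
    [Nonempty ι] (f : ι → Ω → ℝ) (hf : ∀ i, Measurable (f i)) :
    ∃ g : Ω → ι, Measurable g ∧ ∀ ω i, f i ω ≤ f (g ω) ω := by
  classical
  have key : ∀ s : Finset ι, s.Nonempty → ∃ g : Ω → ι, Measurable g ∧
      Measurable (fun ω => f (g ω) ω) ∧ ∀ ω, ∀ i ∈ s, f i ω ≤ f (g ω) ω := by
    intro s hs
    induction hs using Finset.Nonempty.cons_induction with
    | singleton i =>
      exact ⟨fun _ => i, measurable_const, hf i, fun ω j hj => by
        rw [Finset.mem_singleton.1 hj]⟩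
    | cons i s _ _ ih =>
      obtain ⟨g, hg, hfg, hmax⟩ := ih
      have hset : MeasurableSet {ω | f (g ω) ω ≤ f i ω} := measurableSet_le hfg (hf i)
      refine ⟨fun ω => if f (g ω) ω ≤ f i ω then i else g ω,
        Measurable.ite hset measurable_const hg, ?_, fun ω j hj => ?_⟩
      · have : (fun ω => f (if f (g ω) ω ≤ f i ω then i else g ω) ω)
            = fun ω => if f (g ω) ω ≤ f i ω then f i ω else f (g ω) ω := by
          funext ω
          split_ifs <;> rfl
        rw [this]
        exact Measurable.ite hset (hf i) hfg
      · rw [Finset.mem_cons] at hj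
        beta_reduce
        split_ifs with h
        · rcases hj with rfl | hj
          · exact le_rfl
          · exact (hmax ω j hj).trans h
        · rcases hj with rfl | hj
          · exact (not_le.1 h).le
          · exact hmax ω j hj
  obtain ⟨g, hg, _, hmax⟩ := key Finset.univ Finset.univ_nonempty
  exact ⟨g, hg, fun ω i => hmax ω i (Finset.mem_univ i)⟩
end

/-! ### Rewards of a market, and the upper bound for return-based contracts. -/

noncomputable section

namespace CreatorMarket

variable {d K M : ℕ} {X : Type} [MeasurableSpace X] {pay : X → Vec d → ℝ → ℝ}

theorem measurable_reward_left (E : CreatorMarket d K M pay) (c : Fin K → E.C) :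
    Measurable (E.reward c) :=
  E.measurable_reward.comp (measurable_const.prodMk measurable_id)

theorem measurable_reward_apply (E : CreatorMarket d K M pay) (c : Fin K → E.C) (k : Fin K) :
    Measurable fun ω (j : Fin M) => E.reward c ω j k := by
  have := E.measurable_reward_left c
  fun_prop

theorem isProbabilityMeasure_rewardLaw (hK : 1 ≤ K) (E : CreatorMarket d K M pay) (c : E.C) :
    IsProbabilityMeasure (E.rewardLaw c) := by
  rw [← E.map_reward (fun _ => c) ⟨0, hK⟩]
  exact Measure.isProbabilityMeasure_map (E.measurable_reward_apply _ _).aemeasurable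

theorem integral_rewardLaw (E : CreatorMarket d K M pay) (c : Fin K → E.C) (k : Fin K)
    {φ : (Fin M → ℝ) → ℝ} (hφ : Measurable φ) :
    ∫ r, φ r ∂(E.rewardLaw (c k)) = ∫ ω, φ (fun j => E.reward c ω j k) ∂E.noise := by
  rw [← E.map_reward c k, integral_map (E.measurable_reward_apply c k).aemeasurable
    hφ.aestronglyMeasurable]

/-- The expected total reward of a content. -/
def totalReward (E : CreatorMarket d K M pay) (c : E.C) : ℝ := ∫ r, ∑ j, r j ∂(E.rewardLaw c)

theorem integrable_reward (E : CreatorMarket d K M pay) (c : Fin K → E.C) (j : Fin M) (k : Fin K) :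
    Integrable (fun ω => E.reward c ω j k) E.noise := by
  refine integrable_of_abs_le (C := 1) ?_ fun ω => ?_
  · have := E.measurable_reward_left c
    fun_prop
  · rw [abs_of_nonneg (E.reward_mem c ω j k).1]
    exact (E.reward_mem c ω j k).2

theorem totalReward_eq (E : CreatorMarket d K M pay) (c : Fin K → E.C) (k : Fin K) :
    E.totalReward (c k) = ∫ ω, ∑ j, E.reward c ω j k ∂E.noise :=
  E.integral_rewardLaw c k (by fun_prop)

theorem integral_sum_reward (E : CreatorMarket d K M pay) (c : Fin K → E.C) :
    ∫ ω, ∑ k, ∑ j, E.reward c ω j k ∂E.noise = ∑ k, E.totalReward (c k) := by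
  rw [integral_finsetSum _ fun k _ => integrable_finsetSum _ fun j _ => E.integrable_reward c j k]
  exact Finset.sum_congr rfl fun k _ => (E.totalReward_eq c k).symm

theorem totalReward_mem (hK : 1 ≤ K) (E : CreatorMarket d K M pay) (c : E.C) :
    E.totalReward c ∈ Set.Icc (0 : ℝ) M := by
  have h := E.totalReward_eq (fun _ => c) ⟨0, hK⟩
  rw [h]
  refine ⟨integral_nonneg fun ω => Finset.sum_nonneg fun j _ => (E.reward_mem _ _ _ _).1, ?_⟩
  have h1 := integral_mono (integrable_finsetSum Finset.univ fun j _ =>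
    E.integrable_reward (fun _ => c) j ⟨0, hK⟩) (integrable_const (M : ℝ)) fun ω =>
      (Finset.sum_le_card_nsmul Finset.univ _ 1 fun j _ =>
        (E.reward_mem (fun _ => c) ω j ⟨0, hK⟩).2).trans (by simp)
  simpa using h1

theorem sum_reward_mem (E : CreatorMarket d K M pay) (c : Fin K → E.C) (ω : E.Noise) :
    ∑ k, ∑ j, E.reward c ω j k ∈ Set.Icc (0 : ℝ) (K * M) := by
  refine ⟨Finset.sum_nonneg fun k _ => Finset.sum_nonneg fun j _ => (E.reward_mem _ _ _ _).1, ?_⟩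
  refine (Finset.sum_le_card_nsmul Finset.univ _ (M : ℝ) fun k _ => ?_).trans (by simp)
  exact (Finset.sum_le_card_nsmul Finset.univ _ 1 fun j _ => (E.reward_mem c ω j k).2).trans
    (by simp)

/-- The total reward that is recorded in one round. -/
def recordReward (x : RoundRecord X d K M) : ℝ := ∑ k, ∑ j, x.2.2 j k

theorem measurable_recordReward : Measurable (recordReward : RoundRecord X d K M → ℝ) := by
  unfold recordReward
  fun_prop

/-- Boundedness makes the supremum a genuine upper bound, so the regret integrand is nonnegative and
only the majorant `G` has to be integrable. -/
theorem regret_le (E : CreatorMarket d K M pay) (A : Algorithm X d K M) (T : ℕ)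
    (hbdd : BddAbove (Set.range E.utility)) (G : A.Seed × (ℕ → E.Noise) → ℝ)
    (hG : Integrable G (A.seedLaw.prod (Measure.infinitePi fun _ : ℕ => E.noise)))
    (hle : ∀ p, ∑ t ∈ Finset.range T, (E.optimum - E.utility (E.contract A p.1 p.2 t)) ≤ G p) :
    E.regret A T ≤ ∫ p, G p ∂(A.seedLaw.prod (Measure.infinitePi fun _ : ℕ => E.noise)) :=
  integral_mono_of_nonneg (Filter.Eventually.of_forall fun _ => Finset.sum_nonneg fun _ _ =>
    sub_nonneg.2 (le_ciSup hbdd _)) hG (Filter.Eventually.of_forall hle)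

end CreatorMarket

section ReturnBased

variable {d K M : ℕ}

theorem utility_returnPay (E : CreatorMarket d K M (returnPay d)) (α : Set.Icc (0 : ℝ) 1) :
    E.utility α = (1 - α) * ∑ k, E.totalReward (E.response k α) := by
  unfold CreatorMarket.utility
  rw [Finset.mul_sum]
  refine Finset.sum_congr rfl fun k _ => ?_
  rw [CreatorMarket.totalReward, ← integral_const_mul]
  refine integral_congr_ae (Filter.Eventually.of_forall fun r => ?_)
  simp only [returnPay]
  ring

/-- Exchange argument: adding the two optimality inequalities cancels the costs and leaves `(β - α)`
times the difference of rewards, which is nonnegative. -/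
theorem totalReward_response_mono (E : CreatorMarket d K M (returnPay d)) (k : Fin K)
    {α β : Set.Icc (0 : ℝ) 1} (h : α ≤ β) :
    E.totalReward (E.response k α) ≤ E.totalReward (E.response k β) := by
  rcases h.eq_or_lt with rfl | hlt
  · exact le_rfl
  have h1 := E.response_optimal k α (E.response k β)
  have h2 := E.response_optimal k β (E.response k α)
  simp only [returnPay, integral_const_mul] at h1 h2
  change (α : ℝ) * E.totalReward _ - _ ≤ α * E.totalReward _ - _ at h1
  change (β : ℝ) * E.totalReward _ - _ ≤ β * E.totalReward _ - _ at h2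
  have h3 : (0 : ℝ) < β - α := sub_pos.2 hlt
  by_contra! h4
  nlinarith

theorem utility_returnPay_mem (hK : 1 ≤ K) (E : CreatorMarket d K M (returnPay d))
    (α : Set.Icc (0 : ℝ) 1) : E.utility α ∈ Set.Icc (0 : ℝ) (K * M) := by
  rw [utility_returnPay]
  have h0 : 0 ≤ ∑ k, E.totalReward (E.response k α) :=
    Finset.sum_nonneg fun k _ => (E.totalReward_mem hK _).1
  have h1 : ∑ k, E.totalReward (E.response k α) ≤ K * M :=
    (Finset.sum_le_card_nsmul Finset.univ _ (M : ℝ) fun k _ => (E.totalReward_mem hK _).2).trans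
      (by simp)
  have h2 := α.2.1
  have h3 := α.2.2
  exact ⟨mul_nonneg (by linarith) h0, by nlinarith⟩

/-- One-sided continuity is all that holds, since best responses may jump. Raising `α` never lowers
the reward and increases the paid share by at most `ε` of a reward bounded by `K M`; hence the grid
rounds upwards. -/
theorem utility_le_of_le (hK : 1 ≤ K) (E : CreatorMarket d K M (returnPay d))
    {α β : Set.Icc (0 : ℝ) 1} (h : α ≤ β) {ε : ℝ} (hε : (β : ℝ) ≤ α + ε) :
    E.utility α ≤ E.utility β + K * M * ε := by
  rw [utility_returnPay, utility_returnPay]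
  have h0 : ∑ k, E.totalReward (E.response k α) ≤ ∑ k, E.totalReward (E.response k β) :=
    Finset.sum_le_sum fun k _ => totalReward_response_mono E k h
  have h1 : ∑ k, E.totalReward (E.response k α) ≤ K * M :=
    (Finset.sum_le_card_nsmul Finset.univ _ (M : ℝ) fun k _ => (E.totalReward_mem hK _).2).trans
      (by simp)
  have h2 : 0 ≤ ∑ k, E.totalReward (E.response k α) :=
    Finset.sum_nonneg fun k _ => (E.totalReward_mem hK _).1
  have h3 : (α : ℝ) ≤ β := h
  have h4 := β.2.2
  have h5 := mul_le_mul_of_nonneg_left h0 (sub_nonneg.2 h4)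
  nlinarith

/-- The contracts of the grid with mesh `1 / N`. -/
def gridContract (N : ℕ) (hN : 0 < N) (i : Fin (N + 1)) : Set.Icc (0 : ℝ) 1 :=
  ⟨(i : ℝ) / N, by positivity, by
    rw [div_le_one (by positivity)]
    exact_mod_cast Nat.lt_succ_iff.1 i.2⟩

/-- The index of the least grid contract above `α`. -/
def gridIndex (N : ℕ) (α : Set.Icc (0 : ℝ) 1) : Fin (N + 1) :=
  ⟨min ⌈(α : ℝ) * N⌉₊ N, Nat.lt_succ_iff.2 (min_le_right _ _)⟩

theorem measurable_gridIndex (N : ℕ) : Measurable (gridIndex N) := by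
  have h : Measurable fun α : Set.Icc (0 : ℝ) 1 => ⌈(α : ℝ) * N⌉₊ :=
    Nat.measurable_ceil.comp (by fun_prop)
  exact (measurable_from_top (f := fun n : ℕ =>
    (⟨min n N, Nat.lt_succ_iff.2 (min_le_right _ _)⟩ : Fin (N + 1)))).comp h

theorem gridIndex_gridContract (N : ℕ) (hN : 0 < N) (i : Fin (N + 1)) :
    gridIndex N (gridContract N hN i) = i := by
  ext
  have : (N : ℝ) ≠ 0 := by positivity
  simp only [gridIndex, gridContract]
  rw [div_mul_cancel₀ _ this, Nat.ceil_natCast]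
  exact min_eq_left (Nat.lt_succ_iff.1 i.2)

theorem gridContract_gridIndex (N : ℕ) (hN : 0 < N) (α : Set.Icc (0 : ℝ) 1) :
    α ≤ gridContract N hN (gridIndex N α) ∧
      (gridContract N hN (gridIndex N α) : ℝ) ≤ α + 1 / N := by
  have hN' : (0 : ℝ) < N := by exact_mod_cast hN
  have h0 : 0 ≤ (α : ℝ) * N := mul_nonneg α.2.1 hN'.le
  have h1 : ⌈(α : ℝ) * N⌉₊ ≤ N := Nat.ceil_le.2 (mul_le_of_le_one_left hN'.le α.2.2)
  have h2 : (gridContract N hN (gridIndex N α) : ℝ) = (⌈(α : ℝ) * N⌉₊ : ℝ) / N := by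
    simp only [gridContract, gridIndex, min_eq_left h1]
  refine ⟨?_, ?_⟩
  · rw [← Subtype.coe_le_coe, h2, le_div_iff₀ hN']
    exact Nat.le_ceil _
  · rw [h2, div_le_iff₀ hN', add_mul, one_div_mul_cancel hN'.ne']
    exact (Nat.ceil_lt_add_one h0).le

/-- The reward of the bandit that plays the grid contracts, read off from a record. -/
def gridReward (d K M : ℕ) (x : RoundRecord (Set.Icc (0 : ℝ) 1) d K M) : ℝ :=
  (1 - x.1) * CreatorMarket.recordReward x / (K * M)

theorem measurable_gridReward : Measurable (gridReward d K M) := by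
  have : Measurable (CreatorMarket.recordReward : RoundRecord (Set.Icc (0 : ℝ) 1) d K M → ℝ) :=
    CreatorMarket.measurable_recordReward
  unfold gridReward
  fun_prop

/-- A record sequence, extended to all rounds. -/
def extendRecords {R α : Type} {t : ℕ} (φ : R → α) (x : α) (h : Fin t → R) (r : ℕ) : α :=
  if hr : r < t then φ (h ⟨r, hr⟩) else x

theorem measurable_extendRecords {R α : Type} [MeasurableSpace R] [MeasurableSpace α] {t : ℕ}
    {φ : R → α} (hφ : Measurable φ) (x : α) (r : ℕ) :
    Measurable fun h : Fin t → R => extendRecords φ x h r := by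
  unfold extendRecords
  split_ifs
  · exact hφ.comp (measurable_pi_apply _)
  · exact measurable_const

/-- The optimistic index of a grid contract, as a function of the history. -/
def gridArmIndex (d K M h N t : ℕ) (i : Fin (N + 1))
    (H : Fin t → RoundRecord (Set.Icc (0 : ℝ) 1) d K M) : ℝ :=
  armIndex h (extendRecords (fun x => gridIndex N x.1) 0 H)
    (extendRecords (gridReward d K M) 0 H) i t

theorem measurable_gridArmIndex (h N t : ℕ) (i : Fin (N + 1)) :
    Measurable (gridArmIndex d K M h N t i) := by
  have h1 : Measurable fun x : RoundRecord (Set.Icc (0 : ℝ) 1) d K M => gridIndex N x.1 :=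
    (measurable_gridIndex N).comp measurable_fst
  exact measurable_armIndex (fun r _ => measurable_extendRecords h1 0 r)
    (fun r _ => measurable_extendRecords measurable_gridReward 0 r) h i

/-- The algorithm that plays the grid contract with the largest index. -/
def gridAlgorithm (d K M h N : ℕ) (hN : 0 < N) : Algorithm (Set.Icc (0 : ℝ) 1) d K M where
  Seed := Unit
  seedLaw := Measure.dirac ()
  act t _ H := gridContract N hN
    ((exists_measurable_argmax (gridArmIndex d K M h N t) (measurable_gridArmIndex h N t)).choose H)
  measurable_act t := by
    have := (exists_measurable_argmax (gridArmIndex d K M h N t)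
      (measurable_gridArmIndex h N t)).choose_spec.1
    exact ((measurable_of_countable (gridContract N hN)).comp this).comp measurable_snd

theorem regret_gridAlgorithm_le (hK : 1 ≤ K) (hM : 1 ≤ M) (E : CreatorMarket d K M (returnPay d))
    (h N : ℕ) (hN : 0 < N) (T : ℕ) :
    E.regret (gridAlgorithm d K M h N hN) T ≤ K * M *
      (T / N + (400 * (T / 4 ^ h) + 7000 * ((N + 1 : ℕ) * 4 ^ h))) := by
  set A := gridAlgorithm d K M h N hN with hA
  have hKM : (0 : ℝ) < K * M := by
    have : 0 < K * M := Nat.mul_pos hK hM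
    exact_mod_cast this
  let a : ℕ → A.Seed × (ℕ → E.Noise) → Fin (N + 1) := fun t p =>
    gridIndex N (E.contract A p.1 p.2 t)
  have ham : ∀ t, Measurable (a t) := fun t =>
    (measurable_gridIndex N).comp (E.measurable_contract A t)
  have hap : ∀ t, DependsOnPast t (a t) := fun t s ω ω' hω => by
    have := E.dependsOnPast_contract A t s ω ω' hω
    simp only [a] at this ⊢
    rw [this]
  let g : (t : ℕ) → (Fin t → RoundRecord (Set.Icc (0 : ℝ) 1) d K M) → Fin (N + 1) := fun t =>
    (exists_measurable_argmax (gridArmIndex d K M h N t) (measurable_gridArmIndex h N t)).choose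
  have hg : ∀ t H i, gridArmIndex d K M h N t i H ≤ gridArmIndex d K M h N t (g t H) H := fun t =>
    (exists_measurable_argmax (gridArmIndex d K M h N t)
      (measurable_gridArmIndex h N t)).choose_spec.2
  have hcon : ∀ t (p : A.Seed × (ℕ → E.Noise)), E.contract A p.1 p.2 t
      = gridContract N hN (g t (E.history A p.1 p.2 t)) := fun t p => rfl
  have hag : ∀ t p, a t p = g t (E.history A p.1 p.2 t) := fun t p => by
    simp only [a]
    rw [hcon, gridIndex_gridContract]
  have hcona : ∀ t (p : A.Seed × (ℕ → E.Noise)), E.contract A p.1 p.2 t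
      = gridContract N hN (a t p) := fun t p => by
    rw [hcon, hag]
  let X : Fin (N + 1) → E.Noise → ℝ := fun i ω =>
    gridReward d K M (E.observe (gridContract N hN i) ω)
  have hXm : ∀ i, Measurable (X i) := fun i =>
    measurable_gridReward.comp (E.measurable_observe.comp (measurable_const.prodMk measurable_id))
  have hXeq : ∀ i ω, X i ω = (1 - gridContract N hN i) / (K * M)
      * ∑ k, ∑ j, E.reward (fun k => E.response k (gridContract N hN i)) ω j k := fun i ω => by
    simp only [X, gridReward, CreatorMarket.recordReward, CreatorMarket.observe]
    ring
  have hX : ∀ i ω, X i ω ∈ Set.Icc (0 : ℝ) 1 := fun i ω => by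
    have h1 := E.sum_reward_mem (fun k => E.response k (gridContract N hN i)) ω
    have h2 := (gridContract N hN i).2
    rw [hXeq, div_mul_eq_mul_div]
    refine ⟨div_nonneg (mul_nonneg (by linarith [h2.2]) h1.1) hKM.le, ?_⟩
    rw [div_le_one hKM]
    nlinarith [h1.1, h1.2, h2.1, h2.2]
  have hmean : ∀ i, ∫ ω, X i ω ∂E.noise = E.utility (gridContract N hN i) / (K * M) := fun i => by
    simp_rw [hXeq]
    rw [integral_const_mul, E.integral_sum_reward, utility_returnPay]
    ring
  -- The index looks only at rounds before `t`, so the arbitrary values beyond the recorded history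
  -- are immaterial.
  have hidx : ∀ p t i, armIndex h (fun r => a r p) (fun r => X (a r p) (p.2 r)) i t
      = gridArmIndex d K M h N t i (E.history A p.1 p.2 t) := by
    intro p t i
    refine armIndex_congr (fun r hr => ?_) (fun r hr => ?_) h i
    · rw [extendRecords, dif_pos hr, E.history_apply]
      rfl
    · rw [extendRecords, dif_pos hr, E.history_apply]
      simp only [X]
      rw [hcona]
  have hmax : ∀ p t i, armIndex h (fun r => a r p) (fun r => X (a r p) (p.2 r)) i t
      ≤ armIndex h (fun r => a r p) (fun r => X (a r p) (p.2 r)) (a t p) t := by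
    intro p t i
    rw [hidx, hidx, hag]
    exact hg t _ i
  obtain ⟨i₀, -, hi₀⟩ := Finset.exists_max_image Finset.univ
    (fun i => E.utility (gridContract N hN i)) Finset.univ_nonempty
  have hopt : E.optimum ≤ E.utility (gridContract N hN i₀) + K * M * (1 / N) := by
    have : Nonempty (Set.Icc (0 : ℝ) 1) := ⟨gridContract N hN 0⟩
    refine ciSup_le fun α => ?_
    obtain ⟨h1, h2⟩ := gridContract_gridIndex N hN α
    exact (utility_le_of_le hK E h1 h2).trans
      (add_le_add_left (hi₀ (gridIndex N α) (Finset.mem_univ _)) _)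
  have hbandit := integral_bandit_regret_le A.seedLaw E.noise a ham hap X hXm hX h hmax i₀ T
  have hbdd : BddAbove (Set.range E.utility) :=
    ⟨K * M, by rintro _ ⟨α, rfl⟩; exact (utility_returnPay_mem hK E α).2⟩
  have hint : Integrable (fun p => ∑ t ∈ Finset.range T,
      ((∫ y, X i₀ y ∂E.noise) - ∫ y, X (a t p) y ∂E.noise))
      (A.seedLaw.prod (Measure.infinitePi fun _ : ℕ => E.noise)) := by
    refine integrable_finsetSum _ fun t _ => (integrable_const _).sub ?_
    have hm : Measurable fun p => ∫ y, X (a t p) y ∂E.noise :=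
      (measurable_of_countable fun i => ∫ y, X i y ∂E.noise).comp (ham t)
    refine integrable_of_abs_le hm (C := 1) fun p => ?_
    rw [hmean, abs_of_nonneg (div_nonneg (utility_returnPay_mem hK E _).1 hKM.le),
      div_le_one hKM]
    exact (utility_returnPay_mem hK E _).2
  refine (E.regret_le A T hbdd (fun p => K * M * (T / N + ∑ t ∈ Finset.range T,
      ((∫ y, X i₀ y ∂E.noise) - ∫ y, X (a t p) y ∂E.noise)))
      (((integrable_const _).add hint).const_mul _) fun p => ?_).trans ?_
  · have h1 : (T : ℝ) / N = ∑ _t ∈ Finset.range T, (1 : ℝ) / N := by simp; ring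
    rw [h1, ← Finset.sum_add_distrib, Finset.mul_sum]
    refine Finset.sum_le_sum fun t _ => ?_
    rw [hmean, hmean, hcona]
    have h2 : (K : ℝ) * M * (1 / N + (E.utility (gridContract N hN i₀) / (K * M)
        - E.utility (gridContract N hN (a t p)) / (K * M)))
        = E.utility (gridContract N hN i₀) + K * M * (1 / N)
          - E.utility (gridContract N hN (a t p)) := by
      field_simp
      ring
    rw [h2]
    linarith
  · rw [integral_const_mul, integral_add (integrable_const _) hint]
    simp only [integral_const, probReal_univ, smul_eq_mul, one_mul]
    rw [Fintype.card_fin] at hbandit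
    exact mul_le_mul_of_nonneg_left (by linarith) hKM.le

/-- The least power of `64` above `T` exceeds it by at most a factor `64`, and `64^(2/3) = 16`. -/
theorem exists_four_pow (T : ℕ) (hT : 1 ≤ T) :
    ∃ h : ℕ, (T : ℝ) ≤ 64 ^ h ∧ (16 : ℝ) ^ h ≤ 16 * (T : ℝ) ^ ((2 : ℝ) / 3) := by
  have hT' : (1 : ℝ) ≤ T := by exact_mod_cast hT
  refine ⟨Nat.clog 64 T, by exact_mod_cast Nat.le_pow_clog (by norm_num) T, ?_⟩
  have h1 : (64 : ℝ) ^ Nat.clog 64 T ≤ 64 * T := by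
    rcases Nat.lt_or_ge 1 T with h | h
    · have h2 := Nat.pow_pred_clog_lt_self (b := 64) (by norm_num) h
      have h3 : 0 < Nat.clog 64 T := Nat.clog_pos (by norm_num) h
      have h4 : 64 ^ Nat.clog 64 T = 64 * 64 ^ (Nat.clog 64 T).pred := by
        obtain ⟨n, hn⟩ := Nat.exists_eq_succ_of_ne_zero h3.ne'
        rw [hn, Nat.pred_succ, pow_succ']
      have h5 : 64 ^ Nat.clog 64 T ≤ 64 * T := by omega
      exact_mod_cast h5
    · have : T = 1 := le_antisymm h hT
      subst this
      simp
  have h6 := Real.rpow_le_rpow (by positivity) h1 (by norm_num : (0 : ℝ) ≤ 2 / 3)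
  rw [Real.mul_rpow (by norm_num) (by linarith)] at h6
  have e1 : (64 : ℝ) ^ ((2 : ℝ) / 3) = 16 := by
    rw [show (64 : ℝ) = 4 ^ (3 : ℝ) by norm_num, ← Real.rpow_mul (by norm_num)]
    norm_num
  have e2 : ((64 : ℝ) ^ Nat.clog 64 T) ^ ((2 : ℝ) / 3) = 16 ^ Nat.clog 64 T := by
    rw [← Real.rpow_natCast, ← Real.rpow_mul (by norm_num), mul_comm, Real.rpow_mul (by norm_num),
      e1, Real.rpow_natCast]
  rwa [e1, e2] at h6

/-- With mesh `4^(-h)`, about `T^(-1/3)`, both the discretisation loss `T / 4^h` and the term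
(number of arms) times `4^h` are of order `16^h`, about `T^(2/3)`. -/
theorem exists_algorithm_returnPay (hK : 1 ≤ K) (hM : 1 ≤ M) (d T : ℕ) (hT : 1 ≤ T) :
    ∃ A : Algorithm (Set.Icc (0 : ℝ) 1) d K M, ∀ E : CreatorMarket d K M (returnPay d),
      E.regret A T ≤ (K * M * 240000) * (T : ℝ) ^ ((2 : ℝ) / 3) := by
  obtain ⟨h, h1, h2⟩ := exists_four_pow T hT
  refine ⟨gridAlgorithm d K M h (4 ^ h) (by positivity), fun E =>
    (regret_gridAlgorithm_le hK hM E h (4 ^ h) (by positivity) T).trans ?_⟩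
  rw [mul_assoc ((K : ℝ) * M)]
  refine mul_le_mul_of_nonneg_left ?_ (by positivity)
  have h3 : (T : ℝ) / 4 ^ h ≤ 16 ^ h := by
    rw [div_le_iff₀ (by positivity), ← mul_pow]
    norm_num
    exact h1
  have h4 : ((4 : ℝ) ^ h + 1) * 4 ^ h ≤ 2 * 16 ^ h := by
    have h5 : (1 : ℝ) ≤ 4 ^ h := one_le_pow₀ (by norm_num)
    rw [show (16 : ℝ) ^ h = 4 ^ h * 4 ^ h by rw [← mul_pow]; norm_num]
    nlinarith
  push_cast
  have h6 : (0 : ℝ) ≤ (T : ℝ) ^ ((2 : ℝ) / 3) := by positivity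
  linarith

end ReturnBased
end

/-! ### A measurable approximate spanner. -/

noncomputable section

section Spanner

variable {d N : ℕ}

/-- The available feature vectors, extended by small multiples of the unit vectors. -/
def extendedFeature (ε : ℝ) (c : Fin N → Vec d) : Fin N ⊕ Fin d → Fin d → ℝ
  | Sum.inl i => fun a => c i a
  | Sum.inr b => Pi.single b ε

/-- The matrix whose columns are the extended features selected by `B`. -/
def featureMatrix (ε : ℝ) (c : Fin N → Vec d) (B : Fin d → Fin N ⊕ Fin d) :
    Matrix (Fin d) (Fin d) ℝ :=
  Matrix.of fun a b => extendedFeature ε c (B b) a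

theorem featureMatrix_updateCol (ε : ℝ) (c : Fin N → Vec d) (B : Fin d → Fin N ⊕ Fin d)
    (b : Fin d) (j : Fin N ⊕ Fin d) :
    (featureMatrix ε c B).updateCol b (extendedFeature ε c j)
      = featureMatrix ε c (Function.update B b j) := by
  ext a b'
  rw [Matrix.updateCol_apply]
  by_cases h : b' = b
  · subst h; simp [featureMatrix]
  · simp [featureMatrix, h]

theorem measurable_det_featureMatrix (ε : ℝ) (B : Fin d → Fin N ⊕ Fin d) :
    Measurable fun c : Fin N → Vec d => (featureMatrix ε c B).det := by
  simp only [Matrix.det_apply]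
  refine Finset.measurable_sum _ fun σ _ => Measurable.const_smul ?_ _
  refine Finset.measurable_prod _ fun i _ => ?_
  simp only [featureMatrix, Matrix.of_apply]
  cases B i with
  | inl j =>
    simp only [extendedFeature]
    fun_prop
  | inr b => exact measurable_const

theorem det_featureMatrix_inr (ε : ℝ) (c : Fin N → Vec d) :
    (featureMatrix ε c Sum.inr).det = ε ^ d := by
  have : featureMatrix ε c Sum.inr = Matrix.diagonal fun _ => ε := by
    ext a b
    by_cases h : a = b
    · subst h; simp [featureMatrix, extendedFeature]
    · simp [featureMatrix, extendedFeature, h]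
  rw [this, Matrix.det_diagonal]
  simp

theorem measurable_comp_of_countable {Ω ι β : Type} [MeasurableSpace Ω] [MeasurableSpace ι]
    [MeasurableSpace β] [Countable ι] [MeasurableSingletonClass ι] {g : Ω → ι} (hg : Measurable g)
    {F : ι → Ω → β} (hF : ∀ i, Measurable (F i)) : Measurable fun ω => F (g ω) ω :=
  (measurable_from_prod_countable_right (f := fun p : ι × Ω => F p.1 p.2) hF).comp
    (hg.prodMk measurable_id)

/-- Every finite family of vectors contains `d` members from which all of the family is obtained,
up to a small error, by coefficients of absolute value at most one; both can be chosen
measurably. -/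
theorem exists_measurable_spanner (hN : 0 < N) {ε : ℝ} (hε : 0 < ε) :
    ∃ (arm : (Fin N → Vec d) → Fin d → Fin N) (coef : (Fin N → Vec d) → Fin N → Fin d → ℝ),
      (∀ b, Measurable fun c => arm c b) ∧ (∀ i b, Measurable fun c => coef c i b) ∧
      (∀ c i b, |coef c i b| ≤ 1) ∧
      ∀ c i, ∀ v ∈ unitBall d,
        |inner ℝ v (c i) - ∑ b, coef c i b * inner ℝ v (c (arm c b))| ≤ d * ε := by
  let e := (Fintype.equivFin (Fin d → Fin N ⊕ Fin d)).symm
  have : Nonempty (Fin (Fintype.card (Fin d → Fin N ⊕ Fin d))) := ⟨e.symm Sum.inr⟩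
  -- Choose `d` columns of maximal `|det|`. By Cramer's rule the coordinates of any other vector are
  -- ratios of determinants after exchanging one column, hence at most one in absolute value.
  obtain ⟨g, hg, hmax⟩ := exists_measurable_argmax
    (fun k c => |(featureMatrix ε c (e k)).det|)
    (fun k => (measurable_det_featureMatrix ε (e k)).abs)
  have hmax' : ∀ c B, |(featureMatrix ε c B).det| ≤ |(featureMatrix ε c (e (g c))).det| := by
    intro c B
    have := hmax c (e.symm B)
    simpa using this
  -- The artificial columns `ε e_b` have determinant `ε^d`, so the maximum is positive even if the
  -- given vectors do not span.
  have hdet : ∀ c, 0 < |(featureMatrix ε c (e (g c))).det| := by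
    intro c
    refine lt_of_lt_of_le ?_ (hmax' c Sum.inr)
    rw [det_featureMatrix_inr]
    positivity
  let raw : (Fin N → Vec d) → Fin N → Fin d → ℝ := fun c i b =>
    (featureMatrix ε c (Function.update (e (g c)) b (Sum.inl i))).det
      / (featureMatrix ε c (e (g c))).det
  have hraw : ∀ c i b, |raw c i b| ≤ 1 := fun c i b => by
    simp only [raw]
    rw [abs_div, div_le_one (hdet c)]
    exact hmax' c _
  refine ⟨fun c b => Sum.elim id (fun _ => ⟨0, hN⟩) (e (g c) b),
    fun c i b => Sum.elim (fun _ => raw c i b) (fun _ => 0) (e (g c) b), fun b => ?_,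
    fun i b => ?_, fun c i b => ?_, fun c i v hv => ?_⟩
  · exact (measurable_of_countable fun k => Sum.elim id (fun _ => (⟨0, hN⟩ : Fin N))
      (e k b)).comp hg
  · refine measurable_comp_of_countable hg (F := fun k c => Sum.elim (fun _ =>
      (featureMatrix ε c (Function.update (e k) b (Sum.inl i))).det
      / (featureMatrix ε c (e k)).det) (fun _ => (0 : ℝ)) (e k b)) fun k => ?_
    cases e k b with
    | inl j =>
      exact (measurable_det_featureMatrix ε _).div (measurable_det_featureMatrix ε _)
    | inr a => exact measurable_const
  · beta_reduce
    cases e (g c) b with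
    | inl j => exact hraw c i b
    | inr a => simp
  · have hd0 : (featureMatrix ε c (e (g c))).det ≠ 0 := abs_pos.1 (hdet c)
    have hspan : ∀ a, c i a = ∑ b, raw c i b * extendedFeature ε c (e (g c) b) a := by
      intro a
      have h1 := congr_fun (Matrix.mulVec_cramer (featureMatrix ε c (e (g c)))
        (extendedFeature ε c (Sum.inl i))) a
      rw [Matrix.mulVec, dotProduct] at h1
      simp only [Matrix.cramer_apply, featureMatrix_updateCol, Pi.smul_apply, smul_eq_mul] at h1
      rw [← mul_right_inj' hd0]
      refine h1.symm.trans ?_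
      rw [Finset.mul_sum]
      refine Finset.sum_congr rfl fun b _ => ?_
      simp only [raw]
      field_simp
      exact mul_comm _ _
    have hinner : ∀ x : Vec d, inner ℝ v x = ∑ a, v a * x a := fun x => by
      rw [PiLp.inner_apply]
      simp [mul_comm]
    have e1 : inner ℝ v (c i)
        = ∑ b, raw c i b * ∑ a, v a * extendedFeature ε c (e (g c) b) a := by
      rw [hinner]
      simp_rw [hspan, Finset.mul_sum]
      rw [Finset.sum_comm]
      exact Finset.sum_congr rfl fun b _ => Finset.sum_congr rfl fun a _ => by ring
    rw [e1, ← Finset.sum_sub_distrib]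
    refine (Finset.abs_sum_le_sum_abs _ _).trans
      ((Finset.sum_le_card_nsmul _ _ ε fun b _ => ?_).trans (by simp))
    have hr := hraw c i b
    rcases hb : e (g c) b with j | a
    · simp only [hb, Sum.elim_inl, id, extendedFeature]
      rw [hinner, sub_self, abs_zero]
      exact hε.le
    · simp only [hb, Sum.elim_inr, zero_mul, sub_zero, extendedFeature, Pi.single_apply, mul_ite,
        mul_zero, Finset.sum_ite_eq', Finset.mem_univ, if_true]
      have h1 := coord_mem_of_mem_unitBall hv a
      rw [abs_mul, abs_of_nonneg (mul_nonneg h1.1 hε.le)]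
      calc |raw c i b| * (v a * ε) ≤ 1 * (1 * ε) :=
            mul_le_mul hr (mul_le_mul_of_nonneg_right h1.2 hε.le)
              (mul_nonneg h1.1 hε.le) zero_le_one
        _ = ε := by ring

end Spanner

/-! ### Linear contracts: utility and discretisation. -/

section LinearContracts

variable {d K M : ℕ}

theorem inner_vec (x y : Vec d) : inner ℝ x y = ∑ a, x a * y a := by
  rw [PiLp.inner_apply]
  simp [mul_comm]

theorem inner_mem_of_mem_unitBall {x y : Vec d} (hx : x ∈ unitBall d) (hy : y ∈ unitBall d) :
    inner ℝ x y ∈ Set.Icc (0 : ℝ) 1 := by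
  constructor
  · rw [inner_vec]
    exact Finset.sum_nonneg fun a _ => mul_nonneg (hx.2 a) (hy.2 a)
  · exact (real_inner_le_norm x y).trans (mul_le_one₀ hx.1 (norm_nonneg _) hy.1)

theorem abs_inner_le_card_mul {x y : Vec d} {η : ℝ} (hη : 0 ≤ η) (hx : ∀ a, |x a| ≤ η)
    (hy : ∀ a, |y a| ≤ 1) : |inner ℝ x y| ≤ d * η := by
  rw [inner_vec]
  refine (Finset.abs_sum_le_sum_abs _ _).trans
    ((Finset.sum_le_card_nsmul _ _ η fun a _ => ?_).trans (by simp))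
  rw [abs_mul]
  calc |x a| * |y a| ≤ η * 1 := mul_le_mul (hx a) (hy a) (abs_nonneg _) hη
    _ = η := mul_one η

theorem zero_mem_unitBall : (0 : Vec d) ∈ unitBall d := by
  refine ⟨by simp, fun i => by simp⟩

theorem convex_unitBall : Convex ℝ (unitBall d) := by
  have h : unitBall d = Metric.closedBall 0 1 ∩ {x : Vec d | ∀ i, 0 ≤ x i} := by
    ext x; simp [unitBall]
  rw [h]
  refine (convex_closedBall _ _).inter fun x hx y hy a b ha hb _ i => ?_
  exact add_nonneg (mul_nonneg ha (hx i)) (mul_nonneg hb (hy i))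

theorem mem_unitBall_of_le {x y : Vec d} (hy : y ∈ unitBall d) (hx : ∀ i, 0 ≤ x i)
    (hxy : ∀ i, x i ≤ y i) : x ∈ unitBall d := by
  refine ⟨le_trans ?_ hy.1, hx⟩
  rw [EuclideanSpace.norm_eq, EuclideanSpace.norm_eq]
  refine Real.sqrt_le_sqrt (Finset.sum_le_sum fun i _ => ?_)
  rw [Real.norm_eq_abs, Real.norm_eq_abs, abs_of_nonneg (hx i), abs_of_nonneg (hy.2 i)]
  exact pow_le_pow_left₀ (hx i) (hxy i) 2

/-- The point of the unit ball with coordinates `g i / m`, if it lies there. -/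
def gridVector (d m : ℕ) (g : Fin d → Fin (m + 1)) : unitBall d :=
  haveI := Classical.propDecidable
  if h : (WithLp.toLp 2 fun i => (g i : ℝ) / m : Vec d) ∈ unitBall d then ⟨_, h⟩
  else ⟨0, zero_mem_unitBall⟩

/-- Coordinates are rounded down, which keeps the point in `unitBall d`, so the default value of
`gridVector` is not met. -/
theorem exists_gridVector_close {m : ℕ} (hm : 0 < m) {x : Vec d} (hx : x ∈ unitBall d) :
    ∃ g, ∀ i, |(gridVector d m g : Vec d) i - x i| ≤ 1 / m := by
  have hm' : (0 : ℝ) < m := by exact_mod_cast hm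
  have hle : ∀ i, ⌊x i * m⌋₊ ≤ m := fun i => by
    have h1 := coord_mem_of_mem_unitBall hx i
    refine Nat.floor_le_of_le ?_
    exact mul_le_of_le_one_left hm'.le h1.2
  let g : Fin d → Fin (m + 1) := fun i => ⟨⌊x i * m⌋₊, Nat.lt_succ_iff.2 (hle i)⟩
  have hfl : ∀ i, (⌊x i * m⌋₊ : ℝ) / m ≤ x i := fun i => by
    rw [div_le_iff₀ hm']
    exact Nat.floor_le (mul_nonneg (hx.2 i) hm'.le)
  have hmem : (WithLp.toLp 2 fun i => (g i : ℝ) / m : Vec d) ∈ unitBall d :=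
    mem_unitBall_of_le hx (fun i => by
      change 0 ≤ ((⌊x i * m⌋₊ : ℕ) : ℝ) / m
      positivity) hfl
  refine ⟨g, fun i => ?_⟩
  have e : (gridVector d m g : Vec d) i = (⌊x i * m⌋₊ : ℝ) / m := by
    rw [gridVector, dif_pos hmem]
  rw [e, abs_le]
  constructor
  · have := Nat.lt_floor_add_one (x i * m)
    have h2 : x i ≤ (⌊x i * m⌋₊ : ℝ) / m + 1 / m := by
      rw [← add_div, le_div_iff₀ hm']
      exact this.le
    linarith
  · have : 0 ≤ 1 / (m : ℝ) := by positivity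
    linarith [hfl i]

theorem totalReward_eq_inner {pay : unitBall d → Vec d → ℝ → ℝ} (hK : 1 ≤ K)
    (E : CreatorMarket d K M pay) (u : Fin M → Vec d)
    (hu : ∀ j c, E.meanReward j c = inner ℝ (u j) (c : Vec d)) (c : E.C) :
    E.totalReward c = inner ℝ (∑ j, u j) (c : Vec d) := by
  have h := E.totalReward_eq (fun _ => c) ⟨0, hK⟩
  rw [h, integral_finsetSum _ fun j _ => E.integrable_reward (fun _ => c) j ⟨0, hK⟩, sum_inner]
  refine Finset.sum_congr rfl fun j _ => ?_
  rw [← hu, CreatorMarket.meanReward]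
  exact (E.integral_rewardLaw (fun _ => c) ⟨0, hK⟩ (φ := fun r => r j) (by fun_prop)).symm

theorem integral_payoff_linearPay (hK : 1 ≤ K) (E : CreatorMarket d K M (linearPay d))
    {v : Vec d} (hv : ∀ c : E.C, E.totalReward c = inner ℝ v (c : Vec d))
    (θ : unitBall d) (c : E.C) :
    ∫ r, ((∑ j, r j) - linearPay d θ (c : Vec d) (∑ j, r j)) ∂(E.rewardLaw c)
      = inner ℝ (v - θ) (c : Vec d) := by
  have := E.isProbabilityMeasure_rewardLaw hK c
  have hi : Integrable (fun r : Fin M → ℝ => ∑ j, r j) (E.rewardLaw c) := by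
    rw [← E.map_reward (fun _ => c) ⟨0, hK⟩]
    refine (integrable_map_measure (by fun_prop)
      (E.measurable_reward_apply _ _).aemeasurable).2 ?_
    exact integrable_finsetSum _ fun j _ => E.integrable_reward (fun _ => c) j ⟨0, hK⟩
  simp only [linearPay]
  rw [integral_sub hi (integrable_const _), inner_sub_left, ← hv]
  simp [CreatorMarket.totalReward]

theorem utility_linearPay (hK : 1 ≤ K) (E : CreatorMarket d K M (linearPay d))
    {v : Vec d} (hv : ∀ c : E.C, E.totalReward c = inner ℝ v (c : Vec d))
    (θ : unitBall d) : E.utility θ = ∑ k, inner ℝ (v - θ) (E.response k θ : Vec d) :=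
  Finset.sum_congr rfl fun _ _ => integral_payoff_linearPay hK E hv θ _

/-- Adding the two optimality conditions cancels the costs: the response is a monotone map. -/
theorem inner_response_mono (hK : 1 ≤ K) (E : CreatorMarket d K M (linearPay d))
    (θ θ' : unitBall d) (k : Fin K) :
    0 ≤ inner ℝ ((θ' : Vec d) - θ) ((E.response k θ' : Vec d) - E.response k θ) := by
  have h1 := E.response_optimal k θ (E.response k θ')
  have h2 := E.response_optimal k θ' (E.response k θ)
  have hp := fun c => E.isProbabilityMeasure_rewardLaw hK c
  simp only [linearPay, integral_const, probReal_univ, smul_eq_mul, one_mul] at h1 h2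
  simp only [inner_sub_left, inner_sub_right]
  linarith

theorem abs_utility_linearPay_le (hK : 1 ≤ K) (E : CreatorMarket d K M (linearPay d))
    {v : Vec d} (hvB : v ∈ unitBall d)
    (hv : ∀ c : E.C, E.totalReward c = inner ℝ v (c : Vec d)) (θ : unitBall d) :
    |E.utility θ| ≤ K := by
  rw [utility_linearPay hK E hv]
  refine (Finset.abs_sum_le_sum_abs _ _).trans
    ((Finset.sum_le_card_nsmul _ _ 1 fun k _ => ?_).trans (by simp))
  have h1 := inner_mem_of_mem_unitBall hvB (E.C_subset (E.response k θ).2)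
  have h2 := inner_mem_of_mem_unitBall θ.2 (E.C_subset (E.response k θ).2)
  rw [inner_sub_left, abs_le]
  constructor <;> linarith [h1.1, h1.2, h2.1, h2.2]

/-- Move from `θ` by `δ = 1/r` towards `v` and round, `θ' = (1-δ)θ + δv + e`. Monotonicity gives `δ
⟨v - θ, c' - c⟩ ≥ -⟨e, c' - c⟩`, so the new content satisfies `⟨v - θ, c'⟩ ≥ ⟨v - θ, c⟩ - dδ`. The
rounding error is divided by `δ`, whence the mesh `1/r²`. Convexity and `v ∈ unitBall d` keep the
target inside the family. -/
theorem exists_gridVector_utility (hK : 1 ≤ K) (E : CreatorMarket d K M (linearPay d))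
    {v : Vec d} (hvB : v ∈ unitBall d)
    (hv : ∀ c : E.C, E.totalReward c = inner ℝ v (c : Vec d)) {r : ℕ} (hr : 1 ≤ r)
    (θ : unitBall d) :
    ∃ g, E.utility θ ≤ E.utility (gridVector d (r ^ 2) g) + K * ((1 + 2 * d) / r) := by
  have hr' : (1 : ℝ) ≤ r := by exact_mod_cast hr
  set δ : ℝ := 1 / r with hδ
  have hδ0 : 0 < δ := by positivity
  have hδ1 : δ ≤ 1 := by rw [hδ, div_le_one (by linarith)]; exact hr'
  have hmem : (1 - δ) • (θ : Vec d) + δ • v ∈ unitBall d :=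
    convex_unitBall θ.2 hvB (by linarith) hδ0.le (by ring)
  obtain ⟨g, hg⟩ := exists_gridVector_close (m := r ^ 2) (by positivity) hmem
  refine ⟨g, ?_⟩
  rw [utility_linearPay hK E hv, utility_linearPay hK E hv]
  have hk : ∀ k, inner ℝ (v - θ) (E.response k θ : Vec d)
      ≤ inner ℝ (v - gridVector d (r ^ 2) g) (E.response k (gridVector d (r ^ 2) g) : Vec d)
        + (1 + 2 * d) / r := by
    intro k
    set θ' := gridVector d (r ^ 2) g with hθ'
    set c : Vec d := (E.response k θ : Vec d) with hc
    set c' : Vec d := (E.response k θ' : Vec d) with hc'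
    have hcB : c ∈ unitBall d := E.C_subset (E.response k θ).2
    have hcB' : c' ∈ unitBall d := E.C_subset (E.response k θ').2
    set e : Vec d := (θ' : Vec d) - ((1 - δ) • (θ : Vec d) + δ • v) with he
    have hθe : (θ' : Vec d) = (1 - δ) • (θ : Vec d) + δ • v + e := by rw [he]; abel
    have hδ2 : (1 : ℝ) / (r ^ 2 : ℕ) = δ ^ 2 := by rw [hδ]; push_cast; rw [div_pow, one_pow]
    have he1 : ∀ a, |e a| ≤ δ ^ 2 := fun a => by
      have := hg a
      rw [hδ2] at this
      exact this
    have h1 : |inner ℝ e (c' - c)| ≤ d * δ ^ 2 := by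
      refine abs_inner_le_card_mul (by positivity) he1 fun a => ?_
      have h2 := coord_mem_of_mem_unitBall hcB a
      have h3 := coord_mem_of_mem_unitBall hcB' a
      rw [PiLp.sub_apply, abs_le]
      constructor <;> linarith [h2.1, h2.2, h3.1, h3.2]
    have h2 : |inner ℝ e c'| ≤ d * δ ^ 2 := by
      refine abs_inner_le_card_mul (by positivity) he1 fun a => ?_
      have h3 := coord_mem_of_mem_unitBall hcB' a
      rw [abs_le]
      constructor <;> linarith [h3.1, h3.2]
    have h3 : 0 ≤ inner ℝ ((θ' : Vec d) - θ) (c' - c) := inner_response_mono hK E θ θ' k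
    have h4 : (θ' : Vec d) - θ = δ • (v - θ) + e := by
      rw [hθe]; simp only [sub_smul, smul_sub, one_smul]; abel
    have h5 : v - (θ' : Vec d) = (1 - δ) • (v - θ) - e := by
      rw [hθe]; simp only [sub_smul, smul_sub, one_smul]; abel
    rw [h4, inner_add_left, real_inner_smul_left] at h3
    rw [h5, inner_sub_left (𝕜 := ℝ) _ e, real_inner_smul_left]
    have h6 : -(d * δ) ≤ inner ℝ (v - (θ : Vec d)) (c' - c) := by
      have h7 := (abs_le.1 h1).2
      have h8 : δ * -(d * δ) ≤ δ * inner ℝ (v - (θ : Vec d)) (c' - c) := by nlinarith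
      exact le_of_mul_le_mul_left h8 hδ0
    rw [inner_sub_right] at h6
    have h9 : inner ℝ (v - (θ : Vec d)) c ≤ 1 := by
      rw [inner_sub_left]
      linarith [(inner_mem_of_mem_unitBall hvB hcB).2, (inner_mem_of_mem_unitBall θ.2 hcB).1]
    have h10 := (abs_le.1 h2).2
    have h11 : (1 + 2 * (d : ℝ)) / r = δ + 2 * (d * δ) := by rw [hδ]; ring
    rw [h11]
    have hd0 : (0 : ℝ) ≤ d := Nat.cast_nonneg d
    have h12 : (d : ℝ) * δ ^ 2 ≤ d * δ := mul_le_mul_of_nonneg_left (by nlinarith) hd0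
    have h13 := mul_le_mul_of_nonneg_left h6 (sub_nonneg.2 hδ1)
    have h14 : δ * inner ℝ (v - (θ : Vec d)) c ≤ δ * 1 := mul_le_mul_of_nonneg_left h9 hδ0.le
    nlinarith [mul_nonneg hd0 hδ0.le]
  refine (Finset.sum_le_sum fun k _ => hk k).trans (le_of_eq ?_)
  rw [Finset.sum_add_distrib]
  simp

end LinearContracts
end

/-! ### Explore every contract, estimate a spanner, commit. -/

noncomputable section

/-- The increments before round `m` are switched off together with their indicator, so only `n`
rounds count in the deviation bound. -/
theorem integral_abs_sum_window_le {S Y : Type} [MeasurableSpace S] [MeasurableSpace Y]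
    (σ : Measure S) [IsProbabilityMeasure σ] (ν : Measure Y) [IsProbabilityMeasure ν]
    {f : Y → ℝ} (hf : Measurable f) {D : ℝ} (hD : 0 < D) (hfD : ∀ y, |f y| ≤ D)
    (hf0 : ∫ y, f y ∂ν = 0) (m : ℕ) {n : ℕ} (hn : 0 < n) :
    ∫ p, |∑ s ∈ Finset.range n, f (p.2 (m + s))|
      ∂(σ.prod (Measure.infinitePi fun _ : ℕ => ν)) ≤ 4 * (D * √n) := by
  have h := integral_abs_sum_le σ ν
    (fun t x => if t < m then 0 else f x.2) (fun t _ => if t < m then 0 else 1) hD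
    (fun t => by split_ifs <;> fun_prop) (fun t => measurable_const)
    (fun t y s ω ω' _ => rfl) (fun t s ω ω' _ => rfl)
    (fun t p => by split_ifs <;> simp)
    (fun t p y => by
      split_ifs
      · simp
      · simpa using hfD y)
    (fun t p => by
      dsimp only
      split_ifs
      · simp
      · exact hf0)
    (m + n) (n := n) (by exact_mod_cast hn)
    (fun p => by
      rw [Finset.sum_range_add, Finset.sum_eq_zero fun t ht => if_pos (Finset.mem_range.1 ht)]
      simp)
  refine (le_of_eq (integral_congr_ae (Filter.Eventually.of_forall fun p => ?_))).trans h
  dsimp only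
  rw [Finset.sum_range_add, Finset.sum_eq_zero fun t ht => if_pos (Finset.mem_range.1 ht)]
  simp

section ExploreThenCommit

variable {d K M N : ℕ}

/-- The sum of the contents that are recorded in one round. -/
def recordContent {X : Type} (x : RoundRecord X d K M) : Vec d := ∑ k, x.2.1 k

theorem measurable_recordContent {X : Type} [MeasurableSpace X] :
    Measurable (recordContent : RoundRecord X d K M → Vec d) := by
  unfold recordContent
  fun_prop

/-- The recorded contents of the first `N` rounds. -/
def recordedContents (N : ℕ) {X : Type} {t : ℕ} (H : Fin t → RoundRecord X d K M) :
    Fin N → Vec d := fun i => extendRecords recordContent 0 H i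

/-- The average recorded rewards of the `d` windows of length `n` that follow the first `N`
rounds. -/
def windowAverages (N n : ℕ) {X : Type} {t : ℕ} (H : Fin t → RoundRecord X d K M) :
    Fin d → ℝ := fun b =>
  (∑ s ∈ Finset.range n, extendRecords CreatorMarket.recordReward 0 H (N + b * n + s)) / n

theorem measurable_recordedContents {X : Type} [MeasurableSpace X] (N t : ℕ) :
    Measurable fun H : Fin t → RoundRecord X d K M => recordedContents N H :=
  measurable_pi_iff.2 fun i => measurable_extendRecords measurable_recordContent 0 i

theorem measurable_windowAverages {X : Type} [MeasurableSpace X] (N n t : ℕ) :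
    Measurable fun H : Fin t → RoundRecord X d K M => windowAverages N n H :=
  measurable_pi_iff.2 fun _ => (Finset.measurable_sum _ fun _ _ =>
    measurable_extendRecords CreatorMarket.measurable_recordReward 0 _).div_const _

/-- The contract index played in round `t`: every index once, then each selected arm for `n`
rounds, and then the index selected from the records. -/
def exploreIndex (hN : 0 < N) (n : ℕ) (arm : (Fin N → Vec d) → Fin d → Fin N)
    (sel : (Fin N → Vec d) × (Fin d → ℝ) → Fin N) {X : Type} (t : ℕ)
    (H : Fin t → RoundRecord X d K M) : Fin N :=
  if h : t < N then ⟨t, h⟩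
  else if t < N + d * n then
    if h' : (t - N) / n < d then arm (recordedContents N H) ⟨(t - N) / n, h'⟩ else ⟨0, hN⟩
  else sel (recordedContents N H, windowAverages N n H)

theorem measurable_exploreIndex (hN : 0 < N) (n : ℕ)
    {arm : (Fin N → Vec d) → Fin d → Fin N} (harm : ∀ b, Measurable fun c => arm c b)
    {sel : (Fin N → Vec d) × (Fin d → ℝ) → Fin N} (hsel : Measurable sel)
    {X : Type} [MeasurableSpace X] (t : ℕ) :
    Measurable (exploreIndex (K := K) (M := M) hN n arm sel (X := X) t) := by
  unfold exploreIndex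
  split_ifs
  · exact measurable_const
  · exact (harm _).comp (measurable_recordedContents N t)
  · exact measurable_const
  · exact hsel.comp ((measurable_recordedContents N t).prodMk (measurable_windowAverages N n t))

/-- The algorithm that plays the contracts `θ i` with the indices `exploreIndex`. -/
def exploreAlgorithm (K M : ℕ) {X : Type} [MeasurableSpace X] (θ : Fin N → X) (hN : 0 < N) (n : ℕ)
    {arm : (Fin N → Vec d) → Fin d → Fin N} (harm : ∀ b, Measurable fun c => arm c b)
    {sel : (Fin N → Vec d) × (Fin d → ℝ) → Fin N} (hsel : Measurable sel) :
    Algorithm X d K M where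
  Seed := Unit
  seedLaw := Measure.dirac ()
  act t _ H := θ (exploreIndex hN n arm sel t H)
  measurable_act t := ((measurable_of_countable θ).comp
    (measurable_exploreIndex hN n harm hsel t)).comp measurable_snd

section History

variable {X : Type} [MeasurableSpace X] {pay : X → Vec d → ℝ → ℝ} (E : CreatorMarket d K M pay)
  (θ : Fin N → X) (hN : 0 < N) {n : ℕ}
  {arm : (Fin N → Vec d) → Fin d → Fin N} (harm : ∀ b, Measurable fun c => arm c b)
  {sel : (Fin N → Vec d) × (Fin d → ℝ) → Fin N} (hsel : Measurable sel)

/-- The sum of the contents created under the contract `θ i`. -/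
def totalContent (i : Fin N) : Vec d := ∑ k, (E.response k (θ i) : Vec d)

/-- Contents carry no noise, so after one play of every contract the features, and with them the
spanning arms, are deterministic. -/
theorem recordedContents_history (s : (exploreAlgorithm K M θ hN n harm hsel).Seed)
    (ω : ℕ → E.Noise) {t : ℕ} (ht : N ≤ t) :
    recordedContents N (E.history (exploreAlgorithm K M θ hN n harm hsel) s ω t)
      = totalContent E θ := by
  funext i
  have hi := i.2
  have h : E.contract (exploreAlgorithm K M θ hN n harm hsel) s ω i = θ i :=
    congrArg θ (dif_pos hi)
  rw [recordedContents, extendRecords, dif_pos (hi.trans_le ht), E.history_apply, h]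
  rfl

theorem contract_window (s : (exploreAlgorithm K M θ hN n harm hsel).Seed)
    (ω : ℕ → E.Noise) (b : Fin d) {r : ℕ} (hr : r < n) :
    E.contract (exploreAlgorithm K M θ hN n harm hsel) s ω (N + b * n + r)
      = θ (arm (totalContent E θ) b) := by
  have h1 : (N + b * n + r - N) / n = b := by
    rw [show N + b * n + r - N = r + n * b by rw [mul_comm n]; omega,
      Nat.add_mul_div_left _ _ (by omega), Nat.div_eq_of_lt hr, zero_add]
  have h2 : N + b * n + r < N + d * n := by
    have : (b + 1) * n ≤ d * n := Nat.mul_le_mul_right n b.2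
    nlinarith
  have h : exploreIndex hN n arm sel (N + b * n + r)
      (E.history (exploreAlgorithm K M θ hN n harm hsel) s ω (N + b * n + r))
        = arm (totalContent E θ) b := by
    rw [exploreIndex, dif_neg (by omega), if_pos h2, dif_pos (by rw [h1]; exact b.2),
      recordedContents_history E θ hN harm hsel s ω (by omega)]
    congr 1
    exact Fin.ext h1
  exact congrArg θ h

/-- The total reward of one round under the contract that is explored in the window `b`. -/
def windowReward (b : Fin d) (ω : E.Noise) : ℝ :=
  ∑ k, ∑ j, E.reward (fun k => E.response k (θ (arm (totalContent E θ) b))) ω j k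

theorem windowAverages_history (s : (exploreAlgorithm K M θ hN n harm hsel).Seed)
    (ω : ℕ → E.Noise) {t : ℕ} (ht : N + d * n ≤ t) :
    windowAverages N n (E.history (exploreAlgorithm K M θ hN n harm hsel) s ω t)
      = fun b =>
        (∑ r ∈ Finset.range n, windowReward E θ (arm := arm) b (ω (N + b * n + r))) / n := by
  funext b
  rw [windowAverages]
  congr 1
  refine Finset.sum_congr rfl fun r hr => ?_
  rw [Finset.mem_range] at hr
  have h2 : N + b * n + r < t := by
    have : (b + 1) * n ≤ d * n := Nat.mul_le_mul_right n b.2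
    nlinarith
  rw [extendRecords, dif_pos h2, E.history_apply]
  simp only [contract_window E θ hN harm hsel s ω b hr]
  rfl

theorem contract_commit (s : (exploreAlgorithm K M θ hN n harm hsel).Seed)
    (ω : ℕ → E.Noise) {t : ℕ} (ht : N + d * n ≤ t) :
    E.contract (exploreAlgorithm K M θ hN n harm hsel) s ω t
      = θ (sel (totalContent E θ, fun b =>
        (∑ r ∈ Finset.range n, windowReward E θ (arm := arm) b (ω (N + b * n + r))) / n)) := by
  have h : exploreIndex hN n arm sel t
      (E.history (exploreAlgorithm K M θ hN n harm hsel) s ω t)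
        = sel (totalContent E θ, fun b =>
          (∑ r ∈ Finset.range n, windowReward E θ (arm := arm) b (ω (N + b * n + r))) / n) := by
    rw [exploreIndex, dif_neg (by omega), if_neg (by omega),
      recordedContents_history E θ hN harm hsel s ω (by omega),
      windowAverages_history E θ hN harm hsel s ω ht]
  exact congrArg θ h

end History

end ExploreThenCommit
end

/-! ### The regret bound for linear contracts. -/

noncomputable section

section LinearRegret

variable {d K M N : ℕ}

theorem measurable_windowReward {X : Type} [MeasurableSpace X] {pay : X → Vec d → ℝ → ℝ}
    (E : CreatorMarket d K M pay) (θ : Fin N → X) (arm : (Fin N → Vec d) → Fin d → Fin N)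
    (b : Fin d) : Measurable (windowReward E θ (arm := arm) b) := by
  have := E.measurable_reward_left fun k => E.response k (θ (arm (totalContent E θ) b))
  unfold windowReward
  fun_prop

theorem integral_windowReward (E : CreatorMarket d K M (linearPay d)) {v : Vec d}
    (hv : ∀ c : E.C, E.totalReward c = inner ℝ v (c : Vec d)) (θ : Fin N → unitBall d)
    (arm : (Fin N → Vec d) → Fin d → Fin N) (b : Fin d) :
    ∫ ω, windowReward E θ (arm := arm) b ω ∂E.noise
      = inner ℝ v (totalContent E θ (arm (totalContent E θ) b)) := by
  simp only [windowReward]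
  rw [E.integral_sum_reward, totalContent, inner_sum]
  exact Finset.sum_congr rfl fun k _ => hv _

/-- The window plays one fixed contract `r²` times, so the sum deviates by order `K M r` and its
average by order `K M / r`. -/
theorem integral_abs_windowAverage_sub_le (hK : 1 ≤ K) (hM : 1 ≤ M)
    (E : CreatorMarket d K M (linearPay d)) {v : Vec d}
    (hv : ∀ c : E.C, E.totalReward c = inner ℝ v (c : Vec d)) (θ : Fin N → unitBall d)
    (arm : (Fin N → Vec d) → Fin d → Fin N) (b : Fin d) {S : Type} [MeasurableSpace S]
    (σ : Measure S) [IsProbabilityMeasure σ] {r : ℕ} (hr : 1 ≤ r) (m : ℕ) :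
    ∫ p, |(∑ s ∈ Finset.range (r ^ 2), windowReward E θ (arm := arm) b (p.2 (m + s)))
        / (r ^ 2 : ℕ) - inner ℝ v (totalContent E θ (arm (totalContent E θ) b))|
      ∂(σ.prod (Measure.infinitePi fun _ : ℕ => E.noise)) ≤ 4 * (K * M) / r := by
  set y := inner ℝ v (totalContent E θ (arm (totalContent E θ) b)) with hy
  have hr' : (0 : ℝ) < r := by exact_mod_cast hr
  have hKM : (0 : ℝ) < K * M := by
    have : 0 < K * M := Nat.mul_pos hK hM
    exact_mod_cast this
  have hm := measurable_windowReward E θ arm b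
  have hX : ∀ ω, windowReward E θ (arm := arm) b ω ∈ Set.Icc (0 : ℝ) (K * M) := fun ω =>
    E.sum_reward_mem _ ω
  have hXi : Integrable (windowReward E θ (arm := arm) b) E.noise :=
    integrable_of_abs_le hm (C := K * M) fun ω => by
      rw [abs_of_nonneg (hX ω).1]; exact (hX ω).2
  have hyX : ∫ ω, windowReward E θ (arm := arm) b ω ∂E.noise = y :=
    integral_windowReward E hv θ arm b
  have hy0 : 0 ≤ y := hyX ▸ integral_nonneg fun ω => (hX ω).1
  have hy1 : y ≤ K * M := by
    have := integral_mono hXi (integrable_const ((K : ℝ) * M)) fun ω => (hX ω).2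
    rw [hyX] at this
    simpa using this
  have h := integral_abs_sum_window_le σ E.noise
    (f := fun ω => windowReward E θ (arm := arm) b ω - y) (hm.sub_const y) hKM
    (fun ω => by
      rw [abs_le]
      constructor <;> linarith [(hX ω).1, (hX ω).2])
    (by rw [integral_sub hXi (integrable_const _), hyX]; simp) m (n := r ^ 2) (by positivity)
  have hsq : √((r ^ 2 : ℕ) : ℝ) = r := by
    push_cast
    exact Real.sqrt_sq hr'.le
  rw [hsq] at h
  have he : ∀ p : S × (ℕ → E.Noise),
      |(∑ s ∈ Finset.range (r ^ 2), windowReward E θ (arm := arm) b (p.2 (m + s)))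
        / (r ^ 2 : ℕ) - y|
      = (1 / (r : ℝ) ^ 2) * |∑ s ∈ Finset.range (r ^ 2),
        (windowReward E θ (arm := arm) b (p.2 (m + s)) - y)| := fun p => by
    have h0 : (1 / (r : ℝ) ^ 2) = |1 / (r : ℝ) ^ 2| := (abs_of_nonneg (by positivity)).symm
    rw [h0, ← abs_mul, Finset.sum_sub_distrib, Finset.sum_const, Finset.card_range, nsmul_eq_mul]
    congr 1
    push_cast
    field_simp
  simp_rw [he]
  rw [integral_const_mul]
  refine (mul_le_mul_of_nonneg_left h (by positivity)).trans (le_of_eq ?_)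
  field_simp

/-- Coefficients at most one let the `d` estimation errors pass to every contract without
amplification. All estimated utilities are then within `δ + err` of the truth, and the selected
contract loses at most twice this, plus the grid loss `η`. -/
theorem regret_exploreAlgorithm_le (hK : 1 ≤ K) (hM : 1 ≤ M)
    (E : CreatorMarket d K M (linearPay d)) {v : Vec d} (hvB : v ∈ unitBall d)
    (hv : ∀ c : E.C, E.totalReward c = inner ℝ v (c : Vec d)) (θ : Fin N → unitBall d)
    (hN : 0 < N) {r : ℕ} (hr : 1 ≤ r) {arm : (Fin N → Vec d) → Fin d → Fin N}
    (harm : ∀ b, Measurable fun c => arm c b) {coef : (Fin N → Vec d) → Fin N → Fin d → ℝ}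
    (hcoef : ∀ c i b, |coef c i b| ≤ 1) {δ : ℝ} (hδ : 0 ≤ δ)
    (happrox : ∀ c i, |inner ℝ v (c i) - ∑ b, coef c i b * inner ℝ v (c (arm c b))| ≤ δ)
    {sel : (Fin N → Vec d) × (Fin d → ℝ) → Fin N} (hsel : Measurable sel)
    (hmax : ∀ x i, ∑ b, coef x.1 i b * x.2 b - inner ℝ (θ i : Vec d) (x.1 i)
      ≤ ∑ b, coef x.1 (sel x) b * x.2 b - inner ℝ (θ (sel x) : Vec d) (x.1 (sel x)))
    {η : ℝ} (hη : 0 ≤ η) (hθ : ∀ x, ∃ i, E.utility x ≤ E.utility (θ i) + η) (T : ℕ) :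
    E.regret (exploreAlgorithm K M θ hN (r ^ 2) harm hsel) T
      ≤ 2 * K * (N + d * r ^ 2) + T * (η + 2 * (δ + d * (4 * (K * M) / r))) := by
  set A := exploreAlgorithm K M θ hN (r ^ 2) harm hsel with hA
  set c := totalContent E θ with hc
  let avg : A.Seed × (ℕ → E.Noise) → Fin d → ℝ := fun p b =>
    (∑ s ∈ Finset.range (r ^ 2), windowReward E θ (arm := arm) b (p.2 (N + b * r ^ 2 + s)))
      / (r ^ 2 : ℕ)
  let err : A.Seed × (ℕ → E.Noise) → ℝ := fun p => ∑ b, |avg p b - inner ℝ v (c (arm c b))|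
  have herr0 : ∀ p, 0 ≤ err p := fun p => Finset.sum_nonneg fun b _ => abs_nonneg _
  have hr' : (0 : ℝ) < r := by exact_mod_cast hr
  have hK0 : (0 : ℝ) ≤ K := Nat.cast_nonneg K
  have hubd := abs_utility_linearPay_le hK E hvB hv
  have hbdd : BddAbove (Set.range E.utility) :=
    ⟨K, by rintro _ ⟨x, rfl⟩; exact (abs_le.1 (hubd x)).2⟩
  have : Nonempty (unitBall d) := ⟨⟨0, zero_mem_unitBall⟩⟩
  have hoptK : E.optimum ≤ K := ciSup_le fun x => (abs_le.1 (hubd x)).2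
  have hutil : ∀ i, E.utility (θ i) = inner ℝ v (c i) - inner ℝ (θ i : Vec d) (c i) := fun i => by
    rw [utility_linearPay hK E hv, ← inner_sub_left, hc, totalContent, inner_sum]
  have hest : ∀ p i, |(∑ b, coef c i b * avg p b - inner ℝ (θ i : Vec d) (c i))
      - E.utility (θ i)| ≤ δ + err p := fun p i => by
    have h1 : ∑ b, coef c i b * avg p b - ∑ b, coef c i b * inner ℝ v (c (arm c b))
        = ∑ b, coef c i b * (avg p b - inner ℝ v (c (arm c b))) := by
      rw [← Finset.sum_sub_distrib]
      exact Finset.sum_congr rfl fun b _ => by ring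
    have h2 : |∑ b, coef c i b * (avg p b - inner ℝ v (c (arm c b)))| ≤ err p := by
      refine (Finset.abs_sum_le_sum_abs _ _).trans (Finset.sum_le_sum fun b _ => ?_)
      rw [abs_mul]
      exact mul_le_of_le_one_left (abs_nonneg _) (hcoef c i b)
    have h3 := happrox c i
    rw [hutil]
    rw [abs_le] at h2 h3 ⊢
    constructor <;> linarith [h2.1, h2.2, h3.1, h3.2]
  have hcommit : ∀ p t, N + d * r ^ 2 ≤ t →
      E.optimum - E.utility (E.contract A p.1 p.2 t) ≤ η + 2 * (δ + err p) := fun p t ht => by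
    rw [contract_commit E θ hN harm hsel p.1 p.2 ht]
    set i := sel (c, avg p) with hi
    have h1 : E.optimum ≤ E.utility (θ i) + (η + 2 * (δ + err p)) := by
      refine ciSup_le fun x => ?_
      obtain ⟨j, hj⟩ := hθ x
      have h2 := abs_le.1 (hest p j)
      have h3 := abs_le.1 (hest p i)
      have h4 := hmax (c, avg p) j
      dsimp only at h4
      linarith [h2.1, h3.2]
    have h5 : E.utility (θ (sel (c, avg p))) = E.utility (θ i) := rfl
    simp only [avg] at h5 ⊢
    linarith
  -- Utilities lie in `[-K, K]`, so an exploration round costs at most `2K`.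
  have hround : ∀ p t, E.optimum - E.utility (E.contract A p.1 p.2 t)
      ≤ (if t < N + d * r ^ 2 then 2 * (K : ℝ) else 0) + (η + 2 * (δ + err p)) := fun p t => by
    have := herr0 p
    split_ifs with h
    · have := (abs_le.1 (hubd (E.contract A p.1 p.2 t))).1
      linarith
    · rw [zero_add]
      exact hcommit p t (not_lt.1 h)
  have havgm : ∀ b, Measurable fun p : A.Seed × (ℕ → E.Noise) => avg p b := fun b => by
    refine (Finset.measurable_sum _ fun s _ => ?_).div_const _
    exact (measurable_windowReward E θ arm b).comp
      ((measurable_pi_apply _).comp measurable_snd)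
  have havg : ∀ p b, avg p b ∈ Set.Icc (0 : ℝ) (K * M) := fun p b => by
    have hX : ∀ ω, windowReward E θ (arm := arm) b ω ∈ Set.Icc (0 : ℝ) (K * M) := fun ω =>
      E.sum_reward_mem _ ω
    refine ⟨div_nonneg (Finset.sum_nonneg fun s _ => (hX _).1) (Nat.cast_nonneg _), ?_⟩
    rw [div_le_iff₀ (by positivity)]
    exact (Finset.sum_le_card_nsmul _ _ _ fun s _ => (hX _).2).trans (by simp [mul_comm])
  have hei : ∀ b, Integrable (fun p => |avg p b - inner ℝ v (c (arm c b))|)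
      (A.seedLaw.prod (Measure.infinitePi fun _ : ℕ => E.noise)) := fun b => by
    refine integrable_of_abs_le (C := K * M + |inner ℝ v (c (arm c b))|)
      ((havgm b).sub_const _).abs fun p => ?_
    rw [abs_abs]
    refine (abs_sub _ _).trans ?_
    rw [abs_of_nonneg (havg p b).1]
    linarith [(havg p b).2]
  have herri : Integrable err (A.seedLaw.prod (Measure.infinitePi fun _ : ℕ => E.noise)) :=
    integrable_finsetSum _ fun b _ => hei b
  have herrE : ∫ p, err p ∂(A.seedLaw.prod (Measure.infinitePi fun _ : ℕ => E.noise))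
      ≤ d * (4 * (K * M) / r) := by
    simp only [err]
    rw [integral_finsetSum _ fun b _ => hei b]
    refine (Finset.sum_le_card_nsmul _ _ (4 * (K * M) / (r : ℝ)) fun b _ => ?_).trans (by simp)
    exact integral_abs_windowAverage_sub_le hK hM E hv θ arm b A.seedLaw hr _
  refine (E.regret_le A T hbdd
    (fun p => 2 * K * (N + d * r ^ 2) + T * (η + 2 * (δ + err p)))
    ((integrable_const _).add (((integrable_const _).add
      (((integrable_const _).add herri).const_mul 2)).const_mul _)) fun p => ?_).trans ?_
  · refine (Finset.sum_le_sum fun t _ => hround p t).trans ?_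
    rw [Finset.sum_add_distrib, Finset.sum_const, Finset.card_range, nsmul_eq_mul]
    refine add_le_add_left ?_ _
    rw [← Finset.sum_filter, Finset.sum_const, nsmul_eq_mul, mul_comm]
    refine mul_le_mul_of_nonneg_left ?_ (by linarith)
    have hcard : (Finset.filter (fun t => t < N + d * r ^ 2) (Finset.range T)).card
        ≤ N + d * r ^ 2 := by
      refine (Finset.card_le_card fun t ht => ?_).trans (Finset.card_range _).le
      exact Finset.mem_range.2 (Finset.mem_filter.1 ht).2
    exact_mod_cast hcard
  · have e : ∫ p, (2 * (K : ℝ) * (N + d * r ^ 2) + T * (η + 2 * (δ + err p)))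
        ∂(A.seedLaw.prod (Measure.infinitePi fun _ : ℕ => E.noise))
        = 2 * K * (N + d * r ^ 2) + T * (η + 2 * (δ + ∫ p, err p
          ∂(A.seedLaw.prod (Measure.infinitePi fun _ : ℕ => E.noise)))) := by
      have i1 := (integrable_const (μ := A.seedLaw.prod
        (Measure.infinitePi fun _ : ℕ => E.noise)) δ).add herri
      generalize 2 * (K : ℝ) * (N + d * r ^ 2) = w
      rw [integral_add (integrable_const _), integral_const_mul, integral_add (integrable_const _),
        integral_const_mul, integral_add (integrable_const _) herri]
      · simp
      · exact i1.const_mul 2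
      · exact ((integrable_const _).add (i1.const_mul 2)).const_mul _
    rw [e]
    gcongr

theorem exists_root (d T : ℕ) (hT : 1 ≤ T) :
    ∃ r : ℕ, 1 ≤ r ∧ T ≤ r ^ (2 * d + 1) ∧
      (r : ℝ) ^ (2 * d) ≤ 4 ^ d * (T : ℝ) ^ (2 * (d : ℝ) / (2 * (d : ℝ) + 1)) := by
  have hT' : (1 : ℝ) ≤ T := by exact_mod_cast hT
  have hd : (0 : ℝ) < 2 * (d : ℝ) + 1 := by positivity
  set x := (T : ℝ) ^ ((1 : ℝ) / (2 * (d : ℝ) + 1)) with hx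
  have hx1 : 1 ≤ x := Real.one_le_rpow hT' (by positivity)
  have hxp : x ^ (2 * d + 1) = T := by
    rw [hx, ← Real.rpow_natCast, ← Real.rpow_mul (by linarith)]
    push_cast
    rw [one_div, inv_mul_cancel₀ hd.ne', Real.rpow_one]
  have hx2 : x ^ (2 * d) = (T : ℝ) ^ (2 * (d : ℝ) / (2 * (d : ℝ) + 1)) := by
    rw [hx, ← Real.rpow_natCast, ← Real.rpow_mul (by linarith)]
    push_cast
    congr 1
    ring
  refine ⟨⌈x⌉₊, Nat.one_le_ceil_iff.2 (by linarith), ?_, ?_⟩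
  · have : (T : ℝ) ≤ (⌈x⌉₊ : ℝ) ^ (2 * d + 1) := by
      rw [← hxp]
      exact pow_le_pow_left₀ (by linarith) (Nat.le_ceil x) _
    exact_mod_cast this
  · have h1 := Nat.ceil_lt_add_one (by linarith : 0 ≤ x)
    have h2 : (⌈x⌉₊ : ℝ) ≤ 2 * x := by linarith
    refine (pow_le_pow_left₀ (Nat.cast_nonneg _) h2 _).trans (le_of_eq ?_)
    rw [mul_pow, hx2, pow_mul]
    norm_num

/-- The grid has `(r² + 1)^d ≤ 2^d r^(2d)` points, each played once, and every approximation and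
estimation error is of order `1/r`. Since `T ≤ r^(2d+1)`, the committed rounds also cost of order
`r^(2d)`. -/
theorem exists_algorithm_linearPay (hK : 1 ≤ K) (hM : 1 ≤ M) (hd : 1 ≤ d) (T : ℕ) (hT : 1 ≤ T) :
    ∃ A : Algorithm (unitBall d) d K M, ∀ E : CreatorMarket d K M (linearPay d),
      ∀ u : Fin M → Vec d, (∀ j c, E.meanReward j c = inner ℝ (u j) (c : Vec d)) →
        ∑ j, u j ∈ unitBall d →
        E.regret A T ≤ (4 ^ d * (2 * K * (2 ^ d + d) + (K * (1 + 2 * d) + 2 * d + 8 * d * (K * M))))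
          * (T : ℝ) ^ (2 * (d : ℝ) / (2 * (d : ℝ) + 1)) := by
  obtain ⟨r, hr, hTr, hrT⟩ := exists_root d T hT
  have hr' : (1 : ℝ) ≤ r := by exact_mod_cast hr
  have hr0 : (0 : ℝ) < r := by linarith
  set N := Fintype.card (Fin d → Fin (r ^ 2 + 1)) with hNdef
  have hNcard : N = (r ^ 2 + 1) ^ d := by rw [hNdef]; simp
  have hN : 0 < N := by rw [hNcard]; positivity
  have : Nonempty (Fin N) := ⟨⟨0, hN⟩⟩
  let toGrid := (Fintype.equivFin (Fin d → Fin (r ^ 2 + 1))).symm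
  let θ : Fin N → unitBall d := fun i => gridVector d (r ^ 2) (toGrid i)
  obtain ⟨arm, coef, harm, hcoefm, hcoef, happrox⟩ :=
    exists_measurable_spanner (d := d) hN (ε := 1 / r) (by positivity)
  obtain ⟨sel, hsel, hmax⟩ := exists_measurable_argmax
    (fun (i : Fin N) (x : (Fin N → Vec d) × (Fin d → ℝ)) =>
      ∑ b, coef x.1 i b * x.2 b - inner ℝ (θ i : Vec d) (x.1 i)) (fun i => by
        refine Measurable.sub (Finset.measurable_sum _ fun b _ => ?_) ?_
        · exact ((hcoefm i b).comp measurable_fst).mul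
            ((measurable_pi_apply b).comp measurable_snd)
        · exact Measurable.inner measurable_const
            ((measurable_pi_apply i).comp measurable_fst))
  refine ⟨exploreAlgorithm K M θ hN (r ^ 2) harm hsel, fun E u hu hvB => ?_⟩
  have hv := totalReward_eq_inner hK E u hu
  refine (regret_exploreAlgorithm_le hK hM E hvB hv θ hN hr harm hcoef
    (δ := d * (1 / r)) (by positivity) (fun c i => happrox c i _ hvB) hsel (fun x i => hmax x i)
    (η := K * ((1 + 2 * d) / r)) (by positivity) (fun x => ?_) T).trans ?_
  · obtain ⟨g, hg⟩ := exists_gridVector_utility hK E hvB hv hr x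
    refine ⟨toGrid.symm g, ?_⟩
    simpa [θ] using hg
  · have hR : (1 : ℝ) ≤ (r : ℝ) ^ (2 * d) := one_le_pow₀ hr'
    have hTR : (T : ℝ) / r ≤ (r : ℝ) ^ (2 * d) := by
      rw [div_le_iff₀ hr0, ← pow_succ]
      exact_mod_cast hTr
    have hNR : (N : ℝ) ≤ 2 ^ d * (r : ℝ) ^ (2 * d) := by
      rw [hNcard, pow_mul, ← mul_pow]
      push_cast
      exact pow_le_pow_left₀ (by positivity) (by nlinarith) d
    have hrR : (r : ℝ) ^ 2 ≤ (r : ℝ) ^ (2 * d) := pow_le_pow_right₀ hr' (by omega)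
    have e : 2 * (K : ℝ) * (N + d * r ^ 2) + T * (K * ((1 + 2 * d) / r)
        + 2 * (d * (1 / r) + d * (4 * (K * M) / r)))
        = 2 * K * (N + d * r ^ 2)
          + (K * (1 + 2 * d) + 2 * d + 8 * d * (K * M)) * (T / r) := by
      field_simp
      ring
    rw [e]
    calc 2 * (K : ℝ) * (N + d * r ^ 2) + (K * (1 + 2 * d) + 2 * d + 8 * d * (K * M)) * (T / r)
        ≤ 2 * K * (2 ^ d * (r : ℝ) ^ (2 * d) + d * (r : ℝ) ^ (2 * d))
          + (K * (1 + 2 * d) + 2 * d + 8 * d * (K * M)) * (r : ℝ) ^ (2 * d) := by gcongr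
      _ = (2 * K * (2 ^ d + d) + (K * (1 + 2 * d) + 2 * d + 8 * d * (K * M)))
          * (r : ℝ) ^ (2 * d) := by ring
      _ ≤ (2 * K * (2 ^ d + d) + (K * (1 + 2 * d) + 2 * d + 8 * d * (K * M)))
          * (4 ^ d * (T : ℝ) ^ (2 * (d : ℝ) / (2 * (d : ℝ) + 1))) := by gcongr
      _ = _ := by ring

end LinearRegret
end
theorem theorem4 (K M : ℕ) (hK : 1 ≤ K) (hM : 1 ≤ M) :
    -- return-based contracts: the optimal expected regret is of order `T^(2/3)`
    (∃ a b : ℝ, 0 < a ∧ 0 < b ∧ ∀ d : ℕ, 1 ≤ d → ∀ T : ℕ, 1 ≤ T →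
      (∃ A : Algorithm (Set.Icc (0 : ℝ) 1) d K M,
        ∀ E : CreatorMarket d K M (returnPay d),
          E.regret A T ≤ b * (T : ℝ) ^ ((2 : ℝ) / 3)) ∧
      (∀ A : Algorithm (Set.Icc (0 : ℝ) 1) d K M,
        ∃ E : CreatorMarket d K M (returnPay d),
          E.C = unitBall d ∧ (∃ x, ∀ y, E.utility y ≤ E.utility x) ∧
          a * (T : ℝ) ^ ((2 : ℝ) / 3) ≤ E.regret A T)) ∧
    -- linear feature-based contracts, contents in the unit ball, linear expected rewards
    (∀ d : ℕ, 1 ≤ d → ∃ b : ℝ, 0 < b ∧ ∀ T : ℕ, 1 ≤ T →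
      ∃ A : Algorithm (unitBall d) d K M,
        ∀ E : CreatorMarket d K M (linearPay d), E.C = unitBall d →
          ∀ u : Fin M → Vec d, (∀ j c, E.meanReward j c = inner ℝ (u j) (c : Vec d)) →
            ∑ j, u j ∈ unitBall d →
            E.regret A T ≤ b * (T : ℝ) ^ (2 * (d : ℝ) / (2 * (d : ℝ) + 1))) := by
  have hKM : (0 : ℝ) < K * M := by
    have : 0 < K * M := Nat.mul_pos hK hM
    exact_mod_cast this
  refine ⟨⟨1 / 256, K * M * 240000, by norm_num, by positivity, fun d hd T hT =>
    ⟨exists_algorithm_returnPay hK hM d T hT, exists_market_le_regret hK hM hd hT⟩⟩,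
    fun d hd => ⟨4 ^ d * (2 * K * (2 ^ d + d) + (K * (1 + 2 * d) + 2 * d + 8 * d * (K * M))), ?_,
      fun T hT => ?_⟩⟩
  · have hK' : (0 : ℝ) < K := by exact_mod_cast hK
    positivity
  · obtain ⟨A, hA⟩ := exists_algorithm_linearPay hK hM hd T hT
    exact ⟨A, fun E _ => hA E⟩
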